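/- **Setting.** Let $M=\mathbb{R}^4$ be Minkowski space with signature $(+,-,-,-)$, points $x=(x^0,\mathbf{x})$, $x^2=(x^0)^2-|\mathbf{x}|^2$, $x\cdot\nabla=x^a\nabla_a$, and let $|x|$ be the Euclidean norm of the four coordinates. Let $\theta$ be the Heaviside function and let $0<\varepsilon<\tfrac12$. Call a vector field $J$ on $M$ *admissible* if it is of class $C^3$, conserved ($\nabla_aJ^a=0$), and for some constant $K$ and all $x$ $$|\nabla^\alpha J(x)|\le \frac{K}{(|x|+1)^{3+|\alpha|}}\Big[\theta(x^2)+\frac1{(|x|+1)^{\varepsilon}}\Big]\quad(|\alpha|\le3),$$ $$|\nabla^\alpha (x\cdot\nabla+3)J(x)|\le \frac{K}{(|x|+1)^{3+|\alpha|+\varepsilon}}\quad(|\alpha|\le2).$$ Its retarded and advanced potentials are $$A_{\mathrm{ret}/\mathrm{adv}}(x)=\int_{\mathbb{R}^3}\frac{J(x^0\mp|\mathbf{y}|,\mathbf{x}+\mathbf{y})}{|\mathbf{y}|}\,d^3y ,$$ and its radiated potential is $A_{\mathrm{rad}}=A_{\mathrm{ret}}-A_{\mathrm{adv}}$. Let $J$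 and $J_{\mathrm{inc}}$ be admissible with the same $\varepsilon$, and let $A=A_{\mathrm{ret}}[J]+A_{\mathrm{rad}}[J_{\mathrm{inc}}]$ and $F_{ab}=\nabla_aA_b-\nabla_bA_a$. Write $\langle s\rangle=(s^2+1)^{1/2}$ for real $s$ and $\langle z\rangle=(|z|^2+1)^{1/2}$ for $z\in\mathbb{R}^3$. Global coordinates $(\tau,z)\in\mathbb{R}\times\mathbb{R}^3$ on $M$ are defined by $x^0=\tau\langle z\rangle$, $\mathbf{x}=\langle\tau\rangle z$. Put $\partial_\tau=\partial/\partial\tau$, $\partial_i=\partial/\partial z^i$, and denote components in these coordinates by a hat: $\hat B_\mu=(\partial_\mu x^a)B_a$, $\hat F_{\mu\nu}=(\partial_\mu x^a)(\partial_\nu x^b)F_{ab}$. The special gauge potential is $$\mathcal{A}_a=A_a-\nabla_aS,\qquad S(x)=\log(\langle\tau\rangle\langle z\rangle)\,x^aA_a(x).$$ **Theorem.** The potential $A$ is of class $C^3$, the components $\hat{\mathcal{A}}_\mu(\tau,z)$ are of class $C^2$, and there is a constant $C$ (depending on $J,J_{\mathrm{inc}},\varepsilon$) such that for all $(\tau,z)$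 and all $i,j\in\{1,2,3\}$, with summation over repeated spatial indices within a product, $$|\hat F_{i\tau}|\le\frac{C}{\langle\tau\rangle\langle z\rangle},\quad |z^i\hat F_{i\tau}|\le\frac{C}{\langle\tau\rangle},\quad |\hat F_{ij}|\le C,\quad |z^i\hat F_{ij}|\le\frac{C}{\langle z\rangle},$$ $$|\hat{\mathcal A}_\tau|\le C\Big[\frac{1+\log\langle\tau\rangle}{\langle\tau\rangle^{1+\varepsilon}}+\frac{\log\langle z\rangle}{\langle\tau\rangle^3}\Big],$$ $$|\hat{\mathcal A}_i|\le C\,\frac{1+\log(\langle\tau\rangle\langle z\rangle)}{\langle z\rangle},\qquad |z^i\hat{\mathcal A}_i|\le C\,\frac{1+\log(\langle\tau\rangle\langle z\rangle)}{\langle z\rangle^{\varepsilon}},$$ $$|\partial_i\hat{\mathcal A}_\tau|+|z^k\partial_k\hat{\mathcal A}_\tau|\le C\,\frac{1+\log\langle\tau\rangle}{\langle\tau\rangle^{1+\varepsilon}},\qquad |\partial_\tau\hat{\mathcal A}_i|+|z^k\partial_\tau\hat{\mathcal A}_k|\le\frac{C}{\langle\tau\rangle},$$ $$|\partial_i\hat{\mathcal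 A}_j|\le C(1+\log\langle\tau\rangle),\qquad |z^i\partial_i\hat{\mathcal A}_j|+|z^i\partial_j\hat{\mathcal A}_i|\le C\,\frac{1+\log(\langle\tau\rangle\langle z\rangle)}{\langle z\rangle},$$ $$|z^iz^j\partial_i\hat{\mathcal A}_j|\le C\,\frac{1+\log(\langle\tau\rangle\langle z\rangle)}{\langle z\rangle^{\varepsilon}}.$$ -/

import Mathlib

open MeasureTheory

noncomputable section

/-- Minkowski spacetime in a fixed inertial frame. A point `x` has time coordinate `x 0` and space
coordinates `x 1, x 2, x 3`; the norm `‖x‖` is the Euclidean norm `|x|` of the four coordinates. -/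
abbrev Spacetime : Type := EuclideanSpace ℝ (Fin 4)

/-- Three-dimensional Euclidean space. -/
abbrev Space : Type := EuclideanSpace ℝ (Fin 3)

/-- The spacetime point `(t, y)` with time coordinate `t` and space part `y`. -/
def event (t : ℝ) (y : Space) : Spacetime :=
  WithLp.toLp 2 (Fin.cons t (fun i => y i))

/-- The space part of a spacetime point. -/
def spacePart (x : Spacetime) : Space :=
  WithLp.toLp 2 (fun i => x i.succ)

/-- Diagonal entries of the Minkowski metric, of signature `(+,-,-,-)`. -/
def metricSign (a : Fin 4) : ℝ := if a = 0 then 1 else -1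

/-- The Minkowski square `x² = (x⁰)² - |𝐱|²`. -/
def minkSq (x : Spacetime) : ℝ := ∑ a, metricSign a * x a ^ 2

/-- The Heaviside step function. -/
def heaviside (s : ℝ) : ℝ := if 0 ≤ s then 1 else 0

/-- The partial derivative `∇_a f` in the Minkowski coordinates. -/
def nabla (a : Fin 4) (f : Spacetime → ℝ) (x : Spacetime) : ℝ :=
  fderiv ℝ f x (EuclideanSpace.single a 1)

/-- The vector field `(x · ∇ + 3) J`. -/
def eulerThree (J : Spacetime → Spacetime) (x : Spacetime) : Spacetime :=
  fderiv ℝ J x x + (3 : ℝ) • J x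

/-- The admissible currents `J` (contravariant components `J^a`): conserved, of class `C³`, with
`|∇^α J(x)| ≤ K (|x|+1)^{-3-|α|} [θ(x²) + (|x|+1)^{-ε}]` for `|α| ≤ 3` and
`|∇^α (x·∇+3) J(x)| ≤ K (|x|+1)^{-3-|α|-ε}` for `|α| ≤ 2`. The collection of all partial
derivatives of order `n` is measured by the norm of the `n`-th iterated Fréchet derivative. -/
structure IsScatteringCurrent (ε : ℝ) (J : Spacetime → Spacetime) : Prop where
  contDiff : ContDiff ℝ 3 J
  conserved : ∀ x, ∑ a, nabla a (fun y => J y a) x = 0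
  decay : ∃ K : ℝ, ∀ n : ℕ, n ≤ 3 → ∀ x : Spacetime,
    ‖iteratedFDeriv ℝ n J x‖ ≤
      K / (‖x‖ + 1) ^ (3 + n) * (heaviside (minkSq x) + 1 / (‖x‖ + 1) ^ ε)
  decay_euler : ∃ K : ℝ, ∀ n : ℕ, n ≤ 2 → ∀ x : Spacetime,
    ‖iteratedFDeriv ℝ n (eulerThree J) x‖ ≤ K / (‖x‖ + 1) ^ (3 + (n : ℝ) + ε)

/-- The retarded potential `A_ret^a(x) = ∫ J^a(x⁰ - |y|, 𝐱 + y) / |y| d³y`, that is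
`4π ∫ D_ret(x - y) J^a(y) d⁴y` with `D_ret(x) = (2π)⁻¹ θ(x⁰) δ(x²)`. -/
def retardedPotential (J : Spacetime → Spacetime) (x : Spacetime) : Spacetime :=
  ∫ y : Space, ‖y‖⁻¹ • J (event (x 0 - ‖y‖) (spacePart x + y))

/-- The advanced potential `A_adv^a(x) = ∫ J^a(x⁰ + |y|, 𝐱 + y) / |y| d³y`. -/
def advancedPotential (J : Spacetime → Spacetime) (x : Spacetime) : Spacetime :=
  ∫ y : Space, ‖y‖⁻¹ • J (event (x 0 + ‖y‖) (spacePart x + y))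

/-- The radiated potential `A_rad = A_ret - A_adv` of a current. -/
def radiatedPotential (J : Spacetime → Spacetime) (x : Spacetime) : Spacetime :=
  retardedPotential J x - advancedPotential J x

/-- The covariant components `A_a = η_{ab} A^b` of the Lorenz potential `A = A_ret + A_inc`, where
`A_ret` is the retarded potential of `J` and `A_inc` the radiated potential of `Jinc`. -/
def lorenzPotential (J Jinc : Spacetime → Spacetime) (x : Spacetime) (a : Fin 4) : ℝ :=
  metricSign a * (retardedPotential J x a + radiatedPotential Jinc x a)

/-- The electromagnetic field `F_{ab} = ∇_a A_b - ∇_b A_a` of a covariant potential. -/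
def fieldStrength (A : Spacetime → Fin 4 → ℝ) (x : Spacetime) (a b : Fin 4) : ℝ :=
  nabla a (fun y => A y b) x - nabla b (fun y => A y a) x

/-- The bracket `⟨s⟩ = (s² + 1)^{1/2}`; for a vector `z` one writes `⟨z⟩ = ⟨|z|⟩`. -/
def bracket (s : ℝ) : ℝ := √(s ^ 2 + 1)

/-- The change of coordinates `(τ, z) ↦ x`, with `x⁰ = τ⟨z⟩` and `𝐱 = ⟨τ⟩z`. -/
def chart (p : ℝ × Space) : Spacetime :=
  event (p.1 * bracket ‖p.2‖) (bracket p.1 • p.2)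

/-- `τ² + |z|² + 1` as a function on spacetime. -/
def chartSum (x : Spacetime) : ℝ :=
  √((1 + minkSq x) ^ 2 + 4 * ‖spacePart x‖ ^ 2)

/-- The coordinate `τ` as a function on spacetime; see `chart_coords` and `tauOf_chart`. -/
def tauOf (x : Spacetime) : ℝ := x 0 / √((chartSum x + 1 - minkSq x) / 2)

/-- The coordinates `z` as functions on spacetime; see `chart_coords` and `zOf_chart`. -/
def zOf (x : Spacetime) : Space := (√((chartSum x + 1 + minkSq x) / 2))⁻¹ • spacePart x

/-- The special gauge function `S(x) = log(⟨τ⟩⟨z⟩) x^a A_a(x)`. -/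
def specialGauge (A : Spacetime → Fin 4 → ℝ) (x : Spacetime) : ℝ :=
  Real.log (bracket (tauOf x) * bracket ‖zOf x‖) * ∑ a, x a * A x a

/-- The special gauge potential `𝒜_a = A_a - ∇_a S`. -/
def gaugedPotential (A : Spacetime → Fin 4 → ℝ) (x : Spacetime) (a : Fin 4) : ℝ :=
  A x a - nabla a (specialGauge A) x

/-- Coordinate directions in the `(τ, z)`-space: the index `0` stands for `τ` and the index
`i.succ` for `z^i`. -/
def coordVec (μ : Fin 4) : ℝ × Space :=
  Fin.cases ((1 : ℝ), (0 : Space)) (fun i => ((0 : ℝ), EuclideanSpace.single i (1 : ℝ))) μ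

/-- The partial derivative `∂_μ` in the coordinates `(τ, z)`. -/
def pd (μ : Fin 4) (f : ℝ × Space → ℝ) (p : ℝ × Space) : ℝ :=
  fderiv ℝ f p (coordVec μ)

/-- The Jacobian entry `∂x^a/∂ξ^μ`, where `ξ = (τ, z)`. -/
def jac (a μ : Fin 4) (p : ℝ × Space) : ℝ := pd μ (fun q => chart q a) p

/-- Components `Â_μ = (∂_μ x^a) A_a` of a covector field in the coordinates `(τ, z)`. -/
def hatCovector (A : Spacetime → Fin 4 → ℝ) (μ : Fin 4) (p : ℝ × Space) : ℝ :=
  ∑ a, jac a μ p * A (chart p) a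

/-- Components `F̂_{μν} = (∂_μ x^a)(∂_ν x^b) F_{ab}` of a 2-tensor in the coordinates `(τ, z)`. -/
def hatTensor (F : Spacetime → Fin 4 → Fin 4 → ℝ) (μ ν : Fin 4) (p : ℝ × Space) : ℝ :=
  ∑ a, ∑ b, jac a μ p * jac b ν p * F (chart p) a b

theorem minkSq_event (t : ℝ) (y : Space) : minkSq (event t y) = t ^ 2 - ‖y‖ ^ 2 := by
  rw [EuclideanSpace.norm_sq_eq]
  simp [minkSq, event, metricSign, Fin.sum_univ_succ]
  ring

theorem spacePart_event (t : ℝ) (y : Space) : spacePart (event t y) = y := by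
  ext i
  simp [spacePart, event]

theorem event_zero (t : ℝ) (y : Space) : event t y 0 = t := by
  simp [event]

theorem event_spacePart (x : Spacetime) : event (x 0) (spacePart x) = x := by
  ext i
  refine Fin.cases ?_ (fun j => ?_) i <;> simp [event, spacePart]

theorem bracket_sq (s : ℝ) : bracket s ^ 2 = s ^ 2 + 1 := Real.sq_sqrt (by positivity)

theorem bracket_pos (s : ℝ) : 0 < bracket s := Real.sqrt_pos.2 (by positivity)

theorem bracket_eq {s b : ℝ} (hb : 0 ≤ b) (h : s ^ 2 + 1 = b ^ 2) : bracket s = b := by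
  rw [bracket, h, Real.sqrt_sq hb]

theorem chartSum_chart (p : ℝ × Space) : chartSum (chart p) = p.1 ^ 2 + ‖p.2‖ ^ 2 + 1 := by
  have h1 := bracket_sq p.1
  have h2 := bracket_sq ‖p.2‖
  rw [chartSum, chart, minkSq_event, spacePart_event, norm_smul, Real.norm_eq_abs, mul_pow,
    mul_pow, sq_abs, h1, h2]
  rw [← Real.sqrt_sq (show 0 ≤ p.1 ^ 2 + ‖p.2‖ ^ 2 + 1 by positivity)]
  congr 1
  ring

theorem minkSq_chart (p : ℝ × Space) : minkSq (chart p) = p.1 ^ 2 - ‖p.2‖ ^ 2 := by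
  rw [chart, minkSq_event, norm_smul, Real.norm_eq_abs, mul_pow, mul_pow, sq_abs,
    bracket_sq, bracket_sq]
  ring

/-- `tauOf` recovers `τ`. -/
theorem tauOf_chart (p : ℝ × Space) : tauOf (chart p) = p.1 := by
  have h : (chartSum (chart p) + 1 - minkSq (chart p)) / 2 = ‖p.2‖ ^ 2 + 1 := by
    rw [chartSum_chart, minkSq_chart]; ring
  rw [tauOf, h, chart, event_zero]
  exact mul_div_cancel_right₀ _ (bracket_pos ‖p.2‖).ne'

/-- `zOf` recovers `z`. -/
theorem zOf_chart (p : ℝ × Space) : zOf (chart p) = p.2 := by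
  have h : (chartSum (chart p) + 1 + minkSq (chart p)) / 2 = p.1 ^ 2 + 1 := by
    rw [chartSum_chart, minkSq_chart]; ring
  rw [zOf, h, chart, spacePart_event]
  exact inv_smul_smul₀ (bracket_pos p.1).ne' _

/-- `(τ, z)` are global coordinates: every event is `chart (τ, z)` with `τ, z` given by `tauOf` and
`zOf`. -/
theorem chart_coords (x : Spacetime) : chart (tauOf x, zOf x) = x := by
  have hm : minkSq x = x 0 ^ 2 - ‖spacePart x‖ ^ 2 := by
    conv_lhs => rw [← event_spacePart x]
    rw [minkSq_event]
  have hD0 : 0 ≤ chartSum x := Real.sqrt_nonneg _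
  have hD : chartSum x ^ 2 = (1 + minkSq x) ^ 2 + 4 * ‖spacePart x‖ ^ 2 :=
    Real.sq_sqrt (by positivity)
  have hr : 0 ≤ ‖spacePart x‖ := norm_nonneg _
  have ht : 0 < (chartSum x + 1 + minkSq x) / 2 := by
    by_contra hcon
    have h1 : chartSum x ≤ -(1 + minkSq x) := by linarith
    nlinarith [sq_nonneg (x 0), sq_nonneg ‖spacePart x‖]
  have hz : 0 < (chartSum x + 1 - minkSq x) / 2 := by
    by_contra hcon
    have h1 : chartSum x + 1 ≤ minkSq x := by linarith
    nlinarith [sq_nonneg (x 0), sq_nonneg ‖spacePart x‖]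
  set t := √((chartSum x + 1 + minkSq x) / 2) with htdef
  set w := √((chartSum x + 1 - minkSq x) / 2) with hwdef
  have htp : 0 < t := Real.sqrt_pos.2 ht
  have hwp : 0 < w := Real.sqrt_pos.2 hz
  have ht2 : t ^ 2 = (chartSum x + 1 + minkSq x) / 2 := Real.sq_sqrt ht.le
  have hw2 : w ^ 2 = (chartSum x + 1 - minkSq x) / 2 := Real.sq_sqrt hz.le
  have hbz : bracket ‖zOf x‖ = w := by
    refine bracket_eq hwp.le ?_
    rw [zOf, ← htdef, norm_smul, norm_inv, Real.norm_eq_abs, abs_of_pos htp]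
    field_simp
    rw [ht2, hw2]
    nlinarith
  have hbt : bracket (tauOf x) = t := by
    refine bracket_eq htp.le ?_
    rw [tauOf, ← hwdef]
    field_simp
    rw [ht2, hw2]
    nlinarith
  have e1 : tauOf x * w = x 0 := by
    rw [tauOf, ← hwdef]
    field_simp
  have e2 : t • zOf x = spacePart x := by
    rw [zOf, ← htdef]
    exact smul_inv_smul₀ htp.ne' _
  rw [chart]
  simp only [hbz, hbt, e1, e2]
  exact event_spacePart x

end

noncomputable section

open Filter Topology Set

/-! ### Events and null vectors -/

/-! Retarded and advanced potentials are integrals over a light cone, A(x) = ∫ J(x + k(y)) / |y| d³y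
with k(y) = `nullVec σ y`, and derivatives in x pass under the integral. The theorem rests on two
total divergences on the cone, on the size of cone integrals of power weights, and on cancellations
in the coordinates (τ, z).

Divergences. The operator x·∇ takes the potential of f to the potential of (p·∇ + 2)f, because the
difference of the integrands is the divergence of f(x + k) y/|y| (`conePotential_fderiv_self`). For
a conserved current the flux of ∂_b J through the cone vanishes (`integral_flux_eq_zero`), so
∇_b(x·A) is the potential of ∇_b(p·J). Together, (x·∇)(x·A) is the potential of p·(p·∇ + 3)J, which
decays like |p|^(-2-ε). Thus x·A, itself merely bounded, has a radial derivative of order |x|^(-ε).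

Sizes. Bipolar coordinates turn a cone integral of a weight (1 + |p|)^(-m) into an integral over a
null coordinate. With d = `coneDist x` the result is of order (1 + |x|)^(-1) d^(-(m-3)) for m > 3
and (1 + |x|)^(-(m-2)) for 2 < m < 3. At m = 3 this method would produce a logarithm; it is absent
because the leading part of a current is supported inside the light cone of the origin
(`lintegral_timelikeMajorant_le`). The outcome is collected in `PotentialBounds`.

Coordinates. One has ⟨τ⟩⟨z⟩ ≤ 1 + |x| and ⟨τ⟩² + ⟨z⟩² ≤ 2(1 + |x|) d, so every bound becomes a
monomial in ⟨τ⟩, ⟨z⟩, possibly divided by ⟨τ⟩² + ⟨z⟩². Both ∂_τ x and z^i ∂_i x are combinations of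
x and the time axis. The function S is chosen so that the undifferentiated x·A cancels in the τ
component and, up to a factor ⟨z⟩^(-2), in the contraction with z; what remains involves (x·∇)(x·A)
and single components. The field strength is better when contracted with x, since x^a F_ab =
(x·∇)A_b + A_b - ∇_b(x·A). Time derivatives and the mixed contractions of ∂_i 𝒜̂_j then come from
the identity that the exterior derivative of 𝒜 is F. -/

theorem event_apply_succ (t : ℝ) (y : Space) (i : Fin 3) : event t y i.succ = y i := by
  simp [event]

theorem norm_event_sq (t : ℝ) (y : Space) : ‖event t y‖ ^ 2 = t ^ 2 + ‖y‖ ^ 2 := by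
  rw [EuclideanSpace.norm_sq_eq, EuclideanSpace.norm_sq_eq, Fin.sum_univ_succ]
  simp [event]

theorem norm_sq_eq_time_space (x : Spacetime) : ‖x‖ ^ 2 = x 0 ^ 2 + ‖spacePart x‖ ^ 2 := by
  conv_lhs => rw [← event_spacePart x]
  exact norm_event_sq _ _

theorem norm_le_norm_event (t : ℝ) (y : Space) : ‖y‖ ≤ ‖event t y‖ :=
  le_of_sq_le_sq (by rw [norm_event_sq]; nlinarith [sq_nonneg t]) (norm_nonneg _)

theorem abs_time_le_norm (x : Spacetime) : |x 0| ≤ ‖x‖ :=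
  abs_le_of_sq_le_sq (by rw [norm_sq_eq_time_space]; nlinarith [sq_nonneg ‖spacePart x‖])
    (norm_nonneg _)

theorem norm_spacePart_le (x : Spacetime) : ‖spacePart x‖ ≤ ‖x‖ := by
  conv_rhs => rw [← event_spacePart x]
  exact norm_le_norm_event _ _

theorem norm_event_le (t : ℝ) (y : Space) : ‖event t y‖ ≤ |t| + ‖y‖ :=
  le_of_sq_le_sq (by
    rw [norm_event_sq, ← sq_abs t]; nlinarith [mul_nonneg (abs_nonneg t) (norm_nonneg y)])
    (by positivity)

theorem event_add (s t : ℝ) (y z : Space) : event (s + t) (y + z) = event s y + event t z := by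
  ext i
  refine Fin.cases ?_ (fun j => ?_) i <;> simp [event]

theorem event_smul (c t : ℝ) (y : Space) : event (c * t) (c • y) = c • event t y := by
  ext i
  refine Fin.cases ?_ (fun j => ?_) i <;> simp [event]

/-- `event` as a continuous linear map. -/
def eventL : ℝ × Space →L[ℝ] Spacetime :=
  LinearMap.toContinuousLinearMap
    { toFun := fun p => event p.1 p.2
      map_add' := fun _ _ => event_add _ _ _ _
      map_smul' := fun _ _ => event_smul _ _ _ }

theorem eventL_apply (p : ℝ × Space) : eventL p = event p.1 p.2 := rfl

/-- `spacePart` as a continuous linear map. -/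
def spacePartL : Spacetime →L[ℝ] Space :=
  LinearMap.toContinuousLinearMap
    { toFun := spacePart
      map_add' := fun _ _ => by ext i; simp [spacePart]
      map_smul' := fun _ _ => by ext i; simp [spacePart] }

theorem spacePartL_apply (x : Spacetime) : spacePartL x = spacePart x := rfl

/-- The null vector with space part `y` and time component `σ|y|`. -/
def nullVec (σ : ℝ) (y : Space) : Spacetime := event (σ * ‖y‖) y

theorem continuous_nullVec (σ : ℝ) : Continuous (nullVec σ) := by
  have : nullVec σ = fun y => eventL (σ * ‖y‖, y) := rfl
  rw [this]
  fun_prop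

theorem norm_le_norm_nullVec (σ : ℝ) (y : Space) : ‖y‖ ≤ ‖nullVec σ y‖ :=
  norm_le_norm_event _ _

theorem norm_nullVec_le {σ : ℝ} (hσ : |σ| = 1) (y : Space) : ‖nullVec σ y‖ ≤ 2 * ‖y‖ := by
  refine (norm_event_le _ _).trans ?_
  rw [abs_mul, hσ, abs_norm]
  linarith

theorem one_add_norm_le_mul (σ : ℝ) (x : Spacetime) (y : Space) :
    1 + ‖y‖ ≤ (1 + ‖x + nullVec σ y‖) * (1 + ‖x‖) := by
  have h1 := norm_le_norm_nullVec σ y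
  have h2 : ‖nullVec σ y‖ ≤ ‖x + nullVec σ y‖ + ‖x‖ := by
    have := norm_sub_le (x + nullVec σ y) x
    simpa using this
  nlinarith [norm_nonneg x, norm_nonneg (x + nullVec σ y)]

/-- A Peetre-type inequality: decay at the point of the cone becomes decay in y, at the price of a
factor locally bounded in x. This supplies the dominating functions for continuity and
differentiation of potentials. -/
theorem cone_weight_le (σ : ℝ) {m : ℝ} (hm : 0 ≤ m) (x : Spacetime) (y : Space) :
    (1 + ‖x + nullVec σ y‖) ^ (-m) ≤ (1 + ‖x‖) ^ m * (1 + ‖y‖) ^ (-m) := by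
  have h := one_add_norm_le_mul σ x y
  have h3 : ((1 + ‖x + nullVec σ y‖) * (1 + ‖x‖)) ^ (-m) ≤ (1 + ‖y‖) ^ (-m) :=
    Real.rpow_le_rpow_of_nonpos (by positivity) h (by linarith)
  rw [Real.mul_rpow (by positivity) (by positivity), Real.rpow_neg (x := 1 + ‖x‖) (by positivity),
    mul_inv_le_iff₀ (by positivity)] at h3
  linarith

/-- In polar coordinates the volume factor leaves r(1 + r)^(-m), which is integrable at infinity for
m > 2. This is the threshold on all decay exponents below. -/
theorem integrable_norm_inv_mul_weight {m : ℝ} (hm : 2 < m) :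
    Integrable (fun y : Space => ‖y‖⁻¹ * (1 + ‖y‖) ^ (-m)) := by
  have key := (integrable_fun_norm_addHaar (E := Space) (volume)
    (f := fun r : ℝ => r⁻¹ * (1 + r) ^ (-m))).2
  refine key ?_
  have hI : Integrable (fun r : ℝ => (1 + ‖r‖) ^ (-(m - 1))) :=
    integrable_one_add_norm (by simp; linarith)
  refine (hI.integrableOn (s := Ioi 0)).mono' ?_ ?_
  · apply Measurable.aestronglyMeasurable
    simp only [smul_eq_mul]
    fun_prop
  · refine (ae_restrict_iff' measurableSet_Ioi).2 (Eventually.of_forall fun r hr => ?_)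
    have hr' : (0 : ℝ) < r := hr
    simp only [finrank_euclideanSpace, Fintype.card_fin, smul_eq_mul, Real.norm_eq_abs]
    rw [abs_of_pos (by positivity), abs_of_pos hr', show -(m - 1) = 1 + -m by ring,
      Real.rpow_add (by positivity), Real.rpow_one]
    have : r ^ (3 - 1) * (r⁻¹ * (1 + r) ^ (-m)) = r * (1 + r) ^ (-m) := by
      field_simp
    rw [this]
    gcongr
    linarith

/-! ### Potentials over the light cone -/

/-- Polynomial decay of order `m`. -/
def Decays {E : Type*} [NormedAddCommGroup E] (m : ℝ) (f : Spacetime → E) : Prop :=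
  ∃ K : ℝ, ∀ p, ‖f p‖ ≤ K * (1 + ‖p‖) ^ (-m)

theorem Decays.exists_nonneg {E : Type*} [NormedAddCommGroup E] {m : ℝ} {f : Spacetime → E}
    (h : Decays m f) : ∃ K : ℝ, 0 ≤ K ∧ ∀ p, ‖f p‖ ≤ K * (1 + ‖p‖) ^ (-m) := by
  obtain ⟨K, hK⟩ := h
  exact ⟨|K|, abs_nonneg K, fun p => (hK p).trans (by gcongr; exact le_abs_self K)⟩

theorem Decays.mono {E : Type*} [NormedAddCommGroup E] {m m' : ℝ} {f : Spacetime → E}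
    (h : Decays m f) (hm : m' ≤ m) : Decays m' f := by
  obtain ⟨K, hK0, hK⟩ := h.exists_nonneg
  refine ⟨K, fun p => (hK p).trans ?_⟩
  gcongr
  linarith [norm_nonneg p]

variable {E : Type} [NormedAddCommGroup E] [NormedSpace ℝ E]

/-- The potential `∫ f(x⁰ + σ|y|, 𝐱 + y) / |y| d³y`: retarded for `σ = -1`, advanced for
`σ = 1`. -/
def conePotential (σ : ℝ) (f : Spacetime → E) (x : Spacetime) : E :=
  ∫ y : Space, ‖y‖⁻¹ • f (x + nullVec σ y)

theorem event_cone (σ : ℝ) (x : Spacetime) (y : Space) :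
    event (x 0 + σ * ‖y‖) (spacePart x + y) = x + nullVec σ y := by
  rw [event_add, event_spacePart, nullVec]

theorem retardedPotential_eq (J : Spacetime → Spacetime) :
    retardedPotential J = conePotential (-1) J := by
  ext1 x
  simp only [retardedPotential, conePotential, ← event_cone, neg_one_mul, sub_eq_add_neg]

theorem advancedPotential_eq (J : Spacetime → Spacetime) :
    advancedPotential J = conePotential 1 J := by
  ext1 x
  simp only [advancedPotential, conePotential, ← event_cone, one_mul]

theorem aestronglyMeasurable_cone (σ : ℝ) {f : Spacetime → E} (hf : Continuous f)
    (x : Spacetime) :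
    AEStronglyMeasurable (fun y : Space => ‖y‖⁻¹ • f (x + nullVec σ y)) := by
  have h1 : Continuous fun y : Space => f (x + nullVec σ y) :=
    hf.comp (continuous_const.add (continuous_nullVec σ))
  have h2 : Measurable fun y : Space => ‖y‖⁻¹ := by fun_prop
  exact h2.aestronglyMeasurable.smul h1.aestronglyMeasurable

theorem norm_cone_le {σ m K : ℝ} (hm : 0 ≤ m) {f : Spacetime → E} (hK0 : 0 ≤ K)
    (hK : ∀ p, ‖f p‖ ≤ K * (1 + ‖p‖) ^ (-m)) (x : Spacetime) (y : Space) :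
    ‖‖y‖⁻¹ • f (x + nullVec σ y)‖ ≤ K * (1 + ‖x‖) ^ m * (‖y‖⁻¹ * (1 + ‖y‖) ^ (-m)) := by
  rw [norm_smul, norm_inv, norm_norm]
  have := (hK (x + nullVec σ y)).trans
    (mul_le_mul_of_nonneg_left (cone_weight_le σ hm x y) hK0)
  calc _ ≤ ‖y‖⁻¹ * (K * ((1 + ‖x‖) ^ m * (1 + ‖y‖) ^ (-m))) := by gcongr
    _ = _ := by ring

theorem integrable_cone {σ m : ℝ} (hm : 2 < m) {f : Spacetime → E} (hf : Continuous f)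
    (hd : Decays m f) (x : Spacetime) :
    Integrable (fun y : Space => ‖y‖⁻¹ • f (x + nullVec σ y)) := by
  obtain ⟨K, hK0, hK⟩ := hd.exists_nonneg
  exact ((integrable_norm_inv_mul_weight hm).const_mul _).mono'
    (aestronglyMeasurable_cone σ hf x)
    (Eventually.of_forall (norm_cone_le (by linarith) hK0 hK x))

theorem continuous_conePotential {σ m : ℝ} (hm : 2 < m) {f : Spacetime → E} (hf : Continuous f)
    (hd : Decays m f) : Continuous (conePotential σ f) := by
  obtain ⟨K, hK0, hK⟩ := hd.exists_nonneg
  refine continuous_iff_continuousAt.2 fun x => ?_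
  refine continuousAt_of_dominated
    -- Uniform on the unit ball around x, where 1 + ‖x'‖ ≤ 2 + ‖x‖.
    (bound := fun y => K * (2 + ‖x‖) ^ m * (‖y‖⁻¹ * (1 + ‖y‖) ^ (-m)))
    (Eventually.of_forall fun x' => aestronglyMeasurable_cone σ hf x') ?_
    ((integrable_norm_inv_mul_weight hm).const_mul _) ?_
  · filter_upwards [Metric.ball_mem_nhds x one_pos] with x' hx'
    refine Eventually.of_forall fun y => (norm_cone_le (by linarith) hK0 hK x' y).trans ?_
    have : 1 + ‖x'‖ ≤ 2 + ‖x‖ := by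
      have := norm_le_norm_add_norm_sub' x' x
      rw [mem_ball_iff_norm] at hx'
      linarith
    gcongr
  · refine Eventually.of_forall fun y => ?_
    fun_prop

theorem hasFDerivAt_conePotential {σ m : ℝ} (hm : 2 < m) {f : Spacetime → E}
    (hf : ContDiff ℝ 1 f) (hd : Decays m f) (hd' : Decays m (fderiv ℝ f)) (x : Spacetime) :
    HasFDerivAt (conePotential σ f) (conePotential σ (fderiv ℝ f) x) x := by
  obtain ⟨K, hK0, hK⟩ := hd'.exists_nonneg
  have hc : Continuous (fderiv ℝ f) := hf.continuous_fderiv one_ne_zero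
  refine hasFDerivAt_integral_of_dominated_of_fderiv_le
    (F' := fun x y => ‖y‖⁻¹ • fderiv ℝ f (x + nullVec σ y))
    (bound := fun y => K * (2 + ‖x‖) ^ m * (‖y‖⁻¹ * (1 + ‖y‖) ^ (-m)))
    (Metric.ball_mem_nhds x one_pos)
    (Eventually.of_forall fun x' => aestronglyMeasurable_cone σ hf.continuous x')
    (integrable_cone hm hf.continuous hd x) (aestronglyMeasurable_cone σ hc x) ?_
    ((integrable_norm_inv_mul_weight hm).const_mul _) ?_
  · refine Eventually.of_forall fun y x' hx' => (norm_cone_le (by linarith) hK0 hK x' y).trans ?_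
    have : 1 + ‖x'‖ ≤ 2 + ‖x‖ := by
      have := norm_le_norm_add_norm_sub' x' x
      rw [mem_ball_iff_norm] at hx'
      linarith
    gcongr
  · refine Eventually.of_forall fun y x' _ => ?_
    have h1 : HasFDerivAt f (fderiv ℝ f (x' + nullVec σ y)) (x' + nullVec σ y) :=
      (hf.differentiable one_ne_zero _).hasFDerivAt
    exact ((hasFDerivAt_comp_add_right _).2 h1).const_smul (‖y‖⁻¹)

/-- Induction on the order with the target space quantified inside, since each step passes from f to
`fderiv ℝ f`, whose values lie in another space. -/
theorem contDiff_conePotential {σ m : ℝ} (hm : 2 < m) (n : ℕ) :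
    ∀ {E : Type} [NormedAddCommGroup E] [NormedSpace ℝ E] {f : Spacetime → E},
      ContDiff ℝ n f → (∀ k ≤ n, Decays m (iteratedFDeriv ℝ k f)) →
      ContDiff ℝ n (conePotential σ f) := by
  induction n with
  | zero =>
    intro E _ _ f hf hd
    have h0 : Decays m f := by simpa [Decays] using hd 0 le_rfl
    exact contDiff_zero.2 (continuous_conePotential hm hf.continuous h0)
  | succ n ih =>
    intro E _ _ f hf hd
    have h0 : Decays m f := by simpa [Decays] using hd 0 (Nat.zero_le _)
    have h1 : Decays m (fderiv ℝ f) := by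
      simpa [Decays, norm_iteratedFDeriv_one] using hd 1 (by omega)
    have hf' : ContDiff ℝ (n + 1) f := by exact_mod_cast hf
    have hg : ContDiff ℝ n (fderiv ℝ f) := ((contDiff_succ_iff_fderiv).1 hf').2.2
    have := contDiff_succ_iff_hasFDerivAt.2 ⟨conePotential σ (fderiv ℝ f), ih hg ?_,
      hasFDerivAt_conePotential (σ := σ) hm (hf'.of_le (by simp)) h0 h1⟩
    · exact_mod_cast this
    · intro k hk
      have := hd (k + 1) (by omega)
      simpa [Decays, norm_iteratedFDeriv_fderiv] using this

end

noncomputable section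

open Filter Topology Set

/-! ### A divergence theorem on punctured space -/

/-- A family of cutoffs on `[0, ∞)` vanishing at the origin and at infinity. -/
def annularCutoff (δ s : ℝ) : ℝ := s / ((s + δ) * (1 + δ * s))

/-- The derivative of `annularCutoff δ`. -/
def annularCutoffDeriv (δ s : ℝ) : ℝ := δ * (1 - s ^ 2) / ((s + δ) * (1 + δ * s)) ^ 2

theorem hasDerivAt_annularCutoff {δ s : ℝ} (hδ : 0 < δ) (hs : 0 ≤ s) :
    HasDerivAt (annularCutoff δ) (annularCutoffDeriv δ s) s := by
  have h0 : (s + δ) * (1 + δ * s) ≠ 0 := by positivity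
  have h1 : HasDerivAt (fun s : ℝ => (s + δ) * (1 + δ * s))
      (1 * (1 + δ * s) + (s + δ) * (δ * 1)) s :=
    ((hasDerivAt_id s).add_const δ).mul (((hasDerivAt_id s).const_mul δ).const_add 1)
  have h2 := (hasDerivAt_id s).div h1 h0
  refine h2.congr_deriv ?_
  simp only [annularCutoffDeriv, id]
  congr 1
  ring

theorem annularCutoff_nonneg {δ s : ℝ} (hδ : 0 < δ) (hs : 0 ≤ s) : 0 ≤ annularCutoff δ s := by
  unfold annularCutoff; positivity

theorem annularCutoff_le_one {δ s : ℝ} (hδ : 0 < δ) (hs : 0 ≤ s) : annularCutoff δ s ≤ 1 := by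
  unfold annularCutoff
  rw [div_le_one (by positivity)]
  nlinarith [mul_nonneg hδ.le hs, mul_nonneg (mul_nonneg hδ.le hs) hs,
    mul_nonneg (mul_nonneg hδ.le hs) hδ.le]

/-- For fixed δ the cutoff, taken at |y|², gains two powers of decay; this makes the cut-off field
and its derivative integrable. -/
theorem annularCutoff_sq_le {δ r : ℝ} (hδ : 0 < δ) (hδ1 : δ ≤ 1) (hr : 0 ≤ r) :
    annularCutoff δ (r ^ 2) ≤ 2 / δ * (1 + r) ^ (-2 : ℝ) := by
  have e : (1 + r) ^ (-2 : ℝ) = 1 / (1 + r) ^ 2 := by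
    rw [Real.rpow_neg (by positivity), one_div]
    norm_cast
  rw [e, annularCutoff, div_mul_div_comm, div_le_div_iff₀ (by positivity) (by positivity)]
  have h1 : δ * (1 + r) ^ 2 ≤ 2 * (1 + δ * r ^ 2) := by nlinarith [sq_nonneg (1 - r)]
  have h2 : r ^ 2 * (δ * (1 + r) ^ 2) ≤ (r ^ 2 + δ) * (2 * (1 + δ * r ^ 2)) := by
    gcongr
    linarith
  nlinarith

/-- The gradient of the cutoff at |y|² is at most 4/|y|, uniformly in δ. This scale-invariant bound
dominates the boundary terms in the limit δ → 0. -/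
theorem abs_annularCutoffDeriv_le {δ r : ℝ} (hδ : 0 < δ) (hr : 0 ≤ r) :
    |annularCutoffDeriv δ (r ^ 2)| * (2 * r) ≤ 4 * r⁻¹ := by
  rcases hr.eq_or_lt with rfl | hr
  · simp
  rw [annularCutoffDeriv, abs_div, abs_of_pos (show 0 < ((r ^ 2 + δ) * (1 + δ * r ^ 2)) ^ 2 by
    positivity), abs_mul, abs_of_pos hδ]
  have h1 : |1 - (r ^ 2) ^ 2| ≤ 1 + (r ^ 2) ^ 2 := by
    rw [abs_le]; constructor <;> nlinarith [sq_nonneg (r ^ 2)]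
  -- With s = r² the left side is δs + δs³; each term is bounded separately by the squared product,
  -- through `he` and `hf`.
  have h2 : δ * (1 + (r ^ 2) ^ 2) * r ^ 2 ≤ 2 * ((r ^ 2 + δ) * (1 + δ * r ^ 2)) ^ 2 := by
    set s := r ^ 2
    have hs : 0 ≤ s := by positivity
    have ha : s * δ ≤ (s + δ) ^ 2 := by nlinarith [mul_nonneg hs hδ.le]
    have hb : s ^ 2 ≤ (s + δ) ^ 2 := by gcongr; linarith
    have hc : δ * s ≤ (1 + δ * s) ^ 2 := by nlinarith [mul_nonneg hδ.le hs]
    have hd : 1 ≤ (1 + δ * s) ^ 2 := by nlinarith [mul_nonneg hδ.le hs]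
    have he : s * δ * 1 ≤ (s + δ) ^ 2 * (1 + δ * s) ^ 2 := by gcongr
    have hf : s ^ 2 * (δ * s) ≤ (s + δ) ^ 2 * (1 + δ * s) ^ 2 := by gcongr
    rw [mul_pow]
    nlinarith
  rw [div_mul_eq_mul_div, div_le_iff₀ (by positivity), mul_comm (4 : ℝ), mul_assoc, mul_assoc,
    le_inv_mul_iff₀ hr]
  calc r * (δ * (|1 - (r ^ 2) ^ 2| * (2 * r))) ≤ r * (δ * ((1 + (r ^ 2) ^ 2) * (2 * r))) := by gcongr
    _ ≤ _ := by nlinarith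

/-- The divergence of a linear map of space. -/
def divergence (T : Space →L[ℝ] Space) : ℝ := ∑ i, T (EuclideanSpace.single i 1) i

theorem abs_apply_le_norm (v : Space) (i : Fin 3) : |v i| ≤ ‖v‖ := by
  simpa using PiLp.norm_apply_le v i

/-- Integration by parts, one coordinate at a time, against the constant function 1; integrability
replaces compact support. -/
theorem integral_divergence_eq_zero_of_integrable {W : Space → Space} {W' : Space → Space →L[ℝ] Space}
    (hW : ∀ y, HasFDerivAt W (W' y) y) (hi : Integrable W)
    (hi' : Integrable fun y => ‖W' y‖) : ∫ y, divergence (W' y) = 0 := by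
  have hWd : W' = fderiv ℝ W := by ext1 y; exact (hW y).fderiv.symm
  have key : ∀ i, Integrable (fun y => W' y (EuclideanSpace.single i 1) i) ∧
      ∫ y, W' y (EuclideanSpace.single i 1) i = 0 := by
    intro i
    have hint : Integrable (fun y => W' y (EuclideanSpace.single i 1) i) := by
      refine hi'.mono' ?_ (Eventually.of_forall fun y => ?_)
      · have h1 : Measurable fun y => fderiv ℝ W y (EuclideanSpace.single i 1) :=
          measurable_fderiv_apply_const ℝ W _
        rw [hWd]
        have h2 : Measurable fun y => (fderiv ℝ W y (EuclideanSpace.single i 1)) i := by fun_prop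
        exact h2.aestronglyMeasurable
      · refine (abs_apply_le_norm _ i).trans ((W' y).le_opNorm _ |>.trans ?_)
        simp
    refine ⟨hint, ?_⟩
    have hWi : Integrable (fun y => W y i) := by
      refine hi.norm.mono' ?_ (Eventually.of_forall fun y => abs_apply_le_norm _ i)
      exact ((EuclideanSpace.proj i : Space →L[ℝ] ℝ).continuous.comp
        (continuous_iff_continuousAt.2 fun y => (hW y).continuousAt)).aestronglyMeasurable
    have := integral_bilinear_hasLineDerivAt_right_eq_neg_left_of_integrable (μ := volume)
      (f := fun _ : Space => (1 : ℝ)) (f' := fun _ => 0) (g := fun y => W y i)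
      (g' := fun y => W' y (EuclideanSpace.single i 1) i) (v := EuclideanSpace.single i 1)
      (B := ContinuousLinearMap.mul ℝ ℝ) (by simp) (by simpa using hint) (by simpa using hWi)
      (fun y _ => (hasFDerivAt_const (1 : ℝ) y).hasLineDerivAt _) ?_
    · simpa using this
    · intro y _
      exact ((EuclideanSpace.proj i : Space →L[ℝ] ℝ).hasFDerivAt.comp y (hW y)).hasLineDerivAt _
  simp only [divergence]
  rw [integral_finsetSum _ fun i _ => (key i).1]
  exact Finset.sum_eq_zero fun i _ => (key i).2

/-- The pointwise content of div(χV) = χ div V + dχ(V): the trace of the rank-one map ℓ ⊗ v is ℓ(v).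
-/
theorem divergence_smul_add (c : ℝ) (T : Space →L[ℝ] Space) (ℓ : Space →L[ℝ] ℝ) (v : Space) :
    divergence (c • T + ℓ.smulRight v) = c * divergence T + ℓ v := by
  have hv : ℓ v = ∑ i, v i * ℓ (EuclideanSpace.single i 1) := by
    conv_lhs => rw [← (EuclideanSpace.basisFun (Fin 3) ℝ).sum_repr v]
    simp [map_sum]
  rw [hv]
  simp only [divergence, Finset.mul_sum, ← Finset.sum_add_distrib]
  refine Finset.sum_congr rfl fun i _ => ?_
  simp [mul_comm]

/-- A field bounded near 0 and decaying faster than |y|⁻² has no flux through small or large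
spheres. Multiply by the annular cutoff, apply the smooth case and let δ → 0: the gradient terms are
dominated and tend to 0 pointwise. Integrability of the divergence is assumed separately because the
bound on `V'` is only |y|⁻³ at infinity, which is not integrable. -/
theorem integral_divergence_eq_zero {V : Space → Space} {V' : Space → Space →L[ℝ] Space}
    {m C C' : ℝ} (hm : 2 < m) (hV : ∀ y ≠ 0, HasFDerivAt V (V' y) y)
    (hb : ∀ y, ‖V y‖ ≤ C * (1 + ‖y‖) ^ (-m))
    (hb' : ∀ y ≠ 0, ‖V' y‖ ≤ C' * (‖y‖⁻¹ * (1 + ‖y‖) ^ (-2 : ℝ)))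
    (hdiv : Integrable fun y => divergence (V' y)) : ∫ y, divergence (V' y) = 0 := by
  have hC : 0 ≤ C := by simpa using (norm_nonneg _).trans (hb 0)
  have hC' : 0 ≤ C' := by
    have h := (norm_nonneg _).trans (hb' (EuclideanSpace.single 0 1) (by simp))
    have h2 : (0 : ℝ) < ‖(EuclideanSpace.single 0 1 : Space)‖⁻¹ *
      (1 + ‖(EuclideanSpace.single 0 1 : Space)‖) ^ (-2 : ℝ) := by simp
    exact nonneg_of_mul_nonneg_left h h2
  set D : ℝ → Space → Space →L[ℝ] ℝ :=
    fun δ y => (annularCutoffDeriv δ (‖y‖ ^ 2) * 2) • innerSL ℝ y with hD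
  have hDnorm : ∀ δ > 0, ∀ y, ‖D δ y‖ ≤ 4 * ‖y‖⁻¹ := by
    intro δ hδ y
    have := abs_annularCutoffDeriv_le hδ (norm_nonneg y)
    simp only [hD, norm_smul, norm_mul, Real.norm_eq_abs, innerSL_apply_norm]
    simpa [mul_assoc] using this
  have hchi : ∀ δ > 0, ∀ y : Space,
      HasFDerivAt (fun y : Space => annularCutoff δ (‖y‖ ^ 2)) (D δ y) y := by
    intro δ hδ y
    have h1 := (hasStrictFDerivAt_norm_sq y).hasFDerivAt
    have h2 := (hasDerivAt_annularCutoff hδ (sq_nonneg ‖y‖)).comp_hasFDerivAt y h1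
    refine h2.congr_fderiv ?_
    ext v
    simp [hD]
    ring
  have hW : ∀ δ > 0, ∀ y, HasFDerivAt (fun y => annularCutoff δ (‖y‖ ^ 2) • V y)
      (annularCutoff δ (‖y‖ ^ 2) • V' y + (D δ y).smulRight (V y)) y := by
    intro δ hδ y
    by_cases hy : y = 0
    · subst hy
      have h1 : HasFDerivAt (fun y => annularCutoff δ (‖y‖ ^ 2) • V y)
          (0 : Space →L[ℝ] Space) 0 := by
        -- The cutoff is at most |y|²/δ, so its product with the bounded V vanishes to second order
        -- at 0 and is differentiable there, whatever the singularity of V.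
        refine Asymptotics.IsBigO.hasFDerivAt (n := 2) ?_ (by norm_num)
        refine Asymptotics.IsBigO.of_bound (C / δ) (Eventually.of_forall fun y => ?_)
        have hV0 : ‖V y‖ ≤ C := (hb y).trans (mul_le_of_le_one_right hC
          (Real.rpow_le_one_of_one_le_of_nonpos (by linarith [norm_nonneg y]) (by linarith)))
        rw [norm_smul, Real.norm_eq_abs, abs_of_nonneg (annularCutoff_nonneg hδ (sq_nonneg _))]
        have h2 : annularCutoff δ (‖y‖ ^ 2) ≤ ‖y‖ ^ 2 / δ := by
          unfold annularCutoff
          gcongr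
          nlinarith [sq_nonneg ‖y‖, mul_nonneg hδ.le (sq_nonneg ‖y‖),
            mul_nonneg (mul_nonneg hδ.le (sq_nonneg ‖y‖)) hδ.le,
            mul_nonneg (mul_nonneg hδ.le (sq_nonneg ‖y‖)) (sq_nonneg ‖y‖)]
        calc _ ≤ ‖y‖ ^ 2 / δ * C := by gcongr
          _ = C / δ * ‖‖y - 0‖ ^ 2‖ := by simp; ring
      refine h1.congr_fderiv ?_
      ext v
      simp [hD, annularCutoff]
    · exact (hchi δ hδ y).smul (hV y hy)
  have hzero : ∀ δ > 0, δ ≤ 1 →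
      ∫ y, (annularCutoff δ (‖y‖ ^ 2) * divergence (V' y) + D δ y (V y)) = 0 := by
    intro δ hδ hδ1
    simp only [← divergence_smul_add]
    refine integral_divergence_eq_zero_of_integrable (hW δ hδ) ?_ ?_
    · have hI : Integrable (fun y : Space => (1 + ‖y‖) ^ (-(2 + m))) :=
        integrable_one_add_norm (by simp; linarith)
      refine (hI.const_mul (2 / δ * C)).mono' ?_ (Eventually.of_forall fun y => ?_)
      · exact (continuous_iff_continuousAt.2
          fun y => (hW δ hδ y).continuousAt).aestronglyMeasurable
      · rw [norm_smul, Real.norm_eq_abs, abs_of_nonneg (annularCutoff_nonneg hδ (sq_nonneg _)),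
          neg_add, Real.rpow_add (by positivity)]
        calc _ ≤ (2 / δ * (1 + ‖y‖) ^ (-2 : ℝ)) * (C * (1 + ‖y‖) ^ (-m)) := by
              gcongr
              · exact annularCutoff_sq_le hδ hδ1 (norm_nonneg y)
              · exact hb y
          _ = _ := by ring
    -- The cutoff adds (1 + |y|)^(-2) to the borderline weight of `V'`, whence the exponent 4.
    · have hI1 := (integrable_norm_inv_mul_weight (m := 4) (by norm_num)).const_mul (2 / δ * C')
      have hI2 := (integrable_norm_inv_mul_weight hm).const_mul (4 * C)
      refine (hI1.add hI2).mono' ?_ ?_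
      · simp only [← (hW δ hδ _).fderiv]
        exact (measurable_fderiv ℝ _).norm.aestronglyMeasurable
      · have h0 : ∀ᵐ y : Space, y ≠ 0 := by
          simp [ae_iff]
        filter_upwards [h0] with y hy
        rw [norm_norm]
        refine (norm_add_le _ _).trans (add_le_add ?_ ?_)
        · rw [norm_smul, Real.norm_eq_abs,
            abs_of_nonneg (annularCutoff_nonneg hδ (sq_nonneg _)),
            show (-4 : ℝ) = -2 + -2 by norm_num]
          simp only [Real.rpow_add (show 0 < 1 + ‖y‖ by positivity)]
          calc _ ≤ (2 / δ * (1 + ‖y‖) ^ (-2 : ℝ)) * (C' * (‖y‖⁻¹ * (1 + ‖y‖) ^ (-2 : ℝ))) := by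
                gcongr
                · exact annularCutoff_sq_le hδ hδ1 (norm_nonneg y)
                · exact hb' y hy
            _ = _ := by ring
        · rw [ContinuousLinearMap.norm_smulRight_apply]
          calc _ ≤ (4 * ‖y‖⁻¹) * (C * (1 + ‖y‖) ^ (-m)) := by
                gcongr
                · exact hDnorm δ hδ y
                · exact hb y
            _ = _ := by ring
  have hδn : ∀ n : ℕ, (0 : ℝ) < 1 / (n + 1) ∧ (1 : ℝ) / (n + 1) ≤ 1 := fun n =>
    ⟨by positivity, by rw [div_le_one (by positivity)]; linarith [n.cast_nonneg (α := ℝ)]⟩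
  have hlim : Tendsto (fun n : ℕ => ∫ y, (annularCutoff (1 / (n + 1)) (‖y‖ ^ 2) *
      divergence (V' y) + D (1 / (n + 1)) y (V y))) atTop (𝓝 (∫ y, divergence (V' y))) := by
    have hVm : AEStronglyMeasurable V := by
      have h1 : ContinuousOn V {0}ᶜ := fun y hy => (hV y hy).continuousAt.continuousWithinAt
      have h2 := h1.aestronglyMeasurable (μ := volume) (measurableSet_singleton (0 : Space)).compl
      rwa [restrict_compl_singleton] at h2
    refine tendsto_integral_of_dominated_convergence
      (fun y => ‖divergence (V' y)‖ + 4 * C * (‖y‖⁻¹ * (1 + ‖y‖) ^ (-m))) ?_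
      (hdiv.norm.add ((integrable_norm_inv_mul_weight hm).const_mul _)) ?_ ?_
    · intro n
      refine AEStronglyMeasurable.add (AEStronglyMeasurable.mul ?_ hdiv.aestronglyMeasurable) ?_
      · apply Measurable.aestronglyMeasurable
        unfold annularCutoff
        fun_prop
      · simp only [hD, smul_apply, innerSL_apply_apply]
        have h3 : AEStronglyMeasurable (fun y : Space => inner ℝ y (V y)) :=
          aestronglyMeasurable_id.inner hVm
        have h4 : Measurable fun y : Space =>
            annularCutoffDeriv (1 / ((n : ℝ) + 1)) (‖y‖ ^ 2) * 2 := by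
          unfold annularCutoffDeriv
          fun_prop
        exact h4.aestronglyMeasurable.smul h3
    · intro n
      refine Eventually.of_forall fun y => (norm_add_le _ _).trans (add_le_add ?_ ?_)
      · rw [norm_mul, Real.norm_eq_abs,
          abs_of_nonneg (annularCutoff_nonneg (hδn n).1 (sq_nonneg _))]
        exact mul_le_of_le_one_left (norm_nonneg _)
          (annularCutoff_le_one (hδn n).1 (sq_nonneg _))
      · calc _ ≤ (4 * ‖y‖⁻¹) * (C * (1 + ‖y‖) ^ (-m)) := by
              refine ((D _ y).le_opNorm _).trans ?_
              gcongr
              · exact hDnorm _ (hδn n).1 y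
              · exact hb y
            _ = _ := by ring
    · have h0 : ∀ᵐ y : Space, y ≠ 0 := by
        simp [ae_iff]
      filter_upwards [h0] with y hy
      have hs : 0 < ‖y‖ ^ 2 := by positivity
      have hδ : Tendsto (fun n : ℕ => (1 : ℝ) / (n + 1)) atTop (𝓝 0) :=
        tendsto_one_div_add_atTop_nhds_zero_nat
      have c1 : ContinuousAt (fun δ => annularCutoff δ (‖y‖ ^ 2)) 0 := by
        unfold annularCutoff
        refine ContinuousAt.div (by fun_prop) (by fun_prop) ?_
        simp [hy]
      have c2 : ContinuousAt (fun δ => annularCutoffDeriv δ (‖y‖ ^ 2)) 0 := by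
        unfold annularCutoffDeriv
        refine ContinuousAt.div (by fun_prop) (by fun_prop) ?_
        simp [hy]
      have t1 := c1.tendsto.comp hδ
      have t2 := c2.tendsto.comp hδ
      have e1 : annularCutoff 0 (‖y‖ ^ 2) = 1 := by simp [annularCutoff, hy]
      have e2 : annularCutoffDeriv 0 (‖y‖ ^ 2) = 0 := by simp [annularCutoffDeriv]
      rw [e1] at t1
      rw [e2] at t2
      have := (t1.mul_const (divergence (V' y))).add
        ((t2.mul_const 2).mul_const (inner ℝ y (V y)))
      simpa [hD, Function.comp_def] using this
  have : Tendsto (fun _ : ℕ => (0 : ℝ)) atTop (𝓝 (∫ y, divergence (V' y))) :=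
    hlim.congr fun n => hzero _ (hδn n).1 (hδn n).2
  exact (tendsto_nhds_unique this tendsto_const_nhds)

end

noncomputable section

open Filter Topology Set

/-! ### The Minkowski form -/

/-- The map `x^a ↦ x_a` lowering the index. -/
def lower : Spacetime →L[ℝ] Spacetime :=
  LinearMap.toContinuousLinearMap
    { toFun := fun x => WithLp.toLp 2 (fun a => metricSign a * x a)
      map_add' := fun _ _ => by ext i; simp [mul_add]
      map_smul' := fun _ _ => by ext i; simp [mul_left_comm] }

theorem lower_apply (x : Spacetime) (a : Fin 4) : lower x a = metricSign a * x a := rfl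

theorem norm_lower (x : Spacetime) : ‖lower x‖ = ‖x‖ := by
  rw [EuclideanSpace.norm_eq, EuclideanSpace.norm_eq]
  congr 1
  refine Finset.sum_congr rfl fun a _ => ?_
  rw [lower_apply, norm_mul, metricSign]
  split_ifs <;> simp

/-- The Minkowski bilinear form. -/
def mink : Spacetime →L[ℝ] Spacetime →L[ℝ] ℝ := (innerSL ℝ).comp lower

theorem mink_apply (x v : Spacetime) : mink x v = ∑ a, metricSign a * x a * v a := by
  simp [mink, PiLp.inner_apply, lower_apply, mul_comm]

theorem mink_eq_inner (x v : Spacetime) : mink x v = inner ℝ (lower x) v := rfl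

theorem mink_event (t : ℝ) (y : Space) (v : Spacetime) :
    mink (event t y) v = t * v 0 - inner ℝ y (spacePart v) := by
  simp [mink_apply, PiLp.inner_apply, Fin.sum_univ_succ, event, metricSign, spacePart]
  ring

theorem abs_mink_le (x v : Spacetime) : |mink x v| ≤ ‖x‖ * ‖v‖ := by
  rw [mink_eq_inner, ← norm_lower x]
  exact abs_real_inner_le_norm _ _

theorem norm_mink_le : ‖mink‖ ≤ 1 := by
  refine ContinuousLinearMap.opNorm_le_bound _ zero_le_one fun x => ?_
  refine ContinuousLinearMap.opNorm_le_bound _ (by positivity) fun v => ?_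
  simpa using abs_mink_le x v

/-! ### Calculus on the light cone -/

/-- The radial unit vector field. -/
def radial (y : Space) : Space := ‖y‖⁻¹ • y

/-- The derivative of `radial`. -/
def radialDeriv (y : Space) : Space →L[ℝ] Space :=
  ‖y‖⁻¹ • ContinuousLinearMap.id ℝ Space +
    ((-(‖y‖ ^ 2)⁻¹) • innerSL ℝ (radial y)).smulRight y

theorem norm_radial_le (y : Space) : ‖radial y‖ ≤ 1 := by
  rw [radial, norm_smul, norm_inv, norm_norm]
  exact inv_mul_le_one

theorem norm_radial {y : Space} (hy : y ≠ 0) : ‖radial y‖ = 1 := by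
  rw [radial, norm_smul, norm_inv, norm_norm]
  exact inv_mul_cancel₀ (norm_ne_zero_iff.2 hy)

theorem inner_radial_self (y : Space) : inner ℝ (radial y) y = ‖y‖ := by
  rw [radial, real_inner_smul_left, real_inner_self_eq_norm_sq]
  rcases eq_or_ne ‖y‖ 0 with h | h
  · simp [h]
  · field_simp

theorem hasFDerivAt_norm_radial {y : Space} (hy : y ≠ 0) :
    HasFDerivAt (fun y : Space => ‖y‖) (innerSL ℝ (radial y)) y := by
  have h0 : ‖y‖ ^ 2 ≠ 0 := by simpa using hy
  have h1 := (hasStrictFDerivAt_norm_sq y).hasFDerivAt.sqrt h0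
  have e : (fun y : Space => √(‖y‖ ^ 2)) = fun y => ‖y‖ := by
    ext1 y; exact Real.sqrt_sq (norm_nonneg y)
  rw [e] at h1
  refine h1.congr_fderiv ?_
  ext v
  simp [radial, Real.sqrt_sq (norm_nonneg y)]
  field_simp

theorem hasFDerivAt_radial {y : Space} (hy : y ≠ 0) : HasFDerivAt radial (radialDeriv y) y := by
  have h0 : ‖y‖ ≠ 0 := norm_ne_zero_iff.2 hy
  have h1 := (hasDerivAt_inv h0).comp_hasFDerivAt y (hasFDerivAt_norm_radial hy)
  exact h1.smul (hasFDerivAt_id y)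

theorem radialDeriv_apply (y v : Space) :
    radialDeriv y v = ‖y‖⁻¹ • (v - inner ℝ (radial y) v • radial y) := by
  simp only [radialDeriv, add_apply, smul_apply, ContinuousLinearMap.smulRight_apply,
    innerSL_apply_apply, ContinuousLinearMap.id_apply, smul_eq_mul]
  generalize inner ℝ (radial y) v = c
  rw [radial]
  module

theorem norm_radialDeriv_apply_le (y v : Space) : ‖radialDeriv y v‖ ≤ 2 * ‖y‖⁻¹ * ‖v‖ := by
  rw [radialDeriv_apply, norm_smul, norm_inv, norm_norm]
  have h1 : ‖inner ℝ (radial y) v • radial y‖ ≤ ‖v‖ := by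
    rw [norm_smul]
    calc _ ≤ (‖radial y‖ * ‖v‖) * ‖radial y‖ := by
          gcongr; exact norm_inner_le_norm _ _
      _ ≤ (1 * ‖v‖) * 1 := by gcongr <;> exact norm_radial_le y
      _ = ‖v‖ := by ring
  calc _ ≤ ‖y‖⁻¹ * (‖v‖ + ‖v‖) := by
        gcongr; exact (norm_sub_le _ _).trans (by gcongr)
    _ = _ := by ring

/-- The derivative of y/|y| is the Hessian of |y|, hence symmetric. In `integral_flux_eq_zero` this
makes the two terms with a derivative of the unit normal cancel. -/
theorem inner_radialDeriv_comm (y v w : Space) :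
    inner ℝ (radialDeriv y v) w = inner ℝ (radialDeriv y w) v := by
  simp only [radialDeriv_apply, real_inner_smul_left, inner_sub_left, real_inner_comm v w]
  ring

/-- The derivative of `nullVec σ`. -/
def nullVecDeriv (σ : ℝ) (y : Space) : Space →L[ℝ] Spacetime :=
  eventL.comp ((σ • innerSL ℝ (radial y)).prod (ContinuousLinearMap.id ℝ Space))

theorem nullVecDeriv_apply (σ : ℝ) (y v : Space) :
    nullVecDeriv σ y v = event (σ * inner ℝ (radial y) v) v := by
  simp [nullVecDeriv, eventL_apply]

theorem hasFDerivAt_nullVec (σ : ℝ) {y : Space} (hy : y ≠ 0) :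
    HasFDerivAt (nullVec σ) (nullVecDeriv σ y) y :=
  eventL.hasFDerivAt.comp y
    (((hasFDerivAt_norm_radial hy).const_smul σ).prodMk (hasFDerivAt_id y))

theorem norm_nullVecDeriv_apply_le {σ : ℝ} (hσ : |σ| = 1) (y v : Space) :
    ‖nullVecDeriv σ y v‖ ≤ 2 * ‖v‖ := by
  rw [nullVecDeriv_apply]
  refine (norm_event_le _ _).trans ?_
  rw [abs_mul, hσ]
  have h1 : |inner ℝ (radial y) v| ≤ 1 * ‖v‖ := (abs_real_inner_le_norm _ _).trans (by
    gcongr; exact norm_radial_le y)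
  linarith

variable {E : Type} [NormedAddCommGroup E] [NormedSpace ℝ E]

theorem hasFDerivAt_comp_cone (σ : ℝ) {f : Spacetime → E} (hf : ContDiff ℝ 1 f) (x : Spacetime)
    {y : Space} (hy : y ≠ 0) :
    HasFDerivAt (fun y => f (x + nullVec σ y))
      ((fderiv ℝ f (x + nullVec σ y)).comp (nullVecDeriv σ y)) y :=
  ((hf.differentiable one_ne_zero _).hasFDerivAt).comp y
    ((hasFDerivAt_nullVec σ hy).const_add x)

theorem divergence_add (S T : Space →L[ℝ] Space) :
    divergence (S + T) = divergence S + divergence T := by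
  simp [divergence, Finset.sum_add_distrib]

theorem divergence_radialDeriv {y : Space} (hy : y ≠ 0) :
    divergence (radialDeriv y) = 2 * ‖y‖⁻¹ := by
  have h0 : ‖y‖ ≠ 0 := norm_ne_zero_iff.2 hy
  rw [radialDeriv, divergence_smul_add]
  have : divergence (ContinuousLinearMap.id ℝ Space) = 3 := by simp [divergence]
  rw [this]
  simp only [smul_apply, innerSL_apply_apply, inner_radial_self, smul_eq_mul]
  field_simp
  ring

theorem weight_le_inv_mul {r m : ℝ} (hr : 0 < r) (hm : 3 ≤ m) :
    (1 + r) ^ (-m) ≤ r⁻¹ * (1 + r) ^ (-2 : ℝ) := by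
  have h1 : (1 + r) ^ (-m) ≤ (1 + r) ^ (-1 + -2 : ℝ) :=
    Real.rpow_le_rpow_of_exponent_le (by linarith) (by linarith)
  refine h1.trans ?_
  rw [Real.rpow_add (by positivity), Real.rpow_neg_one]
  gcongr
  linarith

theorem weight_anti {r m m' : ℝ} (hr : 0 ≤ r) (hm : m' ≤ m) :
    (1 + r) ^ (-m) ≤ (1 + r) ^ (-m') :=
  Real.rpow_le_rpow_of_exponent_le (by linarith) (by linarith)

theorem conePotential_apply {σ m : ℝ} (hm : 2 < m) {F : Spacetime → Spacetime →L[ℝ] E}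
    [CompleteSpace E] (hF : Continuous F) (hd : Decays m F) (x b : Spacetime) :
    conePotential σ F x b = ∫ y : Space, ‖y‖⁻¹ • F (x + nullVec σ y) b := by
  rw [conePotential, ContinuousLinearMap.integral_apply (integrable_cone hm hF hd x)]
  rfl

omit [NormedSpace ℝ E] in
theorem exists_cone_bound {σ m : ℝ} (hm : 0 ≤ m) {f : Spacetime → E} (hd : Decays m f)
    (x : Spacetime) : ∃ C, 0 ≤ C ∧ ∀ y, ‖f (x + nullVec σ y)‖ ≤ C * (1 + ‖y‖) ^ (-m) := by
  obtain ⟨K, hK0, hK⟩ := hd.exists_nonneg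
  refine ⟨K * (1 + ‖x‖) ^ m, by positivity, fun y => (hK _).trans ?_⟩
  rw [mul_assoc]
  exact mul_le_mul_of_nonneg_left (cone_weight_le σ hm x y) hK0

/-- `(x · ∇)` of a potential: the vanishing of the integral of a radial total divergence. -/
theorem conePotential_fderiv_self {σ m : ℝ} (hσ : |σ| = 1) (hm : 2 < m) {f : Spacetime → ℝ}
    (hf : ContDiff ℝ 1 f) (hd' : Decays 3 (fderiv ℝ f)) (x : Spacetime)
    (hfx : ∃ C, ∀ y, ‖f (x + nullVec σ y)‖ ≤ C * (1 + ‖y‖) ^ (-m))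
    (hg : Decays m fun p => fderiv ℝ f p p + 2 * f p) :
    conePotential σ (fderiv ℝ f) x x =
      conePotential σ (fun p => fderiv ℝ f p p + 2 * f p) x := by
  obtain ⟨C, hC⟩ := hfx
  have hC0 : 0 ≤ C := by simpa using (norm_nonneg _).trans (hC 0)
  have hc : Continuous (fderiv ℝ f) := hf.continuous_fderiv one_ne_zero
  obtain ⟨C', hC'0, hC'⟩ := exists_cone_bound (σ := σ) (by norm_num) hd' x
  have i1 := (integrable_cone (σ := σ) (by norm_num) hc hd' x).apply_continuousLinearMap x
  have i2 := integrable_cone (σ := σ) (f := fun p => fderiv ℝ f p p + 2 * f p) hm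
    ((hc.clm_apply continuous_id).add (continuous_const.mul hf.continuous)) hg x
  rw [conePotential_apply (by norm_num) hc hd', conePotential, eq_comm, ← sub_eq_zero,
    ← integral_sub i2 (by exact i1)]
  -- The radial derivative of k(y) is k(y)/|y| and div(y/|y|) = 2/|y|. So the divergence of f(x + k)
  -- y/|y| is |y|⁻¹ (k·∇f + 2f), and k = p - x.
  have key : ∀ y ≠ 0, ‖y‖⁻¹ • (fderiv ℝ f (x + nullVec σ y) (x + nullVec σ y) +
      2 * f (x + nullVec σ y)) - ‖y‖⁻¹ • fderiv ℝ f (x + nullVec σ y) x =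
      divergence (f (x + nullVec σ y) • radialDeriv y +
        ((fderiv ℝ f (x + nullVec σ y)).comp (nullVecDeriv σ y)).smulRight (radial y)) := by
    intro y hy
    have e : nullVecDeriv σ y (radial y) = ‖y‖⁻¹ • nullVec σ y := by
      rw [nullVecDeriv_apply, nullVec, ← event_smul, real_inner_self_eq_norm_sq, norm_radial hy,
        radial]
      congr 1
      field_simp
    rw [divergence_smul_add, divergence_radialDeriv hy, ContinuousLinearMap.comp_apply, e, map_add,
      map_smul]
    simp only [smul_eq_mul]
    ring
  have h0 : ∀ᵐ y : Space, y ≠ 0 := by simp [ae_iff]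
  have kae := h0.mono key
  rw [integral_congr_ae kae]
  refine integral_divergence_eq_zero (V := fun y => f (x + nullVec σ y) • radial y) (m := m)
    (C := C) (C' := 2 * C + 2 * C') hm ?_ ?_ ?_ ((i2.sub i1).congr kae)
  · intro y hy
    exact (hasFDerivAt_comp_cone σ hf x hy).smul (hasFDerivAt_radial hy)
  · intro y
    rw [norm_smul]
    exact (mul_le_of_le_one_right (norm_nonneg _) (norm_radial_le y)).trans (hC y)
  · intro y hy
    have hy0 : 0 < ‖y‖ := norm_pos_iff.2 hy
    refine ContinuousLinearMap.opNorm_le_bound _ (by positivity) fun v => ?_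
    have a1 : ‖f (x + nullVec σ y) • radialDeriv y v‖ ≤
        (C * (1 + ‖y‖) ^ (-2 : ℝ)) * (2 * ‖y‖⁻¹ * ‖v‖) := by
      rw [norm_smul]
      gcongr
      · exact (hC y).trans (by gcongr 1; exact weight_anti (norm_nonneg y) hm.le)
      · exact norm_radialDeriv_apply_le y v
    have a2 : ‖fderiv ℝ f (x + nullVec σ y) (nullVecDeriv σ y v) • radial y‖ ≤
        (C' * (‖y‖⁻¹ * (1 + ‖y‖) ^ (-2 : ℝ))) * (2 * ‖v‖) * 1 := by
      rw [norm_smul]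
      gcongr
      · refine (ContinuousLinearMap.le_opNorm _ _).trans ?_
        gcongr
        · exact (hC' y).trans (by gcongr 1; exact weight_le_inv_mul hy0 (by norm_num))
        · exact norm_nullVecDeriv_apply_le hσ y v
      · exact norm_radial_le y
    refine (norm_add_le _ _).trans ((add_le_add a1 a2).trans (le_of_eq ?_))
    ring

/-- The flux of the derivatives of a conserved current through a light cone vanishes. -/
theorem integral_flux_eq_zero {σ : ℝ} (hσ : |σ| = 1) {J : Spacetime → Spacetime}
    (hJ : ContDiff ℝ 1 J) (hcons : ∀ x, ∑ a, fderiv ℝ J x (EuclideanSpace.single a 1) a = 0)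
    (hd : Decays 3 J) (hd' : Decays 4 (fderiv ℝ J)) (x b : Spacetime) :
    ∫ y : Space, ‖y‖⁻¹ • mink (nullVec σ y) (fderiv ℝ J (x + nullVec σ y) b) = 0 := by
  have hσ2 : σ ^ 2 = 1 := by rw [← sq_abs, hσ, one_pow]
  have hc : Continuous (fderiv ℝ J) := hJ.continuous_fderiv one_ne_zero
  obtain ⟨C, hC0, hC⟩ := exists_cone_bound (σ := σ) (by norm_num) hd x
  obtain ⟨C', hC'0, hC'⟩ := exists_cone_bound (σ := σ) (by norm_num) hd' x
  set bs := spacePart b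
  set T : Space → Space →L[ℝ] Spacetime :=
    fun y => (fderiv ℝ J (x + nullVec σ y)).comp (nullVecDeriv σ y) with hT
  set c : Space → ℝ := fun y => inner ℝ (radial y) bs - σ * b 0 with hcdef
  -- Conservation gives b^c ∂_c J^a = ∂_c(b^c J^a - b^a J^c). Contracting the antisymmetric
  -- expression with the null normal leaves only derivatives tangent to the cone, so the integrand
  -- is a divergence in y. With n = y/|y| the field is (n·𝐛 - σb⁰)𝐉 + (σJ⁰ - n·𝐉)𝐛, and `V'` is its
  -- derivative.
  set V' : Space → Space →L[ℝ] Space := fun y =>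
    (c y • spacePartL.comp (T y) +
      ((innerSL ℝ bs).comp (radialDeriv y)).smulRight (spacePart (J (x + nullVec σ y)))) +
    (σ • (EuclideanSpace.proj 0).comp (T y) -
      ((innerSL ℝ (radial y)).comp (spacePartL.comp (T y)) +
        (innerSL ℝ (spacePart (J (x + nullVec σ y)))).comp (radialDeriv y))).smulRight bs with hV'
  have key : ∀ y ≠ 0, ‖y‖⁻¹ • mink (nullVec σ y) (fderiv ℝ J (x + nullVec σ y) b) =
      divergence (V' y) := by
    intro y hy
    set D := fderiv ℝ J (x + nullVec σ y) with hD
    have hb : b = b 0 • event 1 0 + event 0 bs := by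
      rw [← event_smul, ← event_add]
      simp [bs, event_spacePart]
    have hTv : ∀ v, T y v = (σ * inner ℝ (radial y) v) • D (event 1 0) + D (event 0 v) := by
      intro v
      rw [hT, ContinuousLinearMap.comp_apply, nullVecDeriv_apply, ← map_smul, ← map_add,
        ← event_smul, ← event_add]
      simp [hD]
    -- Conservation replaces the spatial divergence of J by -∂_0 J⁰; the other term comes from the
    -- time component of k(y).
    have hdivT : divergence (spacePartL.comp (T y)) =
        σ * inner ℝ (radial y) (spacePart (D (event 1 0))) - D (event 1 0) 0 := by
      have h1 := hcons (x + nullVec σ y)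
      rw [Fin.sum_univ_succ, ← hD] at h1
      have e0 : EuclideanSpace.single (0 : Fin 4) (1 : ℝ) = event 1 0 := by
        ext i
        refine Fin.cases ?_ (fun j => ?_) i <;> simp [event]
      have e1 : ∀ i : Fin 3, EuclideanSpace.single i.succ (1 : ℝ) =
          event 0 (EuclideanSpace.single i 1) := by
        intro i; ext k
        refine Fin.cases ?_ (fun j => ?_) k <;> simp [event]
      simp only [e0, e1] at h1
      simp only [divergence, ContinuousLinearMap.comp_apply, hTv, map_add, map_smul,
        PiLp.add_apply, PiLp.smul_apply, Finset.sum_add_distrib, spacePartL_apply]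
      have h2 : ∑ i, (spacePart (D (event 0 (EuclideanSpace.single i 1)))) i =
          - D (event 1 0) 0 := by
        simp only [spacePart]; linarith
      rw [h2, PiLp.inner_apply, Finset.mul_sum, sub_eq_add_neg]
      congr 1
      refine Finset.sum_congr rfl fun i _ => ?_
      simp [PiLp.inner_apply]
      ring
    have hnull : ‖y‖⁻¹ • nullVec σ y = event σ (radial y) := by
      rw [nullVec, ← event_smul, radial]
      congr 1
      have : ‖y‖ ≠ 0 := norm_ne_zero_iff.2 hy
      field_simp
    rw [← smul_apply, ← map_smul, hnull, mink_event, hV']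
    simp only []
    rw [divergence_add, divergence_smul_add, hdivT]
    have hz : ∀ ℓ : Space →L[ℝ] ℝ, divergence (ℓ.smulRight bs) = ℓ bs := by
      intro ℓ
      have h := divergence_smul_add 0 0 ℓ bs
      have e : (0 : ℝ) • (0 : Space →L[ℝ] Space) + ℓ.smulRight bs = ℓ.smulRight bs := by
        ext v; simp
      rw [e] at h
      rw [h]
      ring
    rw [hz]
    simp only [ContinuousLinearMap.comp_apply, sub_apply, add_apply, smul_apply,
      innerSL_apply_apply, smul_eq_mul, PiLp.proj_apply, hTv, spacePartL_apply]
    have hsymm : inner ℝ bs (radialDeriv y (spacePart (J (x + nullVec σ y)))) =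
        inner ℝ (spacePart (J (x + nullVec σ y))) (radialDeriv y bs) := by
      rw [real_inner_comm, inner_radialDeriv_comm, real_inner_comm]
    rw [hsymm]
    conv_lhs => rw [hb]
    simp only [map_add, map_smul, ← spacePartL_apply, PiLp.add_apply, PiLp.smul_apply, smul_eq_mul,
      inner_add_right, real_inner_smul_right, hcdef]
    linear_combination (b 0 * inner ℝ (radial y) (spacePartL (D (event 1 0))) -
      inner ℝ (radial y) bs * (D (event 1 0) 0)) * hσ2
  have h0 : ∀ᵐ y : Space, y ≠ 0 := by simp [ae_iff]
  have kae := h0.mono key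
  have hm4 : ∀ y, ‖spacePart (J (x + nullVec σ y))‖ ≤ C * (1 + ‖y‖) ^ (-3 : ℝ) := fun y =>
    (norm_spacePart_le _).trans (hC y)
  have hn1 : ∀ y v, |inner ℝ (radial y) v| ≤ ‖v‖ := fun y v =>
    (abs_real_inner_le_norm _ _).trans (mul_le_of_le_one_left (norm_nonneg _) (norm_radial_le y))
  have hcy : ∀ y, |c y| ≤ 2 * ‖b‖ := by
    intro y
    have h1 := hn1 y bs
    have h2 := norm_spacePart_le b
    have h3 := abs_time_le_norm b
    refine (abs_sub _ _).trans ?_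
    rw [abs_mul, hσ]
    linarith
  have hTn : ∀ y v, ‖T y v‖ ≤ (C' * (1 + ‖y‖) ^ (-4 : ℝ)) * (2 * ‖v‖) := by
    intro y v
    rw [hT, ContinuousLinearMap.comp_apply]
    refine (ContinuousLinearMap.le_opNorm _ _).trans ?_
    gcongr
    · exact hC' y
    · exact norm_nullVecDeriv_apply_le hσ y v
  rw [integral_congr_ae kae]
  refine integral_divergence_eq_zero (m := 3)
    (V := fun y => c y • spacePart (J (x + nullVec σ y)) +
      (σ * J (x + nullVec σ y) 0 - inner ℝ (radial y) (spacePart (J (x + nullVec σ y)))) • bs)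
    (C := 4 * ‖b‖ * C) (C' := ‖b‖ * (8 * C' + 4 * C)) (by norm_num) ?_ ?_ ?_ ?_
  · intro y hy
    have hj := hasFDerivAt_comp_cone σ hJ x hy
    have hjs : HasFDerivAt (fun y => spacePart (J (x + nullVec σ y)))
        (spacePartL.comp (T y)) y := spacePartL.hasFDerivAt.comp y hj
    have hj0 : HasFDerivAt (fun y => J (x + nullVec σ y) 0)
        ((EuclideanSpace.proj 0 : Spacetime →L[ℝ] ℝ).comp (T y)) y :=
      (EuclideanSpace.proj 0 : Spacetime →L[ℝ] ℝ).hasFDerivAt.comp y hj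
    have hr := hasFDerivAt_radial hy
    have hcd : HasFDerivAt c ((innerSL ℝ bs).comp (radialDeriv y)) y := by
      have := ((innerSL ℝ bs).hasFDerivAt.comp y hr).sub_const (σ * b 0)
      refine this.congr_of_eventuallyEq (Eventually.of_forall fun y => ?_)
      simp [hcdef, real_inner_comm]
    have hin : HasFDerivAt (fun y => inner ℝ (radial y) (spacePart (J (x + nullVec σ y))))
        ((innerSL ℝ (radial y)).comp (spacePartL.comp (T y)) +
        (innerSL ℝ (spacePart (J (x + nullVec σ y)))).comp (radialDeriv y)) y := by
      refine (hr.inner ℝ hjs).congr_fderiv ?_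
      ext v
      simp [fderivInnerCLM_apply, real_inner_comm]
    exact (hcd.smul hjs).add (((hj0.const_smul σ).sub hin).smul_const bs)
  · intro y
    have h1 : |σ * J (x + nullVec σ y) 0 - inner ℝ (radial y) (spacePart (J (x + nullVec σ y)))| ≤
        2 * (C * (1 + ‖y‖) ^ (-3 : ℝ)) := by
      refine (abs_sub _ _).trans ?_
      rw [abs_mul, hσ]
      have h1 := hn1 y (spacePart (J (x + nullVec σ y)))
      have h2 := hm4 y
      have h3 := (abs_time_le_norm _).trans (hC y)
      linarith
    refine (norm_add_le _ _).trans ?_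
    rw [norm_smul, norm_smul, Real.norm_eq_abs, Real.norm_eq_abs]
    calc _ ≤ (2 * ‖b‖) * (C * (1 + ‖y‖) ^ (-3 : ℝ)) +
          2 * (C * (1 + ‖y‖) ^ (-3 : ℝ)) * ‖b‖ := by
          gcongr
          · exact hcy y
          · exact hm4 y
          · exact norm_spacePart_le b
      _ = _ := by ring
  · intro y hy
    have hy0 : 0 < ‖y‖ := norm_pos_iff.2 hy
    have hbs : ‖bs‖ ≤ ‖b‖ := norm_spacePart_le b
    refine ContinuousLinearMap.opNorm_le_bound _ (by positivity) fun v => ?_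
    set w := ‖y‖⁻¹ * (1 + ‖y‖) ^ (-2 : ℝ) with hw
    have hw0 : 0 ≤ w := by positivity
    have b1 : ‖T y v‖ ≤ 2 * C' * w * ‖v‖ := by
      refine (hTn y v).trans ?_
      have := weight_le_inv_mul hy0 (m := 4) (by norm_num)
      calc _ ≤ C' * w * (2 * ‖v‖) := by gcongr
        _ = _ := by ring
    have b2 : ‖radialDeriv y v‖ * ‖spacePart (J (x + nullVec σ y))‖ ≤ 2 * C * w * ‖v‖ := by
      have h1 := weight_anti (norm_nonneg y) (show (2 : ℝ) ≤ 3 by norm_num)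
      calc _ ≤ (2 * ‖y‖⁻¹ * ‖v‖) * (C * (1 + ‖y‖) ^ (-2 : ℝ)) := by
            gcongr
            · exact norm_radialDeriv_apply_le y v
            · exact (hm4 y).trans (by gcongr)
        _ = _ := by rw [hw]; ring
    have b3 : ‖spacePart (T y v)‖ ≤ ‖T y v‖ := norm_spacePart_le _
    have b4 : |T y v 0| ≤ ‖T y v‖ := abs_time_le_norm _
    have c1 : ‖c y • spacePart (T y v)‖ ≤ 2 * ‖b‖ * ‖T y v‖ := by
      rw [norm_smul]
      gcongr
      exact hcy y
    have c2 : ‖inner ℝ bs (radialDeriv y v) • spacePart (J (x + nullVec σ y))‖ ≤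
        ‖b‖ * (2 * C * w * ‖v‖) := by
      rw [norm_smul]
      calc _ ≤ (‖bs‖ * ‖radialDeriv y v‖) * ‖spacePart (J (x + nullVec σ y))‖ := by
            gcongr; exact norm_inner_le_norm _ _
        _ = ‖bs‖ * (‖radialDeriv y v‖ * ‖spacePart (J (x + nullVec σ y))‖) := by ring
        _ ≤ _ := by gcongr
    have c3 : |σ * T y v 0 - (inner ℝ (radial y) (spacePart (T y v)) +
        inner ℝ (spacePart (J (x + nullVec σ y))) (radialDeriv y v))| ≤
        2 * ‖T y v‖ + 2 * C * w * ‖v‖ := by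
      refine (abs_sub _ _).trans ?_
      rw [abs_mul, hσ]
      have h1 := abs_add_le (inner ℝ (radial y) (spacePart (T y v)))
        (inner ℝ (spacePart (J (x + nullVec σ y))) (radialDeriv y v))
      have h2 := hn1 y (spacePart (T y v))
      have h3 := abs_real_inner_le_norm (spacePart (J (x + nullVec σ y))) (radialDeriv y v)
      linarith
    have e : V' y v = (c y • spacePart (T y v) +
        inner ℝ bs (radialDeriv y v) • spacePart (J (x + nullVec σ y))) +
        (σ * T y v 0 - (inner ℝ (radial y) (spacePart (T y v)) +
        inner ℝ (spacePart (J (x + nullVec σ y))) (radialDeriv y v))) • bs := rfl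
    rw [e]
    refine (norm_add_le _ _).trans ((add_le_add (norm_add_le _ _) le_rfl).trans ?_)
    rw [norm_smul _ bs, Real.norm_eq_abs]
    calc _ ≤ (2 * ‖b‖ * (2 * C' * w * ‖v‖) + ‖b‖ * (2 * C * w * ‖v‖)) +
          (2 * (2 * C' * w * ‖v‖) + 2 * C * w * ‖v‖) * ‖b‖ := by
          gcongr
          · exact c1.trans (by gcongr)
          · exact c3.trans (by gcongr)
      _ = _ := by ring
  · have hF : Continuous fun y : Space =>
        mink (nullVec σ y) (fderiv ℝ J (x + nullVec σ y) b) :=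
      (mink.continuous.comp (continuous_nullVec σ)).clm_apply
        ((hc.comp (continuous_const.add (continuous_nullVec σ))).clm_apply continuous_const)
    refine Integrable.congr ?_ kae
    refine ((integrable_norm_inv_mul_weight (m := 3) (by norm_num)).const_mul
      (2 * C' * ‖b‖)).mono' ?_ (Eventually.of_forall fun y => ?_)
    · have h2 : Measurable fun y : Space => ‖y‖⁻¹ := by fun_prop
      exact h2.aestronglyMeasurable.smul hF.aestronglyMeasurable
    · rw [norm_smul, norm_inv, norm_norm]
      have h1 : ‖fderiv ℝ J (x + nullVec σ y) b‖ ≤ C' * (1 + ‖y‖) ^ (-4 : ℝ) * ‖b‖ :=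
        (ContinuousLinearMap.le_opNorm _ _).trans (by gcongr; exact hC' y)
      have h2 : (1 + ‖y‖) ^ (-3 : ℝ) = (1 + ‖y‖) * (1 + ‖y‖) ^ (-4 : ℝ) := by
        rw [← Real.rpow_one_add' (by positivity) (by norm_num)]
        norm_num
      calc _ ≤ ‖y‖⁻¹ * ((2 * ‖y‖) * (C' * (1 + ‖y‖) ^ (-4 : ℝ) * ‖b‖)) := by
            gcongr
            refine (abs_mink_le _ _).trans ?_
            gcongr
            exact norm_nullVec_le hσ y
        _ ≤ ‖y‖⁻¹ * ((2 * (1 + ‖y‖)) * (C' * (1 + ‖y‖) ^ (-4 : ℝ) * ‖b‖)) := by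
            gcongr; linarith
        _ = _ := by rw [h2]; ring

end

noncomputable section

open Filter Topology Set

/-! ### Bipolar coordinates -/

open scoped ENNReal

/-- Substitution q² = c² + r² at fixed c, so that q dq = r dr. -/
theorem lintegral_Ioi_mul_comp_sqrt (c : ℝ) (h : ℝ → ℝ≥0∞) :
    ∫⁻ r in Ioi (0 : ℝ), ENNReal.ofReal r * h (√(c ^ 2 + r ^ 2)) =
      ∫⁻ q in Ioi |c|, ENNReal.ofReal q * h q := by
  have him : (fun r : ℝ => √(c ^ 2 + r ^ 2)) '' Ioi 0 = Ioi |c| := by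
    ext q
    constructor
    · rintro ⟨r, hr, rfl⟩
      have hr' : (0 : ℝ) < r := hr
      exact Real.lt_sqrt_of_sq_lt (by rw [sq_abs]; nlinarith)
    · intro hq
      have hq' : |c| < q := hq
      have h1 : c ^ 2 < q ^ 2 := sq_lt_sq.2 (hq'.trans_le (le_abs_self q))
      refine ⟨√(q ^ 2 - c ^ 2), Real.sqrt_pos.2 (by linarith), ?_⟩
      simp only
      rw [Real.sq_sqrt (by linarith), add_sub_cancel, Real.sqrt_sq ((abs_nonneg c).trans hq'.le)]
  rw [← him, lintegral_image_eq_lintegral_abs_deriv_mul measurableSet_Ioi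
    (f' := fun r => r / √(c ^ 2 + r ^ 2))]
  · refine setLIntegral_congr_fun measurableSet_Ioi fun r hr => ?_
    have hr' : (0 : ℝ) < r := hr
    have hs : 0 < √(c ^ 2 + r ^ 2) := Real.sqrt_pos.2 (by positivity)
    rw [← mul_assoc, ← ENNReal.ofReal_mul (abs_nonneg _), abs_of_pos (by positivity),
      div_mul_cancel₀ _ hs.ne']
  · intro r hr
    have hr' : (0 : ℝ) < r := hr
    have h1 : HasDerivAt (fun r : ℝ => c ^ 2 + r ^ 2) (2 * r) r := by
      simpa using ((hasDerivAt_id r).pow 2).const_add (c ^ 2)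
    refine ((h1.sqrt (by positivity)).congr_deriv ?_).hasDerivWithinAt
    field_simp
  · intro r hr r' hr' heq
    have h0 : (0 : ℝ) < r := hr
    have h0' : (0 : ℝ) < r' := hr'
    have := (Real.sqrt_inj (by positivity) (by positivity)).1 heq
    exact (pow_left_inj₀ h0.le h0'.le two_ne_zero).1 (by linarith)

/-- Law of cosines: s² = ρ² + q² + 2ρc, so s ds = ρ dc at fixed q, and s sweeps the range allowed by
the triangle inequality. -/
theorem lintegral_Ioo_comp_sqrt {ρ q : ℝ} (hρ : 0 < ρ) (hq : 0 < q) (h : ℝ → ℝ≥0∞) :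
    ENNReal.ofReal ρ * ∫⁻ c in Ioo (-q) q, h (√((ρ + c) ^ 2 + (q ^ 2 - c ^ 2))) =
      ∫⁻ s in Ioo |ρ - q| (ρ + q), ENNReal.ofReal s * h s := by
  have e : ∀ c, (ρ + c) ^ 2 + (q ^ 2 - c ^ 2) = ρ ^ 2 + q ^ 2 + 2 * ρ * c := fun c => by ring
  simp only [e]
  have hpos : ∀ c ∈ Ioo (-q) q, 0 < ρ ^ 2 + q ^ 2 + 2 * ρ * c := by
    intro c hc
    nlinarith [sq_nonneg (ρ - q), mul_pos hρ (show 0 < c + q by linarith [hc.1])]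
  have him : (fun c : ℝ => √(ρ ^ 2 + q ^ 2 + 2 * ρ * c)) '' Ioo (-q) q =
      Ioo |ρ - q| (ρ + q) := by
    ext s
    constructor
    · rintro ⟨c, hc, rfl⟩
      constructor
      · refine Real.lt_sqrt_of_sq_lt ?_
        rw [sq_abs]
        nlinarith [mul_pos hρ (show 0 < c + q by linarith [hc.1])]
      · refine (Real.sqrt_lt' (by positivity)).2 ?_
        nlinarith [mul_pos hρ (show 0 < q - c by linarith [hc.2])]
    · intro hs
      have hs0 : 0 < s := (abs_nonneg _).trans_lt hs.1
      have h1 : (ρ - q) ^ 2 < s ^ 2 := sq_lt_sq.2 (by rw [abs_of_pos hs0]; exact hs.1)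
      have h2 : s ^ 2 < (ρ + q) ^ 2 := by gcongr; exact hs.2
      refine ⟨(s ^ 2 - ρ ^ 2 - q ^ 2) / (2 * ρ), ⟨?_, ?_⟩, ?_⟩
      · rw [lt_div_iff₀ (by positivity)]; nlinarith
      · rw [div_lt_iff₀ (by positivity)]; nlinarith
      · simp only
        rw [mul_div_cancel₀ _ (by positivity), ← Real.sqrt_sq hs0.le]
        congr 1
        rw [Real.sqrt_sq hs0.le]
        ring
  rw [← him, lintegral_image_eq_lintegral_abs_deriv_mul measurableSet_Ioo
    (f' := fun c => ρ / √(ρ ^ 2 + q ^ 2 + 2 * ρ * c)),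
    ← lintegral_const_mul' _ _ ENNReal.ofReal_ne_top]
  · refine setLIntegral_congr_fun measurableSet_Ioo fun c hc => ?_
    have hs : 0 < √(ρ ^ 2 + q ^ 2 + 2 * ρ * c) := Real.sqrt_pos.2 (hpos c hc)
    rw [← mul_assoc, ← ENNReal.ofReal_mul (abs_nonneg _), abs_of_pos (by positivity),
      div_mul_cancel₀ _ hs.ne']
  · intro c hc
    have h1 : HasDerivAt (fun c : ℝ => ρ ^ 2 + q ^ 2 + 2 * ρ * c) (2 * ρ) c := by
      simpa using ((hasDerivAt_id c).const_mul (2 * ρ)).const_add (ρ ^ 2 + q ^ 2)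
    refine ((h1.sqrt (hpos c hc).ne').congr_deriv ?_).hasDerivWithinAt
    field_simp
  · intro r hr r' hr' heq
    have := (Real.sqrt_inj (hpos r hr).le (hpos r' hr').le).1 heq
    have h2 : 2 * ρ * r = 2 * ρ * r' := by linarith
    exact mul_left_cancel₀ (by positivity) h2

theorem lintegral_space_eq_cartesian {F : Space → ℝ≥0∞} (hF : Measurable F) :
    ∫⁻ y, F y = ∫⁻ c : ℝ, ∫⁻ p : ℝ × ℝ, F (!₂[c, p.1, p.2]) := by
  have h1 := (EuclideanSpace.volume_preserving_symm_measurableEquiv_toLp (Fin 3)).symm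
  have h2 := (volume_preserving_piFinSuccAbove (fun _ : Fin 3 => ℝ) 0).symm
  have h3 := (MeasurePreserving.id (volume : Measure ℝ)).prod
    (volume_preserving_finTwoArrow ℝ).symm
  have m1 := hF.comp h1.measurable
  have m2 := m1.comp h2.measurable
  have m3 := m2.comp h3.measurable
  have e1 := h1.lintegral_comp hF
  have e2 := h2.lintegral_comp m1
  have e3 := h3.lintegral_comp m2
  refine e1.symm.trans (e2.symm.trans (e3.symm.trans
    ((lintegral_prod _ m3.aemeasurable).trans ?_)))
  refine lintegral_congr fun c => lintegral_congr fun p => congrArg F ?_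
  ext i
  fin_cases i <;> rfl

theorem lintegral_plane_radial {h : ℝ → ℝ≥0∞} (hh : Measurable h) :
    ∫⁻ p : ℝ × ℝ, h (p.1 ^ 2 + p.2 ^ 2) =
      ENNReal.ofReal (2 * Real.pi) * ∫⁻ r in Ioi (0 : ℝ), ENNReal.ofReal r * h (r ^ 2) := by
  rw [← lintegral_comp_polarCoord_symm]
  have e : ∀ p : ℝ × ℝ, ENNReal.ofReal p.1 • h ((polarCoord.symm p).1 ^ 2 +
      (polarCoord.symm p).2 ^ 2) = ENNReal.ofReal p.1 * h (p.1 ^ 2) := by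
    intro p
    simp only [polarCoord_symm_apply, smul_eq_mul]
    congr 2
    linear_combination p.1 ^ 2 * Real.sin_sq_add_cos_sq p.2
  simp only [e]
  have ht : polarCoord.target = Ioi (0 : ℝ) ×ˢ Ioo (-Real.pi) Real.pi := rfl
  rw [ht, Measure.volume_eq_prod, ← Measure.prod_restrict, lintegral_prod _ (by fun_prop)]
  simp only [lintegral_const, Measure.restrict_apply_univ, Real.volume_Ioo]
  rw [lintegral_mul_const _ (by fun_prop), mul_comm]
  congr 2
  ring

theorem norm_cartesian_sq (a b c : ℝ) : ‖(!₂[a, b, c] : Space)‖ = √(a ^ 2 + (b ^ 2 + c ^ 2)) := by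
  rw [EuclideanSpace.norm_eq, Fin.sum_univ_three]
  simp [add_assoc]

/-- With c the coordinate along the axis, take polar coordinates in the transverse plane, replace
the transverse radius by q at fixed c, exchange the integrals, and replace c by s at fixed q. The
factor 2π is the angle, 1/ρ comes from the last substitution. -/
theorem lintegral_bipolar_axis {ρ : ℝ} (hρ : 0 < ρ) {G : ℝ → ℝ → ℝ≥0∞}
    (hG : Measurable (Function.uncurry G)) :
    ∫⁻ y : Space, G ‖y‖ ‖EuclideanSpace.single 0 ρ + y‖ =
      ENNReal.ofReal (2 * Real.pi / ρ) * ∫⁻ q in Ioi (0 : ℝ), ∫⁻ s in Ioo |ρ - q| (ρ + q),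
        ENNReal.ofReal q * (ENNReal.ofReal s * G q s) := by
  have hG2 : ∀ {α : Type} [MeasurableSpace α] {u v : α → ℝ}, Measurable u → Measurable v →
      Measurable fun x => G (u x) (v x) := fun hu hv => hG.comp (hu.prodMk hv)
  rw [lintegral_space_eq_cartesian (hG2 (by fun_prop) (by fun_prop))]
  have e : ∀ (c : ℝ) (p : ℝ × ℝ), G ‖(!₂[c, p.1, p.2] : Space)‖
      ‖(EuclideanSpace.single 0 ρ + !₂[c, p.1, p.2] : Space)‖ =
      G (√(c ^ 2 + (p.1 ^ 2 + p.2 ^ 2))) (√((ρ + c) ^ 2 + (p.1 ^ 2 + p.2 ^ 2))) := by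
    intro c p
    have : (EuclideanSpace.single 0 ρ + !₂[c, p.1, p.2] : Space) = !₂[ρ + c, p.1, p.2] := by
      ext i; fin_cases i <;> simp
    rw [this, norm_cartesian_sq, norm_cartesian_sq]
  simp only [e]
  have e2 : ∀ c : ℝ, ∫⁻ p : ℝ × ℝ, G (√(c ^ 2 + (p.1 ^ 2 + p.2 ^ 2)))
      (√((ρ + c) ^ 2 + (p.1 ^ 2 + p.2 ^ 2))) = ENNReal.ofReal (2 * Real.pi) *
      ∫⁻ q in Ioi (0 : ℝ), (Ioo (-q) q).indicator
        (fun c => ENNReal.ofReal q * G q (√((ρ + c) ^ 2 + (q ^ 2 - c ^ 2)))) c := by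
    intro c
    rw [lintegral_plane_radial (h := fun w => G (√(c ^ 2 + w)) (√((ρ + c) ^ 2 + w)))
      (hG2 (by fun_prop) (by fun_prop))]
    congr 1
    have h1 := lintegral_Ioi_mul_comp_sqrt c
      (fun q => G q (√((ρ + c) ^ 2 + (q ^ 2 - c ^ 2))))
    have h2 : ∀ r : ℝ, (√(c ^ 2 + r ^ 2)) ^ 2 - c ^ 2 = r ^ 2 := by
      intro r; rw [Real.sq_sqrt (by positivity)]; ring
    simp only [h2] at h1
    rw [h1, ← lintegral_indicator measurableSet_Ioi, ← lintegral_indicator measurableSet_Ioi]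
    refine lintegral_congr fun q => ?_
    simp only [indicator, mem_Ioi, mem_Ioo, ← abs_lt]
    by_cases hq : |c| < q
    · simp [hq, (abs_nonneg c).trans_lt hq]
    · simp [hq]
  simp only [e2]
  have hmeas : Measurable (Function.uncurry fun (c q : ℝ) => (Ioo (-q) q).indicator
        (fun c => ENNReal.ofReal q * G q (√((ρ + c) ^ 2 + (q ^ 2 - c ^ 2)))) c) := by
    have hset : MeasurableSet {z : ℝ × ℝ | z.1 ∈ Ioo (-z.2) z.2} :=
      (measurableSet_lt (f := fun z : ℝ × ℝ => -z.2) (g := fun z => z.1) (by fun_prop)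
        (by fun_prop)).inter (measurableSet_lt (f := fun z : ℝ × ℝ => z.1) (g := fun z => z.2)
        (by fun_prop) (by fun_prop))
    have : (Function.uncurry fun (c q : ℝ) => (Ioo (-q) q).indicator
        (fun c => ENNReal.ofReal q * G q (√((ρ + c) ^ 2 + (q ^ 2 - c ^ 2)))) c) =
        {z : ℝ × ℝ | z.1 ∈ Ioo (-z.2) z.2}.indicator (fun z => ENNReal.ofReal z.2 *
          G z.2 (√((ρ + z.1) ^ 2 + (z.2 ^ 2 - z.1 ^ 2)))) := by
      ext z; simp [indicator, Function.uncurry]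
    rw [this]
    exact (Measurable.mul (by fun_prop) (hG2 (by fun_prop) (by fun_prop))).indicator hset
  rw [lintegral_const_mul' _ _ ENNReal.ofReal_ne_top,
    lintegral_lintegral_swap hmeas.aemeasurable]
  have hfac : ENNReal.ofReal (2 * Real.pi) =
      ENNReal.ofReal (2 * Real.pi / ρ) * ENNReal.ofReal ρ := by
    rw [← ENNReal.ofReal_mul (by positivity), div_mul_cancel₀ _ hρ.ne']
  rw [hfac, mul_assoc, ← lintegral_const_mul' _ _ ENNReal.ofReal_ne_top]
  congr 1
  refine setLIntegral_congr_fun measurableSet_Ioi fun q hq => ?_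
  rw [lintegral_indicator measurableSet_Ioo, lintegral_const_mul' _ _ ENNReal.ofReal_ne_top,
    lintegral_const_mul' _ _ ENNReal.ofReal_ne_top, ← lintegral_Ioo_comp_sqrt hρ hq]
  ring

/-- Integration in bipolar coordinates: distances `q` to the origin and `s` to `-a`. -/
theorem lintegral_bipolar {a : Space} (ha : a ≠ 0) {G : ℝ → ℝ → ℝ≥0∞}
    (hG : Measurable (Function.uncurry G)) :
    ∫⁻ y : Space, G ‖y‖ ‖a + y‖ =
      ENNReal.ofReal (2 * Real.pi / ‖a‖) * ∫⁻ q in Ioi (0 : ℝ),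
        ∫⁻ s in Ioo |‖a‖ - q| (‖a‖ + q), ENNReal.ofReal q * (ENNReal.ofReal s * G q s) := by
  rw [← lintegral_bipolar_axis (norm_pos_iff.2 ha) hG]
  set w : Space := EuclideanSpace.single 0 ‖a‖
  have hw : ‖a‖ = ‖w‖ := by simp [w]
  -- As a and w have equal norm, the reflection in the hyperplane orthogonal to a - w sends a to w
  -- and reduces the claim to the axis.
  set U := (Submodule.span ℝ {a - w})ᗮ.reflection
  have hU : U a = w := Submodule.reflection_sub hw
  have hm : Measurable fun y : Space => G ‖y‖ ‖w + y‖ :=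
    hG.comp ((by fun_prop : Measurable fun y : Space => ‖y‖).prodMk (by fun_prop))
  rw [← U.measurePreserving.lintegral_comp hm]
  refine lintegral_congr fun y => ?_
  rw [← hU, ← map_add, U.norm_map, U.norm_map]

end

noncomputable section

open Filter Topology Set

open scoped ENNReal

/-! ### Estimates of the cone integrals of radial majorants -/

/-- The Jacobian factor q cancels 1/|y|. With t = -σx⁰, the shift v = t + s - q turns the time |t -
q| into |v - s|. The triangle inequalities |ρ - q| < s < ρ + q confine v to (t - ρ, t + ρ) and give
v - (t - ρ) < 2s. -/
theorem lintegral_cone_le {σ : ℝ} (hσ : |σ| = 1) {x : Spacetime} (hx : spacePart x ≠ 0)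
    {g : ℝ → ℝ → ℝ≥0∞} (hg : Measurable (Function.uncurry g)) :
    ∫⁻ y : Space, ENNReal.ofReal ‖y‖⁻¹ * g |x 0 + σ * ‖y‖| ‖spacePart x + y‖ ≤
      ENNReal.ofReal (2 * Real.pi / ‖spacePart x‖) *
        ∫⁻ v in Ioo (-σ * x 0 - ‖spacePart x‖) (-σ * x 0 + ‖spacePart x‖),
          ∫⁻ s in {s | 0 < s ∧ v - (-σ * x 0 - ‖spacePart x‖) < 2 * s},
            ENNReal.ofReal s * g |v - s| s := by
  set ρ := ‖spacePart x‖ with hρ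
  set t := -σ * x 0 with ht
  have hρ0 : 0 < ρ := norm_pos_iff.2 hx
  have hg2 : ∀ {α : Type} [MeasurableSpace α] {u v : α → ℝ}, Measurable u → Measurable v →
      Measurable fun x => g (u x) (v x) := fun hu hv => hg.comp (hu.prodMk hv)
  have habs : ∀ q, |x 0 + σ * q| = |t - q| := by
    intro q
    have h1 : σ * σ = 1 := by rw [← abs_mul_abs_self, hσ, one_mul]
    have : x 0 + σ * q = -(σ * (t - q)) := by rw [ht]; linear_combination (-x 0) * h1
    rw [this, abs_neg, abs_mul, hσ, one_mul]
  rw [lintegral_bipolar hx (G := fun q s => ENNReal.ofReal q⁻¹ * g |x 0 + σ * q| s)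
    (Measurable.mul (by fun_prop) (hg2 (by fun_prop) (by fun_prop)))]
  refine mul_le_mul' le_rfl ?_
  set S : Set (ℝ × ℝ) := {z | 0 < z.1 ∧ |ρ - z.1| < z.2 ∧ z.2 < ρ + z.1} with hS
  have hSm : MeasurableSet S := by
    refine (measurableSet_lt (f := fun _ : ℝ × ℝ => (0 : ℝ)) (g := fun z => z.1) (by fun_prop)
      (by fun_prop)).inter ((measurableSet_lt (f := fun z : ℝ × ℝ => |ρ - z.1|)
      (g := fun z => z.2) (by fun_prop) (by fun_prop)).inter
      (measurableSet_lt (f := fun z : ℝ × ℝ => z.2) (g := fun z => ρ + z.1) (by fun_prop)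
        (by fun_prop)))
  set H : ℝ × ℝ → ℝ≥0∞ := S.indicator (fun z => ENNReal.ofReal z.2 * g |t - z.1| z.2) with hH
  have hHm : Measurable H :=
    (Measurable.mul (by fun_prop) (hg2 (by fun_prop) (by fun_prop))).indicator hSm
  have step1 : ∫⁻ q in Ioi (0 : ℝ), ∫⁻ s in Ioo |ρ - q| (ρ + q),
      ENNReal.ofReal q * (ENNReal.ofReal s * (ENNReal.ofReal q⁻¹ * g |x 0 + σ * q| s)) =
      ∫⁻ q, ∫⁻ s, H (q, s) := by
    rw [← lintegral_indicator measurableSet_Ioi]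
    refine lintegral_congr fun q => ?_
    by_cases hq : 0 < q
    · rw [indicator_of_mem (show q ∈ Ioi 0 from hq), ← lintegral_indicator measurableSet_Ioo]
      refine lintegral_congr fun s => ?_
      have h1 : ENNReal.ofReal q * ENNReal.ofReal q⁻¹ = 1 := by
        rw [← ENNReal.ofReal_mul hq.le, mul_inv_cancel₀ hq.ne', ENNReal.ofReal_one]
      have h2 : ENNReal.ofReal q * (ENNReal.ofReal s * (ENNReal.ofReal q⁻¹ * g |x 0 + σ * q| s)) =
          ENNReal.ofReal s * g |t - q| s := by
        rw [← habs]
        calc _ = (ENNReal.ofReal q * ENNReal.ofReal q⁻¹) *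
              (ENNReal.ofReal s * g |x 0 + σ * q| s) := by ring
          _ = _ := by rw [h1, one_mul]
      simp [hH, hS, indicator, hq, ← h2]
    · rw [indicator_of_notMem (show q ∉ Ioi 0 from hq)]
      simp [hH, hS, hq]
  have step2 : ∫⁻ q, ∫⁻ s, H (q, s) = ∫⁻ v, ∫⁻ s, H (t + s - v, s) := by
    rw [lintegral_lintegral_swap (f := fun q s => H (q, s)) hHm.aemeasurable,
      lintegral_lintegral_swap (f := fun v s => H (t + s - v, s))
        (hHm.comp (f := fun z : ℝ × ℝ => (t + z.2 - z.1, z.2)) (by fun_prop)).aemeasurable]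
    exact lintegral_congr fun s => (lintegral_sub_left_eq_self (fun q => H (q, s)) (t + s)).symm
  rw [step1, step2, ← lintegral_indicator measurableSet_Ioo]
  refine lintegral_mono fun v => ?_
  have hset : MeasurableSet {s : ℝ | 0 < s ∧ v - (t - ρ) < 2 * s} :=
    (measurableSet_lt (f := fun _ : ℝ => (0 : ℝ)) (g := fun z => z) (by fun_prop)
      (by fun_prop)).inter (measurableSet_lt (f := fun _ : ℝ => v - (t - ρ))
      (g := fun s => 2 * s) (by fun_prop) (by fun_prop))
  by_cases hv : v ∈ Ioo (t - ρ) (t + ρ)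
  · rw [indicator_of_mem hv, ← lintegral_indicator hset]
    refine lintegral_mono fun s => ?_
    by_cases hs : (t + s - v, s) ∈ S
    · have hs' := hs
      obtain ⟨h1, h2, h3⟩ := hs
      rw [abs_lt] at h2
      simp only at h1 h2 h3
      have : s ∈ {s : ℝ | 0 < s ∧ v - (t - ρ) < 2 * s} := ⟨by linarith, by linarith⟩
      simp only [hH]
      rw [indicator_of_mem hs', indicator_of_mem this]
      simp only
      rw [show t - (t + s - v) = v - s by ring]
    · simp only [hH]
      rw [indicator_of_notMem hs]
      exact zero_le
  · rw [indicator_of_notMem hv]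
    refine le_of_eq (lintegral_eq_zero_of_ae_eq_zero (Eventually.of_forall fun s => ?_))
    simp only [hH, Pi.zero_apply]
    refine indicator_of_notMem (fun hs => hv ?_) _
    obtain ⟨h1, h2, h3⟩ := hs
    rw [abs_lt] at h2
    simp only at h1 h2 h3
    constructor <;> linarith

theorem lintegral_Ioi_rpow_shift {b γ : ℝ} (hb : 0 < b) (hγ : 1 < γ) :
    ∫⁻ s in Ioi (0 : ℝ), ENNReal.ofReal ((b + s) ^ (-γ)) =
      ENNReal.ofReal (b ^ (1 - γ) / (γ - 1)) := by
  have hd : ∀ s ∈ Ioi (0 : ℝ), HasDerivAt (fun s => -((b + s) ^ (1 - γ) / (γ - 1)))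
      ((b + s) ^ (-γ)) s := by
    intro s hs
    have hs' : (0 : ℝ) < s := hs
    have h1 := ((hasDerivAt_id s).const_add b).rpow_const (p := 1 - γ)
      (Or.inl (by simp; positivity))
    refine ((h1.div_const (γ - 1)).neg).congr_deriv ?_
    have : γ - 1 ≠ 0 := by linarith
    simp only [id, show 1 - γ - 1 = -γ by ring]
    field_simp
    ring
  have hc : ContinuousWithinAt (fun s => -((b + s) ^ (1 - γ) / (γ - 1))) (Ici 0) 0 := by
    refine ContinuousAt.continuousWithinAt ?_
    refine ((ContinuousAt.rpow_const (by fun_prop) (Or.inl (by simp; positivity))).div_const _).neg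
  have hlim : Tendsto (fun s => -((b + s) ^ (1 - γ) / (γ - 1))) atTop (𝓝 0) := by
    have h1 : Tendsto (fun s : ℝ => (b + s) ^ (-(γ - 1))) atTop (𝓝 0) :=
      (tendsto_rpow_neg_atTop (by linarith)).comp (tendsto_atTop_add_const_left _ b tendsto_id)
    simpa using (h1.div_const (γ - 1)).neg
  have hpos : ∀ s ∈ Ioi (0 : ℝ), 0 ≤ (b + s) ^ (-γ) := by
    intro s hs
    have hs' : (0 : ℝ) < s := hs
    positivity
  have hint := integrableOn_Ioi_deriv_of_nonneg hc hd hpos hlim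
  have hval := integral_Ioi_of_hasDerivAt_of_nonneg hc hd hpos hlim
  rw [← ofReal_integral_eq_lintegral_ofReal hint
    ((ae_restrict_iff' measurableSet_Ioi).2 (Eventually.of_forall hpos)), hval]
  simp

theorem lintegral_comp_abs_eq {h : ℝ → ℝ≥0∞} :
    ∫⁻ w, h |w| = 2 * ∫⁻ w in Ioi (0 : ℝ), h w := by
  rw [← lintegral_add_compl _ (measurableSet_Ioi (a := (0 : ℝ))), two_mul]
  congr 1
  · exact setLIntegral_congr_fun measurableSet_Ioi fun w hw => by
      rw [abs_of_pos (show (0 : ℝ) < w from hw)]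
  · rw [compl_Ioi, ← setLIntegral_congr (Iio_ae_eq_Iic (a := (0 : ℝ)))]
    have h1 := (Measure.measurePreserving_neg (volume : Measure ℝ)).setLIntegral_comp_emb
      (Homeomorph.neg ℝ).measurableEmbedding (fun w => h w) (Iio 0)
    have h2 : (fun w : ℝ => -w) '' Iio 0 = Ioi 0 := by simp
    rw [h2] at h1
    rw [← h1]
    exact setLIntegral_congr_fun measurableSet_Iio fun w hw => by
      rw [abs_of_neg (show w < (0 : ℝ) from hw)]

/-- The pointwise bound behind the cone estimates. -/
theorem cone_pointwise_bound {u v s : ℝ} (huv : u < v) (hs : 0 < s) (h2 : v - u < 2 * s) :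
    s ≤ 1 + √(|v - s| ^ 2 + s ^ 2) ∧
      1 + |u| + |v| + s ≤ 5 * (1 + √(|v - s| ^ 2 + s ^ 2)) := by
  set r := √(|v - s| ^ 2 + s ^ 2)
  have h3 : s ≤ r := Real.le_sqrt_of_sq_le (by nlinarith [sq_nonneg |v - s|])
  have h4 : |v - s| ≤ r := Real.le_sqrt_of_sq_le (by nlinarith)
  rw [abs_le] at h4
  refine ⟨by linarith, ?_⟩
  rcases abs_cases u with ⟨h5, _⟩ | ⟨h5, _⟩ <;> rcases abs_cases v with ⟨h6, _⟩ | ⟨h6, _⟩ <;>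
    rw [h5, h6] <;> linarith

/-- The factor s of the measure costs one power of the weight; what is left decays in both null
coordinates u, v as well as in s. -/
theorem mul_majorant_le {m u v s : ℝ} (hm : 1 ≤ m) (huv : u < v) (hs : 0 < s)
    (h2 : v - u < 2 * s) :
    s * (1 + √(|v - s| ^ 2 + s ^ 2)) ^ (-m) ≤
      5 ^ (m - 1) * (1 + |u| + |v| + s) ^ (-(m - 1)) := by
  obtain ⟨h3, h4⟩ := cone_pointwise_bound huv hs h2
  set N := 1 + √(|v - s| ^ 2 + s ^ 2)
  have hN : 0 < N := by positivity
  calc s * N ^ (-m) ≤ N * N ^ (-m) := by gcongr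
    _ = N ^ (-(m - 1)) := by
        rw [show -(m - 1) = 1 + -m by ring, Real.rpow_add hN, Real.rpow_one]
    _ ≤ ((1 + |u| + |v| + s) / 5) ^ (-(m - 1)) :=
        Real.rpow_le_rpow_of_nonpos (by positivity) (by linarith) (by linarith)
    _ = _ := by
        rw [div_eq_mul_inv, Real.mul_rpow (by positivity) (by positivity), mul_comm]
        congr 1
        rw [Real.inv_rpow (by norm_num), Real.rpow_neg (by norm_num), inv_inv]

theorem lintegral_inner_le {m u v : ℝ} (hm : 2 < m) (huv : u < v) :
    ∫⁻ s in {s | 0 < s ∧ v - u < 2 * s}, ENNReal.ofReal s *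
        ENNReal.ofReal ((1 + √(|v - s| ^ 2 + s ^ 2)) ^ (-m)) ≤
      ENNReal.ofReal (5 ^ (m - 1) / (m - 2) * (1 + |u| + |v|) ^ (-(m - 2))) := by
  have hset : MeasurableSet {s : ℝ | 0 < s ∧ v - u < 2 * s} :=
    (measurableSet_lt (f := fun _ : ℝ => (0 : ℝ)) (g := fun z => z) (by fun_prop)
      (by fun_prop)).inter (measurableSet_lt (f := fun _ : ℝ => v - u)
      (g := fun s => 2 * s) (by fun_prop) (by fun_prop))
  calc _ ≤ ∫⁻ s in {s | 0 < s ∧ v - u < 2 * s}, ENNReal.ofReal (5 ^ (m - 1)) *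
        ENNReal.ofReal ((1 + |u| + |v| + s) ^ (-(m - 1))) := by
        refine setLIntegral_mono' hset fun s hs => ?_
        rw [← ENNReal.ofReal_mul hs.1.le, ← ENNReal.ofReal_mul (by positivity)]
        exact ENNReal.ofReal_le_ofReal (mul_majorant_le (by linarith) huv hs.1 hs.2)
    _ ≤ ∫⁻ s in Ioi (0 : ℝ), ENNReal.ofReal (5 ^ (m - 1)) *
        ENNReal.ofReal ((1 + |u| + |v| + s) ^ (-(m - 1))) :=
        lintegral_mono_set fun s hs => hs.1
    _ = _ := by
        rw [lintegral_const_mul' _ _ ENNReal.ofReal_ne_top,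
          lintegral_Ioi_rpow_shift (by positivity) (by linarith),
          ← ENNReal.ofReal_mul (by positivity)]
        congr 1
        rw [show 1 - (m - 1) = -(m - 2) by ring, show m - 1 - 1 = m - 2 by ring]
        ring

theorem lintegral_outer_le_of_one_lt {γ u : ℝ} (hγ : 1 < γ) (s : Set ℝ) :
    ∫⁻ w in s, ENNReal.ofReal ((1 + |u| + |w|) ^ (-γ)) ≤
      ENNReal.ofReal (2 / (γ - 1) * (1 + |u|) ^ (-(γ - 1))) := by
  refine (setLIntegral_le_lintegral _ _).trans (le_of_eq ?_)
  rw [lintegral_comp_abs_eq (h := fun w => ENNReal.ofReal ((1 + |u| + w) ^ (-γ))),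
    lintegral_Ioi_rpow_shift (by positivity) hγ, ← ENNReal.ofReal_ofNat 2,
    ← ENNReal.ofReal_mul (by norm_num)]
  congr 1
  rw [show 1 - γ = -(γ - 1) by ring]
  simp
  ring

/-- The trivial estimate by the length 2|𝐱| of the interval. It is used where |𝐱| may be small, to
cancel the prefactor 1/|𝐱| of the bipolar formula. -/
theorem lintegral_outer_le_length {γ u a b : ℝ} (hγ : 0 ≤ γ) :
    ∫⁻ w in Ioo a b, ENNReal.ofReal ((1 + |u| + |w|) ^ (-γ)) ≤
      ENNReal.ofReal ((1 + |u|) ^ (-γ) * (b - a)) := by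
  calc _ ≤ ∫⁻ _ in Ioo a b, ENNReal.ofReal ((1 + |u|) ^ (-γ)) := by
        refine lintegral_mono fun w => ENNReal.ofReal_le_ofReal ?_
        exact Real.rpow_le_rpow_of_nonpos (by positivity) (by linarith [abs_nonneg w])
          (by linarith)
    _ = _ := by
        rw [setLIntegral_const, Real.volume_Ioo, ← ENNReal.ofReal_mul (by positivity)]

theorem lintegral_outer_le_of_lt_one {γ u a b L : ℝ} (hγ : 0 ≤ γ) (hγ1 : γ < 1) (hL : 0 ≤ L)
    (ha : -L ≤ a) (hb : b ≤ L) :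
    ∫⁻ w in Ioo a b, ENNReal.ofReal ((1 + |u| + |w|) ^ (-γ)) ≤
      ENNReal.ofReal (2 / (1 - γ) * (1 + L) ^ (1 - γ)) := by
  have h1 : ∫⁻ w in Ioo a b, ENNReal.ofReal ((1 + |u| + |w|) ^ (-γ)) ≤
      ∫⁻ w, (Ioc 0 L).indicator (fun w => ENNReal.ofReal ((1 + w) ^ (-γ))) |w| := by
    rw [← lintegral_indicator measurableSet_Ioo]
    refine lintegral_mono_ae ?_
    have h0 : ∀ᵐ w : ℝ, w ≠ 0 := by simp [ae_iff]
    filter_upwards [h0] with w hw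
    by_cases hwm : w ∈ Ioo a b
    · have : |w| ∈ Ioc 0 L := ⟨abs_pos.2 hw, abs_le.2 ⟨by linarith [hwm.1], by linarith [hwm.2]⟩⟩
      rw [indicator_of_mem hwm, indicator_of_mem this]
      exact ENNReal.ofReal_le_ofReal (Real.rpow_le_rpow_of_nonpos (by positivity)
        (by linarith [abs_nonneg u]) (by linarith))
    · rw [indicator_of_notMem hwm]
      exact zero_le
  refine h1.trans ?_
  rw [lintegral_comp_abs_eq, setLIntegral_indicator measurableSet_Ioc,
    inter_eq_self_of_subset_left (fun w hw => hw.1)]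
  have hcont : ContinuousOn (fun w : ℝ => (1 + w) ^ (-γ)) (uIcc 0 L) := by
    refine ContinuousOn.rpow_const (by fun_prop) fun w hw => Or.inl ?_
    rw [uIcc_of_le hL] at hw
    linarith [hw.1]
  have hval : ∫ w in (0 : ℝ)..L, (1 + w) ^ (-γ) =
      (1 + L) ^ (1 - γ) / (1 - γ) - (1 + 0) ^ (1 - γ) / (1 - γ) := by
    refine intervalIntegral.integral_eq_sub_of_hasDerivAt
      (f := fun w : ℝ => (1 + w) ^ (1 - γ) / (1 - γ)) (fun w hw => ?_)
      hcont.intervalIntegrable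
    rw [uIcc_of_le hL] at hw
    have h1 := ((hasDerivAt_id w).const_add 1).rpow_const (p := 1 - γ)
      (Or.inl (by simp only [id]; linarith [hw.1]))
    refine (h1.div_const (1 - γ)).congr_deriv ?_
    have : 1 - γ ≠ 0 := by linarith
    simp only [id, show 1 - γ - 1 = -γ by ring]
    field_simp
  have hint : IntegrableOn (fun w : ℝ => (1 + w) ^ (-γ)) (Ioc 0 L) :=
    (intervalIntegrable_iff_integrableOn_Ioc_of_le hL).1 hcont.intervalIntegrable
  rw [← ofReal_integral_eq_lintegral_ofReal hint, ← intervalIntegral.integral_of_le hL, hval,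
    ← ENNReal.ofReal_ofNat 2, ← ENNReal.ofReal_mul (by norm_num)]
  · refine ENNReal.ofReal_le_ofReal ?_
    have : 0 < 1 - γ := by linarith
    simp only [add_zero, Real.one_rpow]
    have h3 : 0 ≤ 1 / (1 - γ) := by positivity
    have e : 2 / (1 - γ) * (1 + L) ^ (1 - γ) = 2 * ((1 + L) ^ (1 - γ) / (1 - γ)) := by ring
    rw [e]
    simp
    linarith
  · refine (ae_restrict_iff' measurableSet_Ioc).2 (Eventually.of_forall fun w hw => ?_)
    have := hw.1
    simp only [Pi.zero_apply]
    positivity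

end

/-! ### Cone integrals of power weights and of timelike weights. -/

noncomputable section

open Filter Topology Set

open scoped ENNReal

/-- One plus the distance in time from the light cone of the origin. -/
def coneDist (x : Spacetime) : ℝ := 1 + |(|x 0| - ‖spacePart x‖)|

theorem one_le_coneDist (x : Spacetime) : 1 ≤ coneDist x := by
  unfold coneDist; linarith [abs_nonneg (|x 0| - ‖spacePart x‖)]

theorem continuous_coneDist : Continuous coneDist := by
  have : coneDist = fun x => 1 + |(|x 0| - ‖spacePartL x‖)| := rfl
  rw [this]
  fun_prop

theorem coneDist_le {σ : ℝ} (hσ : |σ| = 1) (x : Spacetime) :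
    coneDist x ≤ 1 + |(-σ * x 0 - ‖spacePart x‖)| := by
  have h := abs_abs_sub_abs_le (-σ * x 0) ‖spacePart x‖
  rw [abs_mul, abs_neg, hσ, one_mul, abs_norm] at h
  unfold coneDist
  linarith

/-- Either |𝐱| is comparable with 1 + |x|, so that the prefactor 1/|𝐱| is already good, or 1 + |u|
is comparable with 1 + |x| for u = -σx⁰ - |𝐱|, and the length of the v interval cancels the
prefactor. -/
theorem far_or_interior {σ : ℝ} (hσ : |σ| = 1) (x : Spacetime) :
    (1 + ‖x‖) / 4 ≤ ‖spacePart x‖ ∨ (1 + ‖x‖) / 2 ≤ 1 + |(-σ * x 0 - ‖spacePart x‖)| := by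
  by_contra! hcon
  obtain ⟨h1, h2⟩ := hcon
  have h3 : ‖x‖ ≤ |x 0| + ‖spacePart x‖ := by
    conv_lhs => rw [← event_spacePart x]
    exact norm_event_le _ _
  have h := abs_sub_abs_le_abs_sub (-σ * x 0) ‖spacePart x‖
  rw [abs_mul, abs_neg, hσ, one_mul, abs_norm] at h
  linarith

theorem measurable_majorant (m : ℝ) : Measurable (Function.uncurry fun a s : ℝ =>
    ENNReal.ofReal ((1 + √(a ^ 2 + s ^ 2)) ^ (-m))) := by
  simp only [Function.uncurry_def]
  fun_prop

theorem norm_cone_point (σ : ℝ) (x : Spacetime) (y : Space) :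
    ‖x + nullVec σ y‖ = √(|x 0 + σ * ‖y‖| ^ 2 + ‖spacePart x + y‖ ^ 2) := by
  rw [← event_cone, sq_abs, ← norm_event_sq, Real.sqrt_sq (norm_nonneg _)]

theorem lintegral_majorant_le {σ m : ℝ} (hσ : |σ| = 1) (hm : 2 < m) {x : Spacetime}
    (hx : spacePart x ≠ 0) :
    ∫⁻ y : Space, ENNReal.ofReal ‖y‖⁻¹ * ENNReal.ofReal ((1 + ‖x + nullVec σ y‖) ^ (-m)) ≤
      ENNReal.ofReal (2 * Real.pi / ‖spacePart x‖ * (5 ^ (m - 1) / (m - 2))) *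
        ∫⁻ v in Ioo (-σ * x 0 - ‖spacePart x‖) (-σ * x 0 + ‖spacePart x‖),
          ENNReal.ofReal ((1 + |(-σ * x 0 - ‖spacePart x‖)| + |v|) ^ (-(m - 2))) := by
  simp only [norm_cone_point]
  refine (lintegral_cone_le hσ hx (measurable_majorant m)).trans ?_
  rw [ENNReal.ofReal_mul (by positivity), mul_assoc]
  refine mul_le_mul' le_rfl ?_
  rw [← lintegral_const_mul' _ _ ENNReal.ofReal_ne_top]
  refine setLIntegral_mono' measurableSet_Ioo fun v hv => ?_
  rw [← ENNReal.ofReal_mul (div_nonneg (by positivity) (by linarith))]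
  exact lintegral_inner_le hm hv.1

/-- Here the v integrand has exponent m - 2 > 1, so the integral over the whole line converges to a
multiple of (1 + |u|)^(-(m-3)), and `coneDist x` ≤ 1 + |u|. -/
theorem lintegral_majorant_le_of_three_lt {σ m : ℝ} (hσ : |σ| = 1) (hm : 3 < m) {x : Spacetime}
    (hx : spacePart x ≠ 0) :
    ∫⁻ y : Space, ENNReal.ofReal ‖y‖⁻¹ * ENNReal.ofReal ((1 + ‖x + nullVec σ y‖) ^ (-m)) ≤
      ENNReal.ofReal (5 ^ (m - 1) / (m - 2) * (16 * Real.pi / (m - 3) + 8 * Real.pi) *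
        ((1 + ‖x‖)⁻¹ * coneDist x ^ (-(m - 3)))) := by
  have hρ : 0 < ‖spacePart x‖ := norm_pos_iff.2 hx
  have hc := coneDist_le hσ x
  have hc1 := one_le_coneDist x
  refine (lintegral_majorant_le hσ (by linarith) hx).trans ?_
  have hA : 0 ≤ 5 ^ (m - 1) / (m - 2) := div_nonneg (by positivity) (by linarith)
  set A := 5 ^ (m - 1) / (m - 2)
  set ρ := ‖spacePart x‖
  set u := -σ * x 0 - ρ
  set d := coneDist x ^ (-(m - 3))
  have hm3 : 0 < m - 3 := by linarith
  have hd : 0 ≤ d := by positivity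
  have hud : (1 + |u|) ^ (-(m - 3)) ≤ d :=
    Real.rpow_le_rpow_of_nonpos (by linarith) hc (by linarith)
  have hpi := Real.pi_pos
  rcases far_or_interior hσ x with h | h
  · refine (mul_le_mul' le_rfl (lintegral_outer_le_of_one_lt (by linarith) _)).trans ?_
    rw [← ENNReal.ofReal_mul (by positivity)]
    refine ENNReal.ofReal_le_ofReal ?_
    rw [show m - 2 - 1 = m - 3 by ring]
    have h1 : 2 * Real.pi / ρ ≤ 8 * Real.pi * (1 + ‖x‖)⁻¹ := by
      rw [div_le_iff₀ hρ, mul_assoc, mul_comm (1 + ‖x‖)⁻¹, ← div_eq_mul_inv,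
        mul_div_assoc', le_div_iff₀ (by positivity)]
      nlinarith
    calc _ ≤ 8 * Real.pi * (1 + ‖x‖)⁻¹ * A * (2 / (m - 3) * d) := by gcongr
      _ = A * (16 * Real.pi / (m - 3)) * ((1 + ‖x‖)⁻¹ * d) := by ring
      _ ≤ _ := by gcongr; linarith
  · refine (mul_le_mul' le_rfl (lintegral_outer_le_length (by linarith))).trans ?_
    rw [← ENNReal.ofReal_mul (by positivity)]
    refine ENNReal.ofReal_le_ofReal ?_
    have e1 : (1 + |u|) ^ (-(m - 2)) ≤ 2 * (1 + ‖x‖)⁻¹ * d := by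
      rw [show -(m - 2) = -1 + -(m - 3) by ring, Real.rpow_add (by positivity),
        Real.rpow_neg_one]
      gcongr
      rw [← inv_inv (2 : ℝ), ← mul_inv]
      gcongr
      linarith
    calc _ = 4 * Real.pi * A * (1 + |u|) ^ (-(m - 2)) := by
          have : -σ * x 0 + ρ - u = 2 * ρ := by simp only [u]; ring
          rw [this]
          field_simp
          ring
      _ ≤ 4 * Real.pi * A * (2 * (1 + ‖x‖)⁻¹ * d) := by gcongr
      _ = A * (8 * Real.pi) * ((1 + ‖x‖)⁻¹ * d) := by ring
      _ ≤ _ := by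
          gcongr
          linarith [show 0 ≤ 16 * Real.pi / (m - 3) by positivity]

/-- Here the v integral diverges at infinity, but v stays within 2|x|; it contributes (1 +
|x|)^(3-m), with nothing gained from the distance to the cone. -/
theorem lintegral_majorant_le_of_lt_three {σ m : ℝ} (hσ : |σ| = 1) (hm : 2 < m) (hm3 : m < 3)
    {x : Spacetime} (hx : spacePart x ≠ 0) :
    ∫⁻ y : Space, ENNReal.ofReal ‖y‖⁻¹ * ENNReal.ofReal ((1 + ‖x + nullVec σ y‖) ^ (-m)) ≤
      ENNReal.ofReal (5 ^ (m - 1) / (m - 2) * (48 * Real.pi / (3 - m) + 8 * Real.pi) *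
        (1 + ‖x‖) ^ (-(m - 2))) := by
  have hρ : 0 < ‖spacePart x‖ := norm_pos_iff.2 hx
  refine (lintegral_majorant_le hσ (by linarith) hx).trans ?_
  have hA : 0 ≤ 5 ^ (m - 1) / (m - 2) := div_nonneg (by positivity) (by linarith)
  have hR : 0 < 1 + ‖x‖ := by positivity
  have hpi := Real.pi_pos
  have h3m : 0 < 3 - m := by linarith
  have hρx : ‖spacePart x‖ ≤ ‖x‖ := norm_spacePart_le x
  have hux : |-σ * x 0| ≤ ‖x‖ := by
    rw [abs_mul, abs_neg, hσ, one_mul]; exact abs_time_le_norm x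
  rw [abs_le] at hux
  set A := 5 ^ (m - 1) / (m - 2)
  set ρ := ‖spacePart x‖
  rcases far_or_interior hσ x with h | h
  · refine (mul_le_mul' le_rfl (lintegral_outer_le_of_lt_one (L := 2 * ‖x‖) (by linarith)
      (by linarith) (by positivity) (by linarith [hux.1]) (by linarith [hux.2]))).trans ?_
    rw [← ENNReal.ofReal_mul (by positivity)]
    refine ENNReal.ofReal_le_ofReal ?_
    rw [show 1 - (m - 2) = 3 - m by ring]
    have h1 : 2 * Real.pi / ρ ≤ 8 * Real.pi * (1 + ‖x‖)⁻¹ := by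
      rw [div_le_iff₀ hρ, mul_assoc, mul_comm (1 + ‖x‖)⁻¹, ← div_eq_mul_inv,
        mul_div_assoc', le_div_iff₀ (by positivity)]
      nlinarith
    have h2 : (1 + 2 * ‖x‖) ^ (3 - m) ≤ 3 * (1 + ‖x‖) ^ (3 - m) := by
      calc _ ≤ (3 * (1 + ‖x‖)) ^ (3 - m) := by gcongr; linarith [norm_nonneg x]
        _ = 3 ^ (3 - m) * (1 + ‖x‖) ^ (3 - m) := Real.mul_rpow (by norm_num) hR.le
        _ ≤ 3 ^ (1 : ℝ) * (1 + ‖x‖) ^ (3 - m) := by gcongr <;> linarith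
        _ = _ := by rw [Real.rpow_one]
    have h3 : (1 + ‖x‖)⁻¹ * (1 + ‖x‖) ^ (3 - m) = (1 + ‖x‖) ^ (-(m - 2)) := by
      rw [← Real.rpow_neg_one, ← Real.rpow_add hR]
      congr 1
      ring
    calc _ ≤ 8 * Real.pi * (1 + ‖x‖)⁻¹ * A * (2 / (3 - m) * (3 * (1 + ‖x‖) ^ (3 - m))) := by
          gcongr
      _ = A * (48 * Real.pi / (3 - m)) * ((1 + ‖x‖)⁻¹ * (1 + ‖x‖) ^ (3 - m)) := by ring
      _ ≤ _ := by
          rw [h3]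
          gcongr
          linarith
  · refine (mul_le_mul' le_rfl (lintegral_outer_le_length (by linarith))).trans ?_
    rw [← ENNReal.ofReal_mul (by positivity)]
    refine ENNReal.ofReal_le_ofReal ?_
    set u := -σ * x 0 - ρ
    have e1 : (1 + |u|) ^ (-(m - 2)) ≤ 2 * (1 + ‖x‖) ^ (-(m - 2)) := by
      calc _ ≤ ((1 + ‖x‖) / 2) ^ (-(m - 2)) :=
            Real.rpow_le_rpow_of_nonpos (by positivity) h (by linarith)
        _ = 2 ^ (m - 2) * (1 + ‖x‖) ^ (-(m - 2)) := by
            rw [div_eq_mul_inv, Real.mul_rpow hR.le (by norm_num), mul_comm,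
              Real.inv_rpow (by norm_num), Real.rpow_neg (by norm_num), inv_inv]
        _ ≤ 2 ^ (1 : ℝ) * (1 + ‖x‖) ^ (-(m - 2)) := by gcongr <;> linarith
        _ = _ := by rw [Real.rpow_one]
    calc _ = 4 * Real.pi * A * (1 + |u|) ^ (-(m - 2)) := by
          have : -σ * x 0 + ρ - u = 2 * ρ := by simp only [u]; ring
          rw [this]
          field_simp
          ring
      _ ≤ 4 * Real.pi * A * (2 * (1 + ‖x‖) ^ (-(m - 2))) := by gcongr
      _ = A * (8 * Real.pi) * (1 + ‖x‖) ^ (-(m - 2)) := by ring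
      _ ≤ _ := by
          gcongr
          linarith [show 0 ≤ 48 * Real.pi / (3 - m) by positivity]

/-- The majorant supported inside the light cone. -/
def timelikeMajorant (a s : ℝ) : ℝ≥0∞ :=
  if s ≤ a then ENNReal.ofReal ((1 + √(a ^ 2 + s ^ 2)) ^ (-3 : ℝ)) else 0

theorem measurable_timelikeMajorant : Measurable (Function.uncurry timelikeMajorant) := by
  refine Measurable.ite (measurableSet_le (by fun_prop) (by fun_prop)) ?_ measurable_const
  exact measurable_majorant 3

/-- The support condition s ≤ |v - s| forces s ≤ v/2, while the domain gives s > (v - u)/2. Only an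
interval of length u/2 remains, and the factor |u| is later offset by the v integral of (1 + |u| +
|v|)^(-2). -/
theorem lintegral_inner_timelike_le_of_nonneg {u v : ℝ} (hu : 0 ≤ u) (huv : u < v) :
    ∫⁻ s in {s | 0 < s ∧ v - u < 2 * s}, ENNReal.ofReal s * timelikeMajorant |v - s| s ≤
      ENNReal.ofReal (25 / 2 * |u|) * ENNReal.ofReal ((1 + |u| + |v|) ^ (-2 : ℝ)) := by
  have hset : MeasurableSet {s : ℝ | 0 < s ∧ v - u < 2 * s} :=
    (measurableSet_lt (f := fun _ : ℝ => (0 : ℝ)) (g := fun z => z) (by fun_prop)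
      (by fun_prop)).inter (measurableSet_lt (f := fun _ : ℝ => v - u)
      (g := fun s => 2 * s) (by fun_prop) (by fun_prop))
  calc _ ≤ ∫⁻ s in {s | 0 < s ∧ v - u < 2 * s}, (Ioc ((v - u) / 2) (v / 2)).indicator
        (fun _ => ENNReal.ofReal (25 * (1 + |u| + |v|) ^ (-2 : ℝ))) s := by
        refine setLIntegral_mono' hset fun s hs => ?_
        unfold timelikeMajorant
        split_ifs with h
        · have hs2 : s ≤ v / 2 := by
            rcases le_abs.1 h with h | h <;> linarith
          have hmem : s ∈ Ioc ((v - u) / 2) (v / 2) := ⟨by linarith [hs.2], hs2⟩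
          rw [indicator_of_mem hmem, ← ENNReal.ofReal_mul hs.1.le]
          refine ENNReal.ofReal_le_ofReal ?_
          have := mul_majorant_le (m := 3) (by norm_num) huv hs.1 hs.2
          rw [show (5 : ℝ) ^ ((3 : ℝ) - 1) = 25 by norm_num,
            show -((3 : ℝ) - 1) = -2 by norm_num] at this
          refine this.trans ?_
          gcongr ?_ * ?_
          refine Real.rpow_le_rpow_of_nonpos (by positivity) ?_ (by norm_num)
          linarith [hs.1]
        · simp
    _ ≤ ∫⁻ s, (Ioc ((v - u) / 2) (v / 2)).indicator
        (fun _ => ENNReal.ofReal (25 * (1 + |u| + |v|) ^ (-2 : ℝ))) s :=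
        setLIntegral_le_lintegral _ _
    _ = _ := by
        rw [lintegral_indicator measurableSet_Ioc, setLIntegral_const, Real.volume_Ioc,
          ← ENNReal.ofReal_mul (by positivity), ← ENNReal.ofReal_mul (by positivity),
          abs_of_nonneg hu]
        congr 1
        ring

/-- For v > 0 the support condition s ≤ v/2 contradicts 2s > v - u > v. Hence v ranges over (u, 0],
whose length |u| will match the factor (1 + |u|)⁻¹. -/
theorem lintegral_inner_timelike_le_of_neg {u v : ℝ} (hu : u < 0) (huv : u < v) :
    ∫⁻ s in {s | 0 < s ∧ v - u < 2 * s}, ENNReal.ofReal s * timelikeMajorant |v - s| s ≤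
      (Ioc u 0).indicator (fun _ => ENNReal.ofReal (25 * (1 + |u|)⁻¹)) v := by
  have hset : MeasurableSet {s : ℝ | 0 < s ∧ v - u < 2 * s} :=
    (measurableSet_lt (f := fun _ : ℝ => (0 : ℝ)) (g := fun z => z) (by fun_prop)
      (by fun_prop)).inter (measurableSet_lt (f := fun _ : ℝ => v - u)
      (g := fun s => 2 * s) (by fun_prop) (by fun_prop))
  by_cases hv : v ≤ 0
  · have hmem : v ∈ Ioc u 0 := ⟨huv, hv⟩
    rw [indicator_of_mem hmem]
    have h1 := lintegral_inner_le (m := 3) (by norm_num) huv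
    refine (setLIntegral_mono' hset fun s hs => ?_).trans (h1.trans ?_)
    · unfold timelikeMajorant
      split_ifs with h
      · exact le_rfl
      · simp
    · refine ENNReal.ofReal_le_ofReal ?_
      rw [← Real.rpow_neg_one]
      norm_num
      refine Real.rpow_le_rpow_of_nonpos (by positivity) ?_ (by norm_num)
      linarith [abs_nonneg v]
  · rw [indicator_of_notMem (fun h => hv h.2)]
    refine le_of_eq (setLIntegral_eq_zero hset fun s hs => ?_)
    have : ¬ s ≤ |v - s| := by
      intro h
      rcases le_abs.1 h with h | h <;> linarith [hs.1, hs.2]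
    simp [timelikeMajorant, this]

/-- The borderline exponent 3. The support inside the cone shortens one of the two integrations to a
length of order |u|, which removes the logarithm. -/
theorem lintegral_timelikeMajorant_le {σ : ℝ} (hσ : |σ| = 1) {x : Spacetime}
    (hx : spacePart x ≠ 0) :
    ∫⁻ y : Space, ENNReal.ofReal ‖y‖⁻¹ *
        timelikeMajorant |x 0 + σ * ‖y‖| ‖spacePart x + y‖ ≤
      ENNReal.ofReal (200 * Real.pi * (1 + ‖x‖)⁻¹) := by
  have hρ : 0 < ‖spacePart x‖ := norm_pos_iff.2 hx
  have hpi := Real.pi_pos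
  rcases far_or_interior hσ x with h | h
  · refine (lintegral_cone_le hσ hx measurable_timelikeMajorant).trans ?_
    set ρ := ‖spacePart x‖
    set u := -σ * x 0 - ρ
    have h1 : 2 * Real.pi / ρ ≤ 8 * Real.pi * (1 + ‖x‖)⁻¹ := by
      rw [div_le_iff₀ hρ, mul_assoc, mul_comm (1 + ‖x‖)⁻¹, ← div_eq_mul_inv,
        mul_div_assoc', le_div_iff₀ (by positivity)]
      nlinarith
    have hu1 : 0 < 1 + |u| := by positivity
    have h2 : ∫⁻ v in Ioo u (-σ * x 0 + ρ), ∫⁻ s in {s | 0 < s ∧ v - u < 2 * s},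
        ENNReal.ofReal s * timelikeMajorant |v - s| s ≤ ENNReal.ofReal 25 := by
      rcases le_or_gt 0 u with hu | hu
      · calc _ ≤ ∫⁻ v in Ioo u (-σ * x 0 + ρ), ENNReal.ofReal (25 / 2 * |u|) *
                ENNReal.ofReal ((1 + |u| + |v|) ^ (-2 : ℝ)) :=
              setLIntegral_mono' measurableSet_Ioo fun v hv =>
                lintegral_inner_timelike_le_of_nonneg hu hv.1
          _ ≤ ENNReal.ofReal (25 / 2 * |u|) *
                ENNReal.ofReal (2 / (2 - 1) * (1 + |u|) ^ (-(2 - 1) : ℝ)) := by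
              rw [lintegral_const_mul' _ _ ENNReal.ofReal_ne_top]
              exact mul_le_mul' le_rfl (lintegral_outer_le_of_one_lt (by norm_num) _)
          _ ≤ _ := by
              rw [← ENNReal.ofReal_mul (by positivity)]
              refine ENNReal.ofReal_le_ofReal ?_
              norm_num
              rw [Real.rpow_neg_one, ← div_eq_mul_inv, mul_div_assoc', div_le_iff₀ hu1]
              linarith
      · calc _ ≤ ∫⁻ v in Ioo u (-σ * x 0 + ρ),
                (Ioc u 0).indicator (fun _ => ENNReal.ofReal (25 * (1 + |u|)⁻¹)) v :=
              setLIntegral_mono' measurableSet_Ioo fun v hv =>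
                lintegral_inner_timelike_le_of_neg hu hv.1
          _ ≤ ∫⁻ v, (Ioc u 0).indicator (fun _ => ENNReal.ofReal (25 * (1 + |u|)⁻¹)) v :=
              setLIntegral_le_lintegral _ _
          _ ≤ _ := by
              rw [lintegral_indicator measurableSet_Ioc, setLIntegral_const, Real.volume_Ioc,
                ← ENNReal.ofReal_mul (by positivity)]
              refine ENNReal.ofReal_le_ofReal ?_
              rw [mul_assoc, inv_mul_eq_div, mul_div_assoc', div_le_iff₀ hu1]
              rw [abs_of_neg hu]
              linarith
    calc _ ≤ ENNReal.ofReal (8 * Real.pi * (1 + ‖x‖)⁻¹) * ENNReal.ofReal 25 := by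
          gcongr
      _ = _ := by
          rw [← ENNReal.ofReal_mul (by positivity)]
          congr 1
          ring
  · have hle : ∀ y : Space, ENNReal.ofReal ‖y‖⁻¹ *
        timelikeMajorant |x 0 + σ * ‖y‖| ‖spacePart x + y‖ ≤
        ENNReal.ofReal ‖y‖⁻¹ * ENNReal.ofReal ((1 + ‖x + nullVec σ y‖) ^ (-3 : ℝ)) := by
      intro y
      rw [norm_cone_point]
      refine mul_le_mul' le_rfl ?_
      unfold timelikeMajorant
      split_ifs
      · exact le_rfl
      · exact zero_le
    refine (lintegral_mono hle).trans ((lintegral_majorant_le hσ (by norm_num) hx).trans ?_)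
    refine (mul_le_mul' le_rfl (lintegral_outer_le_length (by norm_num))).trans ?_
    set ρ := ‖spacePart x‖
    set u := -σ * x 0 - ρ
    rw [← ENNReal.ofReal_mul (by positivity)]
    refine ENNReal.ofReal_le_ofReal ?_
    have : -σ * x 0 + ρ - u = 2 * ρ := by simp only [u]; ring
    rw [this]
    norm_num
    rw [Real.rpow_neg_one]
    have e1 : (1 + |u|)⁻¹ ≤ 2 * (1 + ‖x‖)⁻¹ := by
      rw [← inv_inv (2 : ℝ), ← mul_inv]
      gcongr
      linarith
    calc _ = 100 * Real.pi * (1 + |u|)⁻¹ := by field_simp; ring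
      _ ≤ 100 * Real.pi * (2 * (1 + ‖x‖)⁻¹) := by gcongr
      _ = _ := by ring

end

noncomputable section

open Filter Topology Set

open scoped ENNReal

variable {E : Type} [NormedAddCommGroup E] [NormedSpace ℝ E]

/-! ### Estimates of cone potentials -/

/-- The bound `|f| ≤ K w` for some constant `K`. -/
def BoundedBy {F : Type*} [NormedAddCommGroup F] (f : Spacetime → F) (w : Spacetime → ℝ) : Prop :=
  ∃ K : ℝ, ∀ x, ‖f x‖ ≤ K * w x

theorem BoundedBy.add {F : Type*} [NormedAddCommGroup F] {f g : Spacetime → F}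
    {w : Spacetime → ℝ} (hf : BoundedBy f w) (hg : BoundedBy g w) :
    BoundedBy (fun x => f x + g x) w := by
  obtain ⟨K, hK⟩ := hf
  obtain ⟨L, hL⟩ := hg
  exact ⟨K + L, fun x => (norm_add_le _ _).trans (by linarith [hK x, hL x])⟩

theorem BoundedBy.neg {F : Type*} [NormedAddCommGroup F] {f : Spacetime → F}
    {w : Spacetime → ℝ} (hf : BoundedBy f w) : BoundedBy (fun x => -f x) w := by
  obtain ⟨K, hK⟩ := hf
  exact ⟨K, fun x => by rw [norm_neg]; exact hK x⟩

theorem norm_conePotential_le {σ K B : ℝ} {f : Spacetime → E} {x : Spacetime} {w : Space → ℝ≥0∞}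
    (hK : 0 ≤ K) (hB : 0 ≤ B) (h : ∀ y, ‖f (x + nullVec σ y)‖ₑ ≤ ENNReal.ofReal K * w y)
    (hw : ∫⁻ y : Space, ENNReal.ofReal ‖y‖⁻¹ * w y ≤ ENNReal.ofReal B) :
    ‖conePotential σ f x‖ ≤ K * B := by
  have h1 : ‖conePotential σ f x‖ₑ ≤ ENNReal.ofReal (K * B) := by
    refine (enorm_integral_le_lintegral_enorm _).trans ?_
    calc _ ≤ ∫⁻ y : Space, ENNReal.ofReal K * (ENNReal.ofReal ‖y‖⁻¹ * w y) := by
          refine lintegral_mono fun y => ?_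
          rw [enorm_smul, ← ofReal_norm (‖y‖⁻¹), norm_inv, norm_norm]
          calc _ ≤ ENNReal.ofReal ‖y‖⁻¹ * (ENNReal.ofReal K * w y) := mul_le_mul' le_rfl (h y)
            _ = _ := by ring
      _ ≤ _ := by
          rw [lintegral_const_mul' _ _ ENNReal.ofReal_ne_top, ENNReal.ofReal_mul hK]
          exact mul_le_mul' le_rfl hw
  rwa [← ofReal_norm, ENNReal.ofReal_le_ofReal_iff (by positivity)] at h1

/-- Points off the time axis are dense. -/
theorem le_of_le_off_axis {f g : Spacetime → ℝ} (hf : Continuous f) (hg : Continuous g)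
    (h : ∀ x, spacePart x ≠ 0 → f x ≤ g x) (x : Spacetime) : f x ≤ g x := by
  by_cases hx : spacePart x = 0
  · set e : Spacetime := event 0 (EuclideanSpace.single 0 1)
    have ht : Tendsto (fun s : ℝ => x + s • e) (𝓝[>] 0) (𝓝 x) := by
      have : Tendsto (fun s : ℝ => x + s • e) (𝓝 0) (𝓝 (x + (0 : ℝ) • e)) :=
        Continuous.tendsto (by fun_prop) 0
      rw [zero_smul, add_zero] at this
      exact this.mono_left nhdsWithin_le_nhds
    refine le_of_tendsto_of_tendsto ((hf.tendsto x).comp ht) ((hg.tendsto x).comp ht) ?_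
    filter_upwards [self_mem_nhdsWithin] with s hs
    refine h _ ?_
    have hs' : (0 : ℝ) < s := hs
    rw [← spacePartL_apply, map_add, map_smul, spacePartL_apply, spacePartL_apply, hx,
      spacePart_event]
    simp [hs'.ne']
  · exact h x hx

omit [NormedSpace ℝ E] in
theorem enorm_le_ofReal_mul {f : Spacetime → E} {K m : ℝ} (hK0 : 0 ≤ K)
    (hK : ∀ p, ‖f p‖ ≤ K * (1 + ‖p‖) ^ (-m)) (p : Spacetime) :
    ‖f p‖ₑ ≤ ENNReal.ofReal K * ENNReal.ofReal ((1 + ‖p‖) ^ (-m)) := by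
  rw [← ofReal_norm, ← ENNReal.ofReal_mul hK0]
  exact ENNReal.ofReal_le_ofReal (hK p)

theorem continuous_one_add_norm_rpow (m : ℝ) :
    Continuous fun x : Spacetime => (1 + ‖x‖) ^ m :=
  Continuous.rpow_const (by fun_prop) fun x => Or.inl (by positivity)

theorem boundedBy_conePotential_of_three_lt {σ m : ℝ} (hσ : |σ| = 1) (hm : 3 < m)
    {f : Spacetime → E} (hf : Continuous f) (hd : Decays m f) :
    BoundedBy (conePotential σ f) fun x => (1 + ‖x‖)⁻¹ * coneDist x ^ (-(m - 3)) := by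
  obtain ⟨K, hK0, hK⟩ := hd.exists_nonneg
  set C := 5 ^ (m - 1) / (m - 2) * (16 * Real.pi / (m - 3) + 8 * Real.pi)
  have hC : 0 ≤ C := by
    have h1 : 0 < m - 2 := by linarith
    have h2 : 0 < m - 3 := by linarith
    positivity
  refine ⟨K * C, ?_⟩
  refine le_of_le_off_axis (continuous_conePotential (by linarith) hf hd).norm ?_ fun x hx => ?_
  · refine continuous_const.mul (Continuous.mul ?_ ?_)
    · exact Continuous.inv₀ (by fun_prop) fun x => by positivity
    · exact continuous_coneDist.rpow_const
        fun x => Or.inl (zero_lt_one.trans_le (one_le_coneDist x)).ne'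
  · have hc := one_le_coneDist x
    rw [mul_assoc]
    exact norm_conePotential_le hK0 (by positivity)
      (fun y => enorm_le_ofReal_mul hK0 hK _) (lintegral_majorant_le_of_three_lt hσ hm hx)

theorem boundedBy_conePotential_of_lt_three {σ m : ℝ} (hσ : |σ| = 1) (hm : 2 < m) (hm3 : m < 3)
    {f : Spacetime → E} (hf : Continuous f) (hd : Decays m f) :
    BoundedBy (conePotential σ f) fun x => (1 + ‖x‖) ^ (-(m - 2)) := by
  obtain ⟨K, hK0, hK⟩ := hd.exists_nonneg
  set C := 5 ^ (m - 1) / (m - 2) * (48 * Real.pi / (3 - m) + 8 * Real.pi)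
  have hC : 0 ≤ C := by
    have h1 : 0 < m - 2 := by linarith
    have h2 : 0 < 3 - m := by linarith
    positivity
  refine ⟨K * C, ?_⟩
  refine le_of_le_off_axis (continuous_conePotential (by linarith) hf hd).norm
    (continuous_const.mul (continuous_one_add_norm_rpow _)) fun x hx => ?_
  rw [mul_assoc]
  exact norm_conePotential_le hK0 (by positivity)
    (fun y => enorm_le_ofReal_mul hK0 hK _) (lintegral_majorant_le_of_lt_three hσ hm hm3 hx)

theorem minkSq_cone (σ : ℝ) (x : Spacetime) (y : Space) :
    minkSq (x + nullVec σ y) = |x 0 + σ * ‖y‖| ^ 2 - ‖spacePart x + y‖ ^ 2 := by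
  rw [← event_cone, minkSq_event, sq_abs]

/-- The weight of a current that decays like `|x|⁻³` inside the light cone and faster outside. -/
def currentWeight (ε : ℝ) (p : Spacetime) : ℝ :=
  (1 + ‖p‖) ^ (-3 : ℝ) * (heaviside (minkSq p) + (1 + ‖p‖) ^ (-ε))

theorem heaviside_nonneg (s : ℝ) : 0 ≤ heaviside s := by
  unfold heaviside; split_ifs <;> simp

theorem heaviside_le_one (s : ℝ) : heaviside s ≤ 1 := by
  unfold heaviside; split_ifs <;> simp

theorem currentWeight_nonneg (ε : ℝ) (p : Spacetime) : 0 ≤ currentWeight ε p := by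
  have := heaviside_nonneg (minkSq p)
  unfold currentWeight; positivity

theorem currentWeight_le {ε : ℝ} (hε : 0 < ε) (p : Spacetime) :
    currentWeight ε p ≤ 2 * (1 + ‖p‖) ^ (-3 : ℝ) := by
  have h1 := heaviside_le_one (minkSq p)
  have h2 : (1 + ‖p‖) ^ (-ε) ≤ 1 :=
    Real.rpow_le_one_of_one_le_of_nonpos (by linarith [norm_nonneg p]) (by linarith)
  unfold currentWeight
  calc _ ≤ (1 + ‖p‖) ^ (-3 : ℝ) * 2 := by gcongr; linarith
    _ = _ := by ring

theorem weight_le_currentWeight (ε : ℝ) (p : Spacetime) :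
    (1 + ‖p‖) ^ (-(3 + ε)) ≤ currentWeight ε p := by
  rw [neg_add, Real.rpow_add (by positivity), currentWeight]
  have := heaviside_nonneg (minkSq p)
  gcongr
  linarith

omit [NormedSpace ℝ E] in
theorem BoundedBy.decays_three {ε : ℝ} (hε : 0 < ε) {f : Spacetime → E}
    (h : BoundedBy f (currentWeight ε)) : Decays 3 f := by
  obtain ⟨K, hK⟩ := h
  refine ⟨|K| * 2, fun p => (hK p).trans ?_⟩
  calc _ ≤ |K| * currentWeight ε p := by
        gcongr
        · exact currentWeight_nonneg ε p
        · exact le_abs_self K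
    _ ≤ |K| * (2 * (1 + ‖p‖) ^ (-3 : ℝ)) := by gcongr; exact currentWeight_le hε p
    _ = _ := by ring

/-- The weight splits into a timelike part of exponent 3 and a remainder of exponent 3 + ε; each is
O((1 + |x|)⁻¹). -/
theorem boundedBy_conePotential_of_currentWeight {σ ε : ℝ} (hσ : |σ| = 1) (hε : 0 < ε)
    {f : Spacetime → E} (hf : Continuous f) (hd : BoundedBy f (currentWeight ε)) :
    BoundedBy (conePotential σ f) fun x => (1 + ‖x‖)⁻¹ := by
  have hdec := hd.decays_three hε
  obtain ⟨K, hK⟩ := hd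
  have hK' : ∀ p, ‖f p‖ ≤ |K| * currentWeight ε p := fun p => (hK p).trans (by
    gcongr
    · exact currentWeight_nonneg ε p
    · exact le_abs_self K)
  set C := 5 ^ (3 + ε - 1) / (3 + ε - 2) * (16 * Real.pi / (3 + ε - 3) + 8 * Real.pi) with hCdef
  have hC : 0 ≤ C := by
    have h1 : 0 < 3 + ε - 2 := by linarith
    have h2 : 0 < 3 + ε - 3 := by linarith
    have := Real.pi_pos
    positivity
  refine ⟨|K| * (200 * Real.pi + C), ?_⟩
  refine le_of_le_off_axis (continuous_conePotential (m := 3) (by norm_num) hf hdec).norm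
    (continuous_const.mul (Continuous.inv₀ (by fun_prop) fun x => by positivity)) fun x hx => ?_
  rw [mul_assoc]
  refine norm_conePotential_le (w := fun y => timelikeMajorant |x 0 + σ * ‖y‖| ‖spacePart x + y‖ +
    ENNReal.ofReal ((1 + ‖x + nullVec σ y‖) ^ (-(3 + ε)))) (abs_nonneg K)
    (by have := Real.pi_pos; positivity) (fun y => ?_) ?_
  · rw [← ofReal_norm]
    refine (ENNReal.ofReal_le_ofReal (hK' _)).trans ?_
    rw [ENNReal.ofReal_mul (abs_nonneg K)]
    refine mul_le_mul' le_rfl ?_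
    rw [currentWeight, mul_add, ENNReal.ofReal_add (by
      have := heaviside_nonneg (minkSq (x + nullVec σ y)); positivity) (by positivity)]
    refine add_le_add ?_ (le_of_eq ?_)
    · rw [minkSq_cone, heaviside, timelikeMajorant, ← norm_cone_point]
      by_cases h : ‖spacePart x + y‖ ≤ |x 0 + σ * ‖y‖|
      · rw [if_pos h, if_pos]
        · simp
        · have := pow_le_pow_left₀ (norm_nonneg _) h 2
          linarith
      · rw [if_neg h, if_neg]
        · simp
        · have := pow_lt_pow_left₀ (not_le.1 h) (abs_nonneg _) two_ne_zero
          linarith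
    · rw [neg_add, Real.rpow_add (by positivity)]
  · have hm1 : Measurable fun y : Space =>
        ENNReal.ofReal ‖y‖⁻¹ * timelikeMajorant |x 0 + σ * ‖y‖| ‖spacePart x + y‖ :=
      Measurable.mul (by fun_prop) (measurable_timelikeMajorant.comp
        ((by fun_prop : Measurable fun y : Space => |x 0 + σ * ‖y‖|).prodMk
          (by fun_prop : Measurable fun y : Space => ‖spacePart x + y‖)))
    simp only [mul_add]
    rw [lintegral_add_left hm1]
    have := Real.pi_pos
    refine (add_le_add (lintegral_timelikeMajorant_le hσ hx)
      (lintegral_majorant_le_of_three_lt hσ (m := 3 + ε) (by linarith) hx)).trans ?_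
    rw [← ENNReal.ofReal_add (by positivity)
      (by have := one_le_coneDist x; rw [← hCdef]; positivity)]
    refine ENNReal.ofReal_le_ofReal ?_
    rw [← hCdef, add_mul]
    gcongr
    refine mul_le_of_le_one_right (by positivity) ?_
    exact Real.rpow_le_one_of_one_le_of_nonpos (one_le_coneDist x) (by linarith)

end

noncomputable section

open Filter Topology Set

/-! ### Potentials of scattering currents -/

/-- The function `x · V(x)` for a vector field `V`. -/
def radialComponent (V : Spacetime → Spacetime) (x : Spacetime) : ℝ := mink x (V x)

/-- The function `x · ∇ (x · V(x))`. -/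
def radialDerivative (V : Spacetime → Spacetime) (x : Spacetime) : ℝ :=
  fderiv ℝ (radialComponent V) x x

theorem contDiff_radialComponent {n : WithTop ℕ∞} {V : Spacetime → Spacetime}
    (hV : ContDiff ℝ n V) : ContDiff ℝ n (radialComponent V) :=
  (mink.contDiff).clm_apply hV

theorem hasFDerivAt_radialComponent {V : Spacetime → Spacetime} {V' : Spacetime →L[ℝ] Spacetime}
    {x : Spacetime} (hV : HasFDerivAt V V' x) :
    HasFDerivAt (radialComponent V) ((mink x).comp V' + mink.flip (V x)) x :=
  (mink.hasFDerivAt (x := x)).clm_apply hV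

theorem fderiv_radialComponent_apply {V : Spacetime → Spacetime} {x : Spacetime}
    (hV : DifferentiableAt ℝ V x) (b : Spacetime) :
    fderiv ℝ (radialComponent V) x b = mink x (fderiv ℝ V x b) + mink b (V x) := by
  rw [(hasFDerivAt_radialComponent hV.hasFDerivAt).fderiv]
  rfl

theorem norm_iteratedFDeriv_id_le (n : ℕ) (x : Spacetime) :
    ‖iteratedFDeriv ℝ (n + 1) (fun y : Spacetime => y) x‖ ≤ if n = 0 then 1 else 0 := by
  have hid : fderiv ℝ (fun y : Spacetime => y) = fun _ => ContinuousLinearMap.id ℝ Spacetime := by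
    ext1 y; exact fderiv_fun_id
  rw [← norm_iteratedFDeriv_fderiv, hid]
  split_ifs with h
  · subst h
    rw [norm_iteratedFDeriv_zero]
    exact ContinuousLinearMap.norm_id_le
  · rw [iteratedFDeriv_const_of_ne h]
    simp

/-- Leibniz rule for the Minkowski form of x and V(x): the identity has first derivative of norm at
most 1 and no higher ones, so only two terms survive. -/
theorem norm_iteratedFDeriv_radialComponent_le {V : Spacetime → Spacetime} {n : ℕ} (hn : n ≤ 1)
    (hV : ContDiff ℝ (n + 1) V) (x : Spacetime) :
    ‖iteratedFDeriv ℝ (n + 1) (radialComponent V) x‖ ≤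
      ‖x‖ * ‖iteratedFDeriv ℝ (n + 1) V x‖ + (n + 1) * ‖iteratedFDeriv ℝ n V x‖ := by
  have h := mink.norm_iteratedFDeriv_le_of_bilinear (f := fun y : Spacetime => y)
    (N := (n + 1 : ℕ)) contDiff_id (by exact_mod_cast hV) x (n := n + 1) le_rfl
  refine h.trans ((mul_le_of_le_one_left (by positivity) norm_mink_le).trans ?_)
  have h1 := norm_iteratedFDeriv_id_le 0 x
  have h2 := norm_iteratedFDeriv_id_le 1 x
  simp only [if_true, one_ne_zero, if_false] at h1 h2
  interval_cases n
  · simp only [Finset.sum_range_succ, Finset.sum_range_zero, Nat.reduceAdd, Nat.reduceSub,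
      norm_iteratedFDeriv_zero] at h1 ⊢
    norm_num at h1 ⊢
  · simp only [Finset.sum_range_succ, Finset.sum_range_zero, Nat.reduceAdd, Nat.reduceSub,
      norm_iteratedFDeriv_zero] at h1 h2 ⊢
    have h3 := norm_nonneg (iteratedFDeriv ℝ 1 V x)
    have h4 := norm_nonneg (V x)
    have h5 : ‖iteratedFDeriv ℝ 2 (fun y : Spacetime => y) x‖ = 0 :=
      le_antisymm h2 (norm_nonneg _)
    norm_num [h5] at h1 h3 ⊢

theorem norm_mul_weight_le (m : ℝ) (p : Spacetime) :
    ‖p‖ * (1 + ‖p‖) ^ (-(m + 1)) ≤ (1 + ‖p‖) ^ (-m) := by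
  have : (1 + ‖p‖) ^ (-m) = (1 + ‖p‖) * (1 + ‖p‖) ^ (-(m + 1)) := by
    nth_rewrite 2 [← Real.rpow_one (1 + ‖p‖)]
    rw [← Real.rpow_add (by positivity)]
    congr 1
    ring
  rw [this]
  gcongr
  linarith

theorem decays_iteratedFDeriv_radialComponent {V : Spacetime → Spacetime} {m : ℝ} {n : ℕ}
    (hn : n ≤ 1) (hV : ContDiff ℝ (n + 1) V) (h1 : Decays (m + 1) (iteratedFDeriv ℝ (n + 1) V))
    (h0 : Decays m (iteratedFDeriv ℝ n V)) :
    Decays m (iteratedFDeriv ℝ (n + 1) (radialComponent V)) := by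
  obtain ⟨K, hK0, hK⟩ := h1.exists_nonneg
  obtain ⟨L, hL0, hL⟩ := h0.exists_nonneg
  refine ⟨K + (n + 1) * L, fun p => (norm_iteratedFDeriv_radialComponent_le hn hV p).trans ?_⟩
  rw [add_mul K]
  refine add_le_add ?_ ?_
  · calc _ ≤ ‖p‖ * (K * (1 + ‖p‖) ^ (-(m + 1))) := by gcongr; exact hK p
      _ = K * (‖p‖ * (1 + ‖p‖) ^ (-(m + 1))) := by ring
      _ ≤ _ := by gcongr; exact norm_mul_weight_le m p
  · rw [mul_assoc]
    gcongr
    exact hL p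

theorem decays_radialComponent {V : Spacetime → Spacetime} {m : ℝ} (h : Decays (m + 1) V) :
    Decays m (radialComponent V) := by
  obtain ⟨K, hK0, hK⟩ := h.exists_nonneg
  refine ⟨K, fun p => (abs_mink_le p (V p)).trans ?_⟩
  calc _ ≤ ‖p‖ * (K * (1 + ‖p‖) ^ (-(m + 1))) := by gcongr; exact hK p
    _ = K * (‖p‖ * (1 + ‖p‖) ^ (-(m + 1))) := by ring
    _ ≤ _ := by gcongr; exact norm_mul_weight_le m p

/-! ### Decay of admissible currents and the gradient of x · A. -/

section Current

variable {ε : ℝ} {J : Spacetime → Spacetime}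

theorem IsScatteringCurrent.bound (hJ : IsScatteringCurrent ε J) :
    ∃ K, 0 ≤ K ∧ ∀ n : ℕ, n ≤ 3 → ∀ p, ‖iteratedFDeriv ℝ n J p‖ ≤
      K * ((1 + ‖p‖) ^ (-(n : ℝ)) * currentWeight ε p) := by
  obtain ⟨K, hK⟩ := hJ.decay
  refine ⟨|K|, abs_nonneg K, fun n hn p => (hK n hn p).trans ?_⟩
  have h1 : (0 : ℝ) < 1 + ‖p‖ := by positivity
  have h2 := heaviside_nonneg (minkSq p)
  rw [add_comm ‖p‖ 1, currentWeight, ← mul_assoc ((1 + ‖p‖) ^ (-(n : ℝ))),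
    ← Real.rpow_add h1, show -(n : ℝ) + -3 = -((3 + n : ℕ) : ℝ) by push_cast; ring,
    Real.rpow_neg h1.le, Real.rpow_natCast, Real.rpow_neg h1.le ε, ← mul_assoc, one_div,
    ← div_eq_mul_inv]
  gcongr
  exact le_abs_self K

theorem IsScatteringCurrent.decays (hε : 0 < ε) (hJ : IsScatteringCurrent ε J) {n : ℕ}
    (hn : n ≤ 3) : Decays (3 + n) (iteratedFDeriv ℝ n J) := by
  obtain ⟨K, hK0, hK⟩ := hJ.bound
  refine ⟨K * 2, fun p => (hK n hn p).trans ?_⟩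
  have h := currentWeight_le hε p
  calc _ ≤ K * ((1 + ‖p‖) ^ (-(n : ℝ)) * (2 * (1 + ‖p‖) ^ (-3 : ℝ))) := by gcongr
    _ = K * 2 * ((1 + ‖p‖) ^ (-(n : ℝ)) * (1 + ‖p‖) ^ (-3 : ℝ)) := by ring
    _ = _ := by
      rw [← Real.rpow_add (by positivity)]
      congr 2
      ring

theorem IsScatteringCurrent.boundedBy (hJ : IsScatteringCurrent ε J) :
    BoundedBy J (currentWeight ε) := by
  obtain ⟨K, hK0, hK⟩ := hJ.bound
  exact ⟨K, fun p => by simpa using hK 0 (by norm_num) p⟩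

theorem IsScatteringCurrent.decays_zero (hε : 0 < ε) (hJ : IsScatteringCurrent ε J) :
    Decays 3 J := hJ.boundedBy.decays_three hε

theorem IsScatteringCurrent.decays_fderiv (hε : 0 < ε) (hJ : IsScatteringCurrent ε J) :
    Decays 4 (fderiv ℝ J) := by
  have h := hJ.decays hε (n := 1) (by norm_num)
  norm_num at h
  obtain ⟨K, hK⟩ := h
  exact ⟨K, fun p => by rw [← norm_iteratedFDeriv_one]; exact hK p⟩

theorem IsScatteringCurrent.contDiff_eulerThree (hJ : IsScatteringCurrent ε J) :
    ContDiff ℝ 2 (eulerThree J) := by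
  have h1 : ContDiff ℝ 2 (fderiv ℝ J) := hJ.contDiff.fderiv_right (by norm_num)
  exact (h1.clm_apply contDiff_id).add
    ((hJ.contDiff.of_le (by norm_num)).const_smul (3 : ℝ))

theorem IsScatteringCurrent.decays_eulerThree (hJ : IsScatteringCurrent ε J) {n : ℕ}
    (hn : n ≤ 2) : Decays (3 + n + ε) (iteratedFDeriv ℝ n (eulerThree J)) := by
  obtain ⟨K, hK⟩ := hJ.decay_euler
  refine ⟨K, fun p => (hK n hn p).trans (le_of_eq ?_)⟩
  rw [Real.rpow_neg (by positivity), add_comm ‖p‖ 1, div_eq_mul_inv]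

theorem IsScatteringCurrent.divergence_eq_zero (hJ : IsScatteringCurrent ε J) (x : Spacetime) :
    ∑ a, fderiv ℝ J x (EuclideanSpace.single a 1) a = 0 := by
  rw [← hJ.conserved x]
  refine Finset.sum_congr rfl fun a _ => ?_
  have h1 : HasFDerivAt (fun y => J y a)
      ((EuclideanSpace.proj a : Spacetime →L[ℝ] ℝ).comp (fderiv ℝ J x)) x :=
    (EuclideanSpace.proj a : Spacetime →L[ℝ] ℝ).hasFDerivAt.comp x
      (hJ.contDiff.differentiable (by norm_num) x).hasFDerivAt
  rw [nabla, h1.fderiv]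
  rfl

/-- On the light cone of a fixed event a scattering current decays faster than `|y|⁻³`. -/
theorem IsScatteringCurrent.cone_bound {σ : ℝ} (hσ : |σ| = 1) (hε : 0 < ε) (hε1 : ε ≤ 1)
    (hJ : IsScatteringCurrent ε J) (x : Spacetime) :
    ∃ C, 0 ≤ C ∧ ∀ y, ‖J (x + nullVec σ y)‖ ≤ C * (1 + ‖y‖) ^ (-(3 + ε)) := by
  obtain ⟨K, hK0, hK⟩ := hJ.bound
  obtain ⟨L, hL0, hL⟩ := (hJ.decays_fderiv hε).exists_nonneg
  set d := ‖x‖ + 1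
  have hd : 0 < d := by positivity
  refine ⟨K + L * (1 + d) ^ (4 : ℝ) * d, by positivity, fun y => ?_⟩
  -- A unit step outwards makes the null vector k(y) spacelike. At that point the Heaviside term is
  -- absent and J has decay 3 + ε. The mean value inequality over a distance at most |x| + 1, with
  -- ∇J of decay 4 ≥ 3 + ε, carries the bound to x + k(y).
  obtain ⟨e, he1, he2⟩ : ∃ e : Space, ‖e‖ = 1 ∧ ‖y + e‖ = ‖y‖ + 1 := by
    by_cases hy : y = 0
    · exact ⟨EuclideanSpace.single 0 1, by simp, by simp [hy]⟩
    · refine ⟨radial y, norm_radial hy, ?_⟩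
      have : y + radial y = (1 + ‖y‖⁻¹) • y := by rw [radial, add_smul, one_smul]
      rw [this, norm_smul, Real.norm_eq_abs, abs_of_pos (by positivity), add_mul, one_mul,
        inv_mul_cancel₀ (norm_ne_zero_iff.2 hy)]
  set k := event (σ * ‖y‖) (y + e) with hk
  have hky : ‖y‖ ≤ ‖k‖ := by
    have := norm_le_norm_event (σ * ‖y‖) (y + e)
    rw [he2] at this
    linarith
  have hkJ : ‖J k‖ ≤ K * (1 + ‖y‖) ^ (-(3 + ε)) := by
    have h1 := hK 0 (by norm_num) k
    have h2 : minkSq k < 0 := by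
      rw [hk, minkSq_event, he2, mul_pow, ← sq_abs σ, hσ]
      nlinarith [norm_nonneg y]
    have h3 : heaviside (minkSq k) = 0 := by rw [heaviside, if_neg (not_le.2 h2)]
    simp only [norm_iteratedFDeriv_zero, currentWeight, h3, zero_add, Nat.cast_zero, neg_zero,
      Real.rpow_zero, one_mul] at h1
    refine h1.trans ?_
    rw [← Real.rpow_add (by positivity), show (-3 : ℝ) + -ε = -(3 + ε) by ring]
    gcongr ?_ * ?_
    exact Real.rpow_le_rpow_of_nonpos (by positivity) (by linarith) (by linarith)
  have hdist : ‖x + nullVec σ y - k‖ ≤ d := by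
    have : x + nullVec σ y - k = x - event 0 e := by
      have : k = nullVec σ y + event 0 e := by rw [hk, nullVec, ← event_add, add_zero]
      rw [this]
      abel
    rw [this]
    refine (norm_sub_le _ _).trans ?_
    have h2 := norm_event_le 0 e
    rw [abs_zero, zero_add, he1] at h2
    linarith
  have hball : ∀ z ∈ Metric.closedBall k d, ‖fderiv ℝ J z‖ ≤
      L * ((1 + d) ^ (4 : ℝ) * (1 + ‖y‖) ^ (-4 : ℝ)) := by
    intro z hz
    refine (hL z).trans ?_
    gcongr
    rw [mem_closedBall_iff_norm] at hz
    have h1 : ‖k‖ ≤ ‖z‖ + d := by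
      have := norm_sub_le z (z - k)
      rw [sub_sub_cancel] at this
      linarith
    have h2 : 1 + ‖y‖ ≤ (1 + ‖z‖) * (1 + d) := by nlinarith [norm_nonneg z]
    have h3 : ((1 + ‖z‖) * (1 + d)) ^ (-4 : ℝ) ≤ (1 + ‖y‖) ^ (-4 : ℝ) :=
      Real.rpow_le_rpow_of_nonpos (by positivity) h2 (by norm_num)
    rw [Real.mul_rpow (by positivity) (by positivity), Real.rpow_neg (x := 1 + d) (by positivity),
      mul_inv_le_iff₀ (by positivity)] at h3
    linarith
  have hmv := (convex_closedBall k d).norm_image_sub_le_of_norm_fderiv_le (𝕜 := ℝ)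
    (fun z _ => hJ.contDiff.differentiable (by norm_num) z) hball
    (Metric.mem_closedBall_self hd.le) (y := x + nullVec σ y)
    (by rw [mem_closedBall_iff_norm]; exact hdist)
  have h4 : (1 + ‖y‖) ^ (-4 : ℝ) ≤ (1 + ‖y‖) ^ (-(3 + ε)) :=
    weight_anti (norm_nonneg y) (by linarith)
  have h5 := norm_le_norm_add_norm_sub' (J (x + nullVec σ y)) (J k)
  calc ‖J (x + nullVec σ y)‖ ≤ ‖J k‖ + ‖J (x + nullVec σ y) - J k‖ := h5
    _ ≤ K * (1 + ‖y‖) ^ (-(3 + ε)) +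
        L * ((1 + d) ^ (4 : ℝ) * (1 + ‖y‖) ^ (-(3 + ε))) * d := by
      refine add_le_add hkJ (hmv.trans ?_)
      gcongr
    _ = _ := by ring

/-- The derivative of `x · A` for the potential `A` of a conserved current. -/
theorem IsScatteringCurrent.hasFDerivAt_radialComponent {σ : ℝ} (hσ : |σ| = 1) (hε : 0 < ε)
    (hJ : IsScatteringCurrent ε J) (x : Spacetime) :
    HasFDerivAt (radialComponent (conePotential σ J))
      (conePotential σ (fderiv ℝ (radialComponent J)) x) x := by
  have hJ1 : ContDiff ℝ 1 J := hJ.contDiff.of_le (by norm_num)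
  have hd := hJ.decays_zero hε
  have hd' := hJ.decays_fderiv hε
  have hc : Continuous (fderiv ℝ J) := hJ1.continuous_fderiv one_ne_zero
  have hV := hasFDerivAt_conePotential (σ := σ) (m := 3) (by norm_num) hJ1 hd
    (hd'.mono (by norm_num)) x
  refine (_root_.hasFDerivAt_radialComponent hV).congr_fderiv ?_
  have hfc : Continuous (fderiv ℝ (radialComponent J)) :=
    (contDiff_radialComponent hJ1).continuous_fderiv one_ne_zero
  have hfd : Decays 3 (fderiv ℝ (radialComponent J)) := by
    have h1 : Decays (3 + 1) (iteratedFDeriv ℝ (0 + 1) J) := by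
      norm_num
      simpa [Decays, norm_iteratedFDeriv_one] using hd'
    have := decays_iteratedFDeriv_radialComponent (n := 0) (m := 3) (by norm_num)
      (by simpa using hJ1) h1 (by simpa [Decays] using hd)
    simpa [Decays, norm_iteratedFDeriv_one] using this
  ext b
  rw [conePotential_apply (by norm_num) hfc hfd]
  have i1 := (mink b).integrable_comp (integrable_cone (σ := σ) (m := 3) (by norm_num)
    hJ1.continuous hd x)
  have i2 := (mink x).integrable_comp ((integrable_cone (σ := σ) (m := 4) (by norm_num)
    hc hd' x).apply_continuousLinearMap b)
  have e1 : mink b (conePotential σ J x) =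
      ∫ y : Space, mink b (‖y‖⁻¹ • J (x + nullVec σ y)) :=
    ((mink b).integral_comp_comm (integrable_cone (σ := σ) (m := 3) (by norm_num)
      hJ1.continuous hd x)).symm
  have e2 : mink x (conePotential σ (fderiv ℝ J) x b) =
      ∫ y : Space, mink x ((‖y‖⁻¹ • fderiv ℝ J (x + nullVec σ y)) b) := by
    rw [conePotential, ContinuousLinearMap.integral_apply (integrable_cone (by norm_num) hc hd' x)]
    exact ((mink x).integral_comp_comm ((integrable_cone (σ := σ) (m := 4) (by norm_num)
      hc hd' x).apply_continuousLinearMap b)).symm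
  have hflux := integral_flux_eq_zero hσ hJ1 hJ.divergence_eq_zero hd hd' x b
  have i3 := (integrable_cone (σ := σ) (m := 3) (by norm_num) hfc hfd
    x).apply_continuousLinearMap b
  -- With p = x + k, the product rule gives ∂_b(p·J) - x·∂_bJ - b·J = k·∂_bJ. The defect of the
  -- claimed formula is therefore the vanishing flux.
  have hsplit : ∀ y : Space, ‖y‖⁻¹ • mink (nullVec σ y) (fderiv ℝ J (x + nullVec σ y) b) =
      (‖y‖⁻¹ • fderiv ℝ (radialComponent J) (x + nullVec σ y)) b -
      (mink x ((‖y‖⁻¹ • fderiv ℝ J (x + nullVec σ y)) b) +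
        mink b (‖y‖⁻¹ • J (x + nullVec σ y))) := by
    intro y
    rw [smul_apply, fderiv_radialComponent_apply (hJ1.differentiable one_ne_zero _)]
    simp only [smul_apply, map_smul, map_add, add_apply, smul_eq_mul]
    ring
  simp only [hsplit] at hflux
  have hsub := integral_sub i3 (i2.add i1)
  have hadd := integral_add i2 i1
  simp only [Pi.add_apply] at hsub
  rw [hsub, hadd, sub_eq_zero] at hflux
  simp only [add_apply, ContinuousLinearMap.comp_apply,
    ContinuousLinearMap.flip_apply, e1, e2]
  exact hflux.symm

end Current

end

noncomputable section

open Filter Topology Set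

/-! ### Bounds of potentials on spacetime -/

/-- Decay of a potential `V`, of `x · V` and of the radial derivative of `x · V`, together with
their derivatives. -/
structure PotentialBounds (ε : ℝ) (V : Spacetime → Spacetime) : Prop where
  contDiff : ContDiff ℝ 3 V
  self : BoundedBy V fun x => (1 + ‖x‖)⁻¹
  deriv : BoundedBy (fderiv ℝ V) fun x => (1 + ‖x‖)⁻¹ * (coneDist x)⁻¹
  deriv_self : BoundedBy (fun x => fderiv ℝ V x x) fun x => (1 + ‖x‖)⁻¹
  radial_deriv : BoundedBy (fderiv ℝ (radialComponent V)) fun x => (1 + ‖x‖)⁻¹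
  radial_deriv_two : BoundedBy (fderiv ℝ (fderiv ℝ (radialComponent V)))
    fun x => (1 + ‖x‖)⁻¹ * (coneDist x)⁻¹
  radialDeriv : BoundedBy (radialDerivative V) fun x => (1 + ‖x‖) ^ (-ε)
  radialDeriv_deriv : BoundedBy (fderiv ℝ (radialDerivative V))
    fun x => (1 + ‖x‖)⁻¹ * coneDist x ^ (-ε)
  radialDeriv_deriv_self : BoundedBy (fun x => fderiv ℝ (radialDerivative V) x x)
    fun x => (1 + ‖x‖) ^ (-ε)

theorem contDiff_radialDerivative {V : Spacetime → Spacetime} (hV : ContDiff ℝ 3 V) :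
    ContDiff ℝ 2 (radialDerivative V) :=
  ((contDiff_radialComponent hV).fderiv_right (m := 2) (by norm_num)).clm_apply contDiff_id

/-! ### Stability of the bounds under sums and signs. -/

section Algebra

variable {ε : ℝ} {V W : Spacetime → Spacetime}

theorem radialComponent_add : radialComponent (fun x => V x + W x) =
    fun x => radialComponent V x + radialComponent W x := by
  ext x; simp [radialComponent]

theorem radialComponent_neg : radialComponent (fun x => -V x) =
    fun x => -radialComponent V x := by
  ext x; simp [radialComponent]

theorem PotentialBounds.add (hV : PotentialBounds ε V) (hW : PotentialBounds ε W) :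
    PotentialBounds ε fun x => V x + W x := by
  have cV := contDiff_radialComponent hV.contDiff
  have cW := contDiff_radialComponent hW.contDiff
  have dV := hV.contDiff.differentiable (by norm_num)
  have dW := hW.contDiff.differentiable (by norm_num)
  have e1 : fderiv ℝ (fun x => V x + W x) = fun x => fderiv ℝ V x + fderiv ℝ W x :=
    funext fun x => fderiv_fun_add (dV x) (dW x)
  have e2 : fderiv ℝ (radialComponent fun x => V x + W x) =
      fun x => fderiv ℝ (radialComponent V) x + fderiv ℝ (radialComponent W) x := by
    rw [radialComponent_add]
    exact funext fun x => fderiv_fun_add (cV.differentiable (by norm_num) x)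
      (cW.differentiable (by norm_num) x)
  have e3 : fderiv ℝ (fderiv ℝ (radialComponent fun x => V x + W x)) =
      fun x => fderiv ℝ (fderiv ℝ (radialComponent V)) x +
        fderiv ℝ (fderiv ℝ (radialComponent W)) x := by
    rw [e2]
    exact funext fun x => fderiv_fun_add
      ((cV.fderiv_right (m := 2) (by norm_num)).differentiable (by norm_num) x)
      ((cW.fderiv_right (m := 2) (by norm_num)).differentiable (by norm_num) x)
  have e4 : radialDerivative (fun x => V x + W x) =
      fun x => radialDerivative V x + radialDerivative W x := by
    ext x; rw [radialDerivative, e2]; rfl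
  have e5 : fderiv ℝ (radialDerivative fun x => V x + W x) =
      fun x => fderiv ℝ (radialDerivative V) x + fderiv ℝ (radialDerivative W) x := by
    rw [e4]
    exact funext fun x => fderiv_fun_add
      ((contDiff_radialDerivative hV.contDiff).differentiable (by norm_num) x)
      ((contDiff_radialDerivative hW.contDiff).differentiable (by norm_num) x)
  refine ⟨hV.contDiff.add hW.contDiff, hV.self.add hW.self, ?_, ?_, ?_, ?_, ?_, ?_, ?_⟩
  · rw [e1]; exact hV.deriv.add hW.deriv
  · rw [e1]; exact hV.deriv_self.add hW.deriv_self
  · rw [e2]; exact hV.radial_deriv.add hW.radial_deriv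
  · rw [e3]; exact hV.radial_deriv_two.add hW.radial_deriv_two
  · rw [e4]; exact hV.radialDeriv.add hW.radialDeriv
  · rw [e5]; exact hV.radialDeriv_deriv.add hW.radialDeriv_deriv
  · rw [e5]; exact hV.radialDeriv_deriv_self.add hW.radialDeriv_deriv_self

theorem PotentialBounds.neg (hV : PotentialBounds ε V) :
    PotentialBounds ε fun x => -V x := by
  have e1 : fderiv ℝ (fun x => -V x) = fun x => -fderiv ℝ V x :=
    funext fun x => fderiv_fun_neg
  have e2 : fderiv ℝ (radialComponent fun x => -V x) =
      fun x => -fderiv ℝ (radialComponent V) x := by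
    rw [radialComponent_neg]
    exact funext fun x => fderiv_fun_neg
  have e3 : fderiv ℝ (fderiv ℝ (radialComponent fun x => -V x)) =
      fun x => -fderiv ℝ (fderiv ℝ (radialComponent V)) x := by
    rw [e2]
    exact funext fun x => fderiv_fun_neg
  have e4 : radialDerivative (fun x => -V x) = fun x => -radialDerivative V x := by
    ext x; rw [radialDerivative, e2]; rfl
  have e5 : fderiv ℝ (radialDerivative fun x => -V x) =
      fun x => -fderiv ℝ (radialDerivative V) x := by
    rw [e4]
    exact funext fun x => fderiv_fun_neg
  refine ⟨hV.contDiff.neg, hV.self.neg, ?_, ?_, ?_, ?_, ?_, ?_, ?_⟩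
  · rw [e1]; exact hV.deriv.neg
  · rw [e1]; exact hV.deriv_self.neg
  · rw [e2]; exact hV.radial_deriv.neg
  · rw [e3]; exact hV.radial_deriv_two.neg
  · rw [e4]; exact hV.radialDeriv.neg
  · rw [e5]; exact hV.radialDeriv_deriv.neg
  · rw [e5]; exact hV.radialDeriv_deriv_self.neg

end Algebra

/-! ### The bounds for the potential of one current. -/

section Current

variable {σ ε : ℝ} {J : Spacetime → Spacetime}

theorem decays_fderiv_iff {F : Type*} [NormedAddCommGroup F] [NormedSpace ℝ F] {m : ℝ}
    {f : Spacetime → F} : Decays m (iteratedFDeriv ℝ 1 f) ↔ Decays m (fderiv ℝ f) := by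
  simp only [Decays, norm_iteratedFDeriv_one]

theorem decays_fderiv_fderiv_iff {F : Type*} [NormedAddCommGroup F] [NormedSpace ℝ F] {m : ℝ}
    {f : Spacetime → F} :
    Decays m (iteratedFDeriv ℝ 2 f) ↔ Decays m (fderiv ℝ (fderiv ℝ f)) := by
  rw [← decays_fderiv_iff]
  simp only [Decays, norm_iteratedFDeriv_fderiv]

theorem decays_zero_iff {F : Type*} [NormedAddCommGroup F] [NormedSpace ℝ F] {m : ℝ}
    {f : Spacetime → F} : Decays m (iteratedFDeriv ℝ 0 f) ↔ Decays m f := by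
  simp only [Decays, norm_iteratedFDeriv_zero]

/-- `(x · ∇) A` for the potential `A` of a scattering current. -/
theorem IsScatteringCurrent.fderiv_self (hσ : |σ| = 1) (hε : 0 < ε)
    (hJ : IsScatteringCurrent ε J) (x : Spacetime) :
    conePotential σ (fderiv ℝ J) x x =
      conePotential σ (fun p => eulerThree J p - J p) x := by
  have hJ1 : ContDiff ℝ 1 J := hJ.contDiff.of_le (by norm_num)
  have hd := hJ.decays_zero hε
  have hd' := hJ.decays_fderiv hε
  have hc : Continuous (fderiv ℝ J) := hJ1.continuous_fderiv one_ne_zero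
  have hE : Decays 3 (eulerThree J) := by
    have := hJ.decays_eulerThree (n := 0) (by norm_num)
    rw [decays_zero_iff] at this
    exact this.mono (by norm_num; exact hε.le)
  have hEJ : Decays 3 fun p => eulerThree J p - J p := by
    obtain ⟨K, hK⟩ := hE
    obtain ⟨L, hL⟩ := hd
    exact ⟨K + L, fun p => (norm_sub_le _ _).trans (by linarith [hK p, hL p])⟩
  ext a
  set l : Spacetime →L[ℝ] ℝ := EuclideanSpace.proj a with hl
  have hla : ∀ v : Spacetime, v a = l v := fun v => rfl
  have hln : ∀ v, ‖l v‖ ≤ ‖v‖ := fun v => PiLp.norm_apply_le v a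
  set f : Spacetime → ℝ := fun p => l (J p) with hf
  have hfd : ∀ p, fderiv ℝ f p = l.comp (fderiv ℝ J p) := fun p =>
    (l.hasFDerivAt.comp p (hJ1.differentiable one_ne_zero p).hasFDerivAt).fderiv
  have hf1 : ContDiff ℝ 1 f := l.contDiff.comp hJ1
  have hl1 : ‖l‖ ≤ 1 := l.opNorm_le_bound zero_le_one fun v => by simpa using hln v
  have hdf : Decays 4 (fderiv ℝ f) := by
    obtain ⟨K, hK⟩ := hd'
    refine ⟨K, fun p => ?_⟩
    rw [hfd]
    refine (l.opNorm_comp_le _).trans ((mul_le_of_le_one_left (norm_nonneg _) hl1).trans (hK p))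
  -- The cone identity yields 2 where `eulerThree` has 3; the leftover -J is a current of the
  -- borderline kind.
  have hg : (fun p => fderiv ℝ f p p + 2 * f p) = fun p => l (eulerThree J p - J p) := by
    ext p
    rw [hfd]
    simp only [hf, eulerThree, ContinuousLinearMap.comp_apply, map_add, map_sub, map_smul,
      smul_eq_mul]
    ring
  have hself := conePotential_fderiv_self (m := 3) hσ (by norm_num) hf1
    (hdf.mono (by norm_num)) x (by
      obtain ⟨C, -, hC⟩ := exists_cone_bound (σ := σ) (by norm_num) hd x
      exact ⟨C, fun y => (hln _).trans (hC y)⟩) (by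
      rw [hg]
      obtain ⟨K, hK⟩ := hEJ
      exact ⟨K, fun p => (hln _).trans (hK p)⟩)
  rw [hg] at hself
  have hcE : Continuous (eulerThree J) := hJ.contDiff_eulerThree.continuous
  calc conePotential σ (fderiv ℝ J) x x a = conePotential σ (fderiv ℝ f) x x := by
        rw [conePotential_apply (m := 4) (by norm_num) hc hd', hla,
          conePotential_apply (m := 4) (by norm_num) (hf1.continuous_fderiv one_ne_zero) hdf,
          ← l.integral_comp_comm]
        · simp only [hfd, map_smul, ContinuousLinearMap.comp_apply]
        · exact (integrable_cone (σ := σ) (m := 4) (by norm_num) hc hd'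
            x).apply_continuousLinearMap x
    _ = conePotential σ (fun p => l (eulerThree J p - J p)) x := hself
    _ = conePotential σ (fun p => eulerThree J p - J p) x a := by
        rw [hla, conePotential, conePotential, ← l.integral_comp_comm]
        · simp only [map_smul]
        · exact integrable_cone (by norm_num) (hcE.sub hJ1.continuous) hEJ x

theorem decays_apply_self {F : Type*} [NormedAddCommGroup F] [NormedSpace ℝ F] {m : ℝ}
    {f : Spacetime → Spacetime →L[ℝ] F} (h : Decays (m + 1) f) : Decays m fun p => f p p := by
  obtain ⟨K, hK0, hK⟩ := h.exists_nonneg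
  refine ⟨K, fun p => ((f p).le_opNorm p).trans ?_⟩
  calc _ ≤ (K * (1 + ‖p‖) ^ (-(m + 1))) * ‖p‖ := by gcongr; exact hK p
    _ = K * (‖p‖ * (1 + ‖p‖) ^ (-(m + 1))) := by ring
    _ ≤ _ := by gcongr; exact norm_mul_weight_le m p

/-- The potential of a scattering current satisfies all the bounds. -/
theorem IsScatteringCurrent.potentialBounds (hσ : |σ| = 1) (hε : 0 < ε) (hε1 : ε < 1)
    (hJ : IsScatteringCurrent ε J) : PotentialBounds ε (conePotential σ J) := by
  have hJ1 : ContDiff ℝ 1 J := hJ.contDiff.of_le (by norm_num)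
  have hd := hJ.decays_zero hε
  have hd' := hJ.decays_fderiv hε
  have hd2 : Decays 5 (fderiv ℝ (fderiv ℝ J)) := by
    have := hJ.decays hε (n := 2) (by norm_num)
    norm_num at this
    exact decays_fderiv_fderiv_iff.1 this
  have hc : Continuous (fderiv ℝ J) := hJ1.continuous_fderiv one_ne_zero
  have hV' : fderiv ℝ (conePotential σ J) = conePotential σ (fderiv ℝ J) :=
    funext fun x => (hasFDerivAt_conePotential (m := 3) (by norm_num) hJ1 hd
      (hd'.mono (by norm_num)) x).fderiv
  set f := radialComponent J with hf
  have hf3 : ContDiff ℝ 3 f := contDiff_radialComponent hJ.contDiff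
  have hf' : ContDiff ℝ 2 (fderiv ℝ f) := hf3.fderiv_right (by norm_num)
  have hf'' : ContDiff ℝ 1 (fderiv ℝ (fderiv ℝ f)) := hf'.fderiv_right (by norm_num)
  have hdf' : Decays 3 (fderiv ℝ f) := by
    refine decays_fderiv_iff.1 (decays_iteratedFDeriv_radialComponent (n := 0) (by norm_num)
      (by simpa using hJ1) ?_ (decays_zero_iff.2 hd))
    norm_num
    exact decays_fderiv_iff.2 hd'
  have hdf'' : Decays 4 (fderiv ℝ (fderiv ℝ f)) := by
    refine decays_fderiv_fderiv_iff.1 (decays_iteratedFDeriv_radialComponent (n := 1)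
      (by norm_num) (hJ.contDiff.of_le (by norm_num)) ?_ (decays_fderiv_iff.2 hd'))
    norm_num
    exact decays_fderiv_fderiv_iff.2 hd2
  have hφ' : fderiv ℝ (radialComponent (conePotential σ J)) = conePotential σ (fderiv ℝ f) :=
    funext fun x => (hJ.hasFDerivAt_radialComponent hσ hε x).fderiv
  have hφ'' : fderiv ℝ (fderiv ℝ (radialComponent (conePotential σ J))) =
      conePotential σ (fderiv ℝ (fderiv ℝ f)) := by
    rw [hφ']
    exact funext fun x => (hasFDerivAt_conePotential (m := 3) (by norm_num)
      (hf'.of_le (by norm_num)) hdf' (hdf''.mono (by norm_num)) x).fderiv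
  set g := radialComponent (eulerThree J) with hg
  -- The factor p has degree one and raises 2 to 3: (p·∇ + 2)(p·J) = p·(p·∇ + 3)J. This is where the
  -- second admissibility condition yields the gain ε.
  have hgf : (fun p => fderiv ℝ f p p + 2 * f p) = g := by
    ext p
    rw [hf, hg, fderiv_radialComponent_apply (hJ1.differentiable one_ne_zero p)]
    simp only [radialComponent, eulerThree, map_add, map_smul, smul_eq_mul]
    ring
  have hE0 := hJ.decays_eulerThree (n := 0) (by norm_num)
  have hE1 := hJ.decays_eulerThree (n := 1) (by norm_num)
  have hE2 := hJ.decays_eulerThree (n := 2) (by norm_num)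
  have hg2 : ContDiff ℝ 2 g := contDiff_radialComponent hJ.contDiff_eulerThree
  have hg1 : ContDiff ℝ 1 g := hg2.of_le (by norm_num)
  have hdg : Decays (2 + ε) g := by
    refine decays_radialComponent ((decays_zero_iff.1 hE0).mono (le_of_eq ?_))
    push_cast; ring
  have hdg' : Decays (3 + ε) (fderiv ℝ g) := by
    refine decays_fderiv_iff.1 (decays_iteratedFDeriv_radialComponent (n := 0) (by norm_num)
      (hJ.contDiff_eulerThree.of_le (by norm_num)) (hE1.mono (le_of_eq ?_))
      (hE0.mono (le_of_eq ?_)))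
    · push_cast; ring
    · push_cast; ring
  have hψ : radialDerivative (conePotential σ J) = conePotential σ g := by
    ext x
    rw [radialDerivative, hφ', ← hgf]
    refine conePotential_fderiv_self (m := 2 + ε) hσ (by linarith) (hf3.of_le (by norm_num))
      hdf' x ?_ (by rw [hgf]; exact hdg)
    -- In spacetime p·J is only known to decay like |p|⁻², which is not enough for the divergence
    -- theorem. On the cone of a fixed x the improved decay of J gives |y|^(-(2+ε)).
    obtain ⟨C, hC0, hC⟩ := hJ.cone_bound hσ hε hε1.le x
    refine ⟨(‖x‖ + 2) * C, fun y => (abs_mink_le _ _).trans ?_⟩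
    have h1 : ‖x + nullVec σ y‖ ≤ (‖x‖ + 2) * (1 + ‖y‖) := by
      have := norm_nullVec_le hσ y
      have := norm_add_le x (nullVec σ y)
      nlinarith [norm_nonneg x, norm_nonneg y]
    calc _ ≤ ((‖x‖ + 2) * (1 + ‖y‖)) * (C * (1 + ‖y‖) ^ (-(3 + ε))) := by
          gcongr; exact hC y
      _ = (‖x‖ + 2) * C * ((1 + ‖y‖) ^ (1 : ℝ) * (1 + ‖y‖) ^ (-(3 + ε))) := by
          rw [Real.rpow_one]; ring
      _ = _ := by
          rw [← Real.rpow_add (by positivity)]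
          congr 2
          ring
  have hψ' : fderiv ℝ (radialDerivative (conePotential σ J)) = conePotential σ (fderiv ℝ g) := by
    rw [hψ]
    exact funext fun x => (hasFDerivAt_conePotential (m := 2 + ε) (by linarith) hg1 hdg
      (hdg'.mono (by linarith)) x).fderiv
  have hdg2 : Decays (2 + ε) fun p => fderiv ℝ g p p + 2 * g p := by
    obtain ⟨K, hK⟩ := decays_apply_self (m := 2 + ε) (hdg'.mono (by linarith))
    obtain ⟨L, hL⟩ := hdg
    refine ⟨K + 2 * L, fun p => (norm_add_le _ _).trans ?_⟩
    have := hL p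
    rw [norm_mul, Real.norm_ofNat]
    linarith [hK p]
  have hcg' := hg1.continuous_fderiv one_ne_zero
  refine ⟨?_, ?_, ?_, ?_, ?_, ?_, ?_, ?_, ?_⟩
  · refine contDiff_conePotential (m := 3) (by norm_num) 3 hJ.contDiff fun k hk =>
      (hJ.decays hε hk).mono ?_
    linarith [(Nat.cast_nonneg k : (0 : ℝ) ≤ k)]
  · exact boundedBy_conePotential_of_currentWeight hσ hε hJ1.continuous hJ.boundedBy
  · rw [hV']
    have := boundedBy_conePotential_of_three_lt hσ (by norm_num) hc hd'
    norm_num [Real.rpow_neg_one] at this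
    exact this
  · rw [hV']
    simp only [hJ.fderiv_self hσ hε]
    refine boundedBy_conePotential_of_currentWeight hσ hε
      (hJ.contDiff_eulerThree.continuous.sub hJ1.continuous) ?_
    obtain ⟨K, hK0, hK⟩ := (decays_zero_iff.1 hE0).exists_nonneg
    obtain ⟨L, hL⟩ := hJ.boundedBy
    refine ⟨K + L, fun p => (norm_sub_le _ _).trans ?_⟩
    have h1 : ‖eulerThree J p‖ ≤ K * currentWeight ε p := by
      refine (hK p).trans ?_
      gcongr
      simpa using weight_le_currentWeight ε p
    linarith [hL p]
  · rw [hφ']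
    refine boundedBy_conePotential_of_currentWeight hσ hε hf'.continuous ?_
    obtain ⟨K, hK0, hK⟩ := hJ.bound
    refine ⟨2 * K, fun p => ?_⟩
    have h := norm_iteratedFDeriv_radialComponent_le (n := 0) (by norm_num)
      (by simpa using hJ1) p
    have h0 := hK 0 (by norm_num) p
    have h1 := hK 1 (by norm_num) p
    rw [show (0 + 1 : ℕ) = 1 from rfl] at h
    simp only [zero_add, norm_iteratedFDeriv_one, norm_iteratedFDeriv_zero, Nat.cast_zero,
      Nat.cast_one, neg_zero, Real.rpow_zero, one_mul, Real.rpow_neg_one] at h h0 h1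
    have hw := currentWeight_nonneg ε p
    have h2 : ‖p‖ * (1 + ‖p‖)⁻¹ ≤ 1 := by
      rw [mul_inv_le_iff₀ (by positivity)]
      linarith
    calc _ ≤ ‖p‖ * ‖fderiv ℝ J p‖ + ‖J p‖ := h
      _ ≤ ‖p‖ * (K * ((1 + ‖p‖)⁻¹ * currentWeight ε p)) + K * currentWeight ε p := by gcongr
      _ = (‖p‖ * (1 + ‖p‖)⁻¹) * (K * currentWeight ε p) + K * currentWeight ε p := by ring
      _ ≤ 1 * (K * currentWeight ε p) + K * currentWeight ε p := by gcongr
      _ = _ := by ring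
  · rw [hφ'']
    have := boundedBy_conePotential_of_three_lt hσ (by norm_num) hf''.continuous hdf''
    norm_num [Real.rpow_neg_one] at this
    exact this
  · rw [hψ]
    have := boundedBy_conePotential_of_lt_three hσ (by linarith) (by linarith) hg2.continuous hdg
    simpa using this
  · rw [hψ']
    have := boundedBy_conePotential_of_three_lt hσ (by linarith) hcg' hdg'
    simpa using this
  · rw [hψ']
    -- A second use of the cone identity, now for g; its decay 2 + ε needs no help from the cone.
    have h1 : ∀ x, conePotential σ (fderiv ℝ g) x x =
        conePotential σ (fun p => fderiv ℝ g p p + 2 * g p) x := fun x =>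
      conePotential_fderiv_self (m := 2 + ε) hσ (by linarith) hg1 (hdg'.mono (by linarith)) x
        (by
          obtain ⟨C, -, hC⟩ := exists_cone_bound (σ := σ) (by linarith) hdg x
          exact ⟨C, hC⟩) hdg2
    simp only [h1]
    have hcont : Continuous fun p => fderiv ℝ g p p + 2 * g p :=
      (hcg'.clm_apply continuous_id).add (continuous_const.mul hg2.continuous)
    have := boundedBy_conePotential_of_lt_three hσ (by linarith) (by linarith) hcont hdg2
    simpa using this

end Current

/-- The total Lorenz potential as a (contravariant) vector field. -/
def totalPotential (J Jinc : Spacetime → Spacetime) (x : Spacetime) : Spacetime :=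
  conePotential (-1) J x + (conePotential (-1) Jinc x + -conePotential 1 Jinc x)

theorem potentialBounds_totalPotential {ε : ℝ} (hε : 0 < ε) (hε1 : ε < 1)
    {J Jinc : Spacetime → Spacetime} (hJ : IsScatteringCurrent ε J)
    (hJinc : IsScatteringCurrent ε Jinc) : PotentialBounds ε (totalPotential J Jinc) :=
  (hJ.potentialBounds (by norm_num) hε hε1).add
    ((hJinc.potentialBounds (by norm_num) hε hε1).add
      (hJinc.potentialBounds (by norm_num) hε hε1).neg)

theorem lorenzPotential_eq (J Jinc : Spacetime → Spacetime) :
    lorenzPotential J Jinc = fun x a => metricSign a * totalPotential J Jinc x a := by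
  ext x a
  simp only [lorenzPotential, radiatedPotential, retardedPotential_eq, advancedPotential_eq,
    totalPotential, PiLp.add_apply, PiLp.neg_apply, PiLp.sub_apply]
  ring

end

noncomputable section

open Filter Topology Set

/-! ### Calculus in the coordinates `(τ, z)` -/

theorem one_le_bracket (s : ℝ) : 1 ≤ bracket s := by
  rw [bracket, Real.one_le_sqrt]
  nlinarith [sq_nonneg s]

theorem abs_le_bracket (s : ℝ) : |s| ≤ bracket s := by
  rw [bracket, ← Real.sqrt_sq_eq_abs]
  exact Real.sqrt_le_sqrt (by linarith)

theorem contDiff_bracket {n : WithTop ℕ∞} : ContDiff ℝ n bracket :=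
  ContDiff.sqrt (by fun_prop) fun s => by positivity

theorem contDiff_bracket_norm {n : WithTop ℕ∞} : ContDiff ℝ n fun z : Space => bracket ‖z‖ :=
  ContDiff.sqrt ((contDiff_norm_sq ℝ).add contDiff_const) fun s => by positivity

theorem hasDerivAt_bracket (s : ℝ) : HasDerivAt bracket (s / bracket s) s := by
  have h : HasDerivAt (fun s : ℝ => s ^ 2 + 1) (2 * s) s := by
    simpa using (hasDerivAt_pow 2 s).add_const 1
  refine (h.sqrt (by positivity)).congr_deriv ?_
  rw [mul_div_mul_left _ _ two_ne_zero]
  rfl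

theorem hasFDerivAt_bracket_norm (z : Space) :
    HasFDerivAt (fun z : Space => bracket ‖z‖) ((bracket ‖z‖)⁻¹ • innerSL ℝ z) z := by
  have h : HasFDerivAt (fun z : Space => ‖z‖ ^ 2 + 1) (2 • innerSL ℝ z) z :=
    (hasStrictFDerivAt_norm_sq z).hasFDerivAt.add_const 1
  refine (h.sqrt (by positivity)).congr_fderiv ?_
  ext u
  have hb := (bracket_pos ‖z‖).ne'
  change 1 / (2 * bracket ‖z‖) * (2 • inner ℝ z u) = (bracket ‖z‖)⁻¹ * inner ℝ z u
  rw [two_nsmul]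
  field_simp
  ring

theorem chart_eq (p : ℝ × Space) :
    chart p = eventL (p.1 * bracket ‖p.2‖, bracket p.1 • p.2) := by
  rw [eventL_apply, chart]

theorem contDiff_chart {n : WithTop ℕ∞} : ContDiff ℝ n chart := by
  have : chart = fun p => eventL (p.1 * bracket ‖p.2‖, bracket p.1 • p.2) := funext chart_eq
  rw [this]
  have h1 : ContDiff ℝ n fun p : ℝ × Space => bracket ‖p.2‖ :=
    contDiff_bracket_norm.comp contDiff_snd
  have h2 : ContDiff ℝ n fun p : ℝ × Space => bracket p.1 := contDiff_bracket.comp contDiff_fst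
  exact eventL.contDiff.comp ((contDiff_fst.mul h1).prodMk (h2.smul contDiff_snd))

theorem fderiv_chart_apply (p w : ℝ × Space) :
    fderiv ℝ chart p w =
      event (w.1 * bracket ‖p.2‖ + p.1 * (inner ℝ p.2 w.2 / bracket ‖p.2‖))
        ((w.1 * (p.1 / bracket p.1)) • p.2 + bracket p.1 • w.2) := by
  have h1 : HasFDerivAt (fun p : ℝ × Space => bracket ‖p.2‖)
      (((bracket ‖p.2‖)⁻¹ • innerSL ℝ p.2).comp (ContinuousLinearMap.snd ℝ ℝ Space)) p :=
    (hasFDerivAt_bracket_norm p.2).comp p hasFDerivAt_snd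
  have h2 : HasFDerivAt (fun p : ℝ × Space => bracket p.1)
      ((p.1 / bracket p.1) • ContinuousLinearMap.fst ℝ ℝ Space) p :=
    (hasDerivAt_bracket p.1).comp_hasFDerivAt p hasFDerivAt_fst
  have h3 := ((hasFDerivAt_fst (𝕜 := ℝ) (p := p)).mul h1).prodMk
    (h2.smul (hasFDerivAt_snd (𝕜 := ℝ) (p := p)))
  have h4 := eventL.hasFDerivAt.comp p h3
  have h5 : HasFDerivAt chart _ p := h4.congr_of_eventuallyEq
    (Eventually.of_forall chart_eq)
  rw [h5.fderiv]
  simp [eventL_apply]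
  congr 1
  · ring
  · rw [add_comm, mul_comm]

/-- The unit vector in time direction. -/
def timeDir : Spacetime := EuclideanSpace.single 0 1

theorem norm_timeDir : ‖timeDir‖ = 1 := by simp [timeDir]

theorem timeDir_zero : timeDir 0 = 1 := by simp [timeDir]

theorem timeDir_succ (i : Fin 3) : timeDir i.succ = 0 := by simp [timeDir]

/-- Written through x and the time axis, so that contractions with ∂_τ x reduce to x·A, x·∇ and x^a
F_ab, which have better bounds than generic components. -/
theorem fderiv_chart_time (p : ℝ × Space) :
    fderiv ℝ chart p (coordVec 0) =
      (p.1 / bracket p.1 ^ 2) • chart p + (bracket ‖p.2‖ / bracket p.1 ^ 2) • timeDir := by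
  have hT := bracket_pos p.1
  have h := bracket_sq p.1
  have hZ := bracket_pos ‖p.2‖
  rw [fderiv_chart_apply]
  ext a
  refine Fin.cases ?_ (fun i => ?_) a
  · simp only [coordVec, event_zero, chart, PiLp.add_apply, PiLp.smul_apply, timeDir_zero,
      smul_eq_mul, Fin.cases_zero, inner_zero_right]
    field_simp
    linear_combination bracket ‖p.2‖ ^ 2 * h
  · simp only [coordVec, event_apply_succ, chart, PiLp.add_apply, PiLp.smul_apply, timeDir_succ,
      smul_eq_mul, Fin.cases_zero, smul_zero, PiLp.zero_apply]
    field_simp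
    ring

theorem fderiv_chart_space (p : ℝ × Space) (i : Fin 3) :
    fderiv ℝ chart p (coordVec i.succ) =
      (p.1 * p.2 i / bracket ‖p.2‖) • timeDir + bracket p.1 • EuclideanSpace.single i.succ 1 := by
  rw [fderiv_chart_apply]
  ext a
  refine Fin.cases ?_ (fun j => ?_) a
  · simp [coordVec, event_zero, timeDir_zero, EuclideanSpace.inner_single_right]
    ring
  · simp [coordVec, event_apply_succ, timeDir_succ]

/-- The field z·∂_z is x·∇ up to the multiple τ/⟨z⟩ of ∂_0; all gains under contraction with z come
from here. -/
theorem fderiv_chart_radial (p : ℝ × Space) :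
    fderiv ℝ chart p (0, p.2) = chart p - (p.1 / bracket ‖p.2‖) • timeDir := by
  have hZ := bracket_pos ‖p.2‖
  have h := bracket_sq ‖p.2‖
  rw [fderiv_chart_apply]
  ext a
  refine Fin.cases ?_ (fun i => ?_) a
  · simp only [event_zero, chart, PiLp.sub_apply, PiLp.smul_apply, timeDir_zero, smul_eq_mul,
      real_inner_self_eq_norm_sq]
    field_simp
    linear_combination (-p.1) * h
  · simp [event_apply_succ, chart, timeDir_succ]

theorem sum_smul_coordVec (z : Space) : ∑ i : Fin 3, z i • coordVec i.succ = (0, z) := by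
  ext j
  · simp [coordVec, Fin.sum_univ_three]
  · fin_cases j <;> simp [coordVec, Fin.sum_univ_three]

theorem sum_mul_pd (f : ℝ × Space → ℝ) (p : ℝ × Space) :
    ∑ i : Fin 3, p.2 i * pd i.succ f p = fderiv ℝ f p (0, p.2) := by
  rw [← sum_smul_coordVec, map_sum]
  simp [pd]

theorem norm_fderiv_chart_space_le (p : ℝ × Space) (i : Fin 3) :
    ‖fderiv ℝ chart p (coordVec i.succ)‖ ≤ 2 * bracket p.1 := by
  rw [fderiv_chart_space]
  refine (norm_add_le _ _).trans ?_
  have hZ := bracket_pos ‖p.2‖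
  rw [norm_smul, norm_smul, norm_timeDir, PiLp.norm_single, norm_one, mul_one, mul_one,
    Real.norm_eq_abs, Real.norm_eq_abs, abs_of_pos (bracket_pos p.1), abs_div, abs_mul,
    abs_of_pos hZ]
  have h1 : |p.2 i| ≤ bracket ‖p.2‖ := (PiLp.norm_apply_le p.2 i).trans
    ((le_abs_self _).trans (abs_le_bracket _))
  have h2 : |p.1| * |p.2 i| / bracket ‖p.2‖ ≤ bracket p.1 := by
    rw [div_le_iff₀ hZ]
    exact mul_le_mul (abs_le_bracket _) h1 (abs_nonneg _) (bracket_pos _).le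
  linarith

/-- The function `log (⟨τ⟩⟨z⟩)`. -/
def logWeight (p : ℝ × Space) : ℝ := Real.log (bracket p.1 * bracket ‖p.2‖)

theorem logWeight_eq (p : ℝ × Space) :
    logWeight p = Real.log (bracket p.1) + Real.log (bracket ‖p.2‖) :=
  Real.log_mul (bracket_pos _).ne' (bracket_pos _).ne'

theorem contDiff_logWeight {n : WithTop ℕ∞} : ContDiff ℝ n logWeight :=
  ContDiff.log ((contDiff_bracket.comp contDiff_fst).mul (contDiff_bracket_norm.comp contDiff_snd))
    fun _ => (mul_pos (bracket_pos _) (bracket_pos _)).ne'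

theorem fderiv_logWeight_apply (p w : ℝ × Space) :
    fderiv ℝ logWeight p w =
      p.1 / bracket p.1 ^ 2 * w.1 + inner ℝ p.2 w.2 / bracket ‖p.2‖ ^ 2 := by
  have hT := bracket_pos p.1
  have hZ := bracket_pos ‖p.2‖
  have h1 : HasFDerivAt (fun p : ℝ × Space => bracket ‖p.2‖)
      (((bracket ‖p.2‖)⁻¹ • innerSL ℝ p.2).comp (ContinuousLinearMap.snd ℝ ℝ Space)) p :=
    (hasFDerivAt_bracket_norm p.2).comp p hasFDerivAt_snd
  have h2 : HasFDerivAt (fun p : ℝ × Space => bracket p.1)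
      ((p.1 / bracket p.1) • ContinuousLinearMap.fst ℝ ℝ Space) p :=
    (hasDerivAt_bracket p.1).comp_hasFDerivAt p hasFDerivAt_fst
  have h3 : HasFDerivAt logWeight _ p := ((h2.log hT.ne').add (h1.log hZ.ne')).congr_of_eventuallyEq
    (Eventually.of_forall logWeight_eq)
  rw [h3.fderiv]
  simp
  field_simp

end

noncomputable section

open Filter Topology Set

/-! ### The special gauge potential in the coordinates `(τ, z)` -/

theorem sum_mul_nabla (f : Spacetime → ℝ) (x v : Spacetime) :
    ∑ a, v a * nabla a f x = fderiv ℝ f x v := by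
  have hv : v = ∑ a, v a • (EuclideanSpace.single a 1 : Spacetime) := by
    ext b
    simp [Finset.sum_apply, Pi.single_apply]
  conv_rhs => rw [hv, map_sum]
  simp [nabla]

theorem jac_eq (a μ : Fin 4) (p : ℝ × Space) : jac a μ p = fderiv ℝ chart p (coordVec μ) a := by
  have h : HasFDerivAt (fun q => chart q a)
      ((EuclideanSpace.proj a : Spacetime →L[ℝ] ℝ).comp (fderiv ℝ chart p)) p :=
    (EuclideanSpace.proj a : Spacetime →L[ℝ] ℝ).hasFDerivAt.comp p
      ((contDiff_chart (n := 1)).differentiable one_ne_zero p).hasFDerivAt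
  rw [jac, pd, h.fderiv]
  rfl

theorem contDiff_minkSq {n : WithTop ℕ∞} : ContDiff ℝ n minkSq := by
  unfold minkSq
  fun_prop

theorem contDiff_spacePart {n : WithTop ℕ∞} : ContDiff ℝ n spacePart :=
  spacePartL.contDiff

theorem differentiable_chartSum : Differentiable ℝ chartSum := by
  intro x
  have h : DifferentiableAt ℝ (fun x => (1 + minkSq x) ^ 2 + 4 * ‖spacePart x‖ ^ 2) x := by
    have h1 := (contDiff_minkSq (n := 1)).differentiable one_ne_zero x
    have h2 := (contDiff_spacePart (n := 1)).differentiable one_ne_zero x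
    exact (((differentiableAt_const _).add h1).pow 2).add ((h2.norm_sq ℝ).const_mul 4)
  refine h.sqrt ?_
  -- The radicand cannot vanish: its root equals τ² + |z|² + 1 in the coordinates of x.
  have h3 := chartSum_chart (tauOf x, zOf x)
  rw [chart_coords] at h3
  intro h0
  rw [chartSum, h0, Real.sqrt_zero] at h3
  nlinarith [sq_nonneg (tauOf x), sq_nonneg ‖zOf x‖]

theorem bracket_tauOf (x : Spacetime) :
    bracket (tauOf x) = √((chartSum x + 1 + minkSq x) / 2) := by
  have h1 := chartSum_chart (tauOf x, zOf x)
  have h2 := minkSq_chart (tauOf x, zOf x)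
  rw [chart_coords] at h1 h2
  rw [h1, h2, bracket]
  congr 1
  ring

theorem bracket_norm_zOf (x : Spacetime) :
    bracket ‖zOf x‖ = √((chartSum x + 1 - minkSq x) / 2) := by
  have h1 := chartSum_chart (tauOf x, zOf x)
  have h2 := minkSq_chart (tauOf x, zOf x)
  rw [chart_coords] at h1 h2
  rw [h1, h2, bracket]
  congr 1
  ring

/-- First-order differentiability on spacetime suffices: it justifies the chain rule for S, and all
further regularity is read off from `logWeight`, which is smooth in (τ, z). -/
theorem differentiable_log_brackets :
    Differentiable ℝ fun x => Real.log (bracket (tauOf x) * bracket ‖zOf x‖) := by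
  intro x
  have hc := differentiable_chartSum x
  have hm := (contDiff_minkSq (n := 1)).differentiable one_ne_zero x
  have hT := bracket_pos (tauOf x)
  have hZ := bracket_pos ‖zOf x‖
  refine DifferentiableAt.log ?_ (mul_pos hT hZ).ne'
  simp only [bracket_tauOf, bracket_norm_zOf] at hT hZ ⊢
  have h1 : DifferentiableAt ℝ (fun x => (chartSum x + 1 + minkSq x) / 2) x := by
    simp only [div_eq_mul_inv]
    exact ((hc.add_const 1).fun_add hm).mul_const (2 : ℝ)⁻¹
  have h2 : DifferentiableAt ℝ (fun x => (chartSum x + 1 - minkSq x) / 2) x := by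
    simp only [div_eq_mul_inv]
    exact ((hc.add_const 1).fun_sub hm).mul_const (2 : ℝ)⁻¹
  exact (h1.sqrt (Real.sqrt_pos.1 hT).ne').mul (h2.sqrt (Real.sqrt_pos.1 hZ).ne')

/-- The covector components of a vector field `V`. -/
def covariant (V : Spacetime → Spacetime) (x : Spacetime) (a : Fin 4) : ℝ := metricSign a * V x a

/-! ### Components of the gauge potential and its exterior derivative. -/

section Gauge

variable {V : Spacetime → Spacetime}

theorem sum_mul_covariant (V : Spacetime → Spacetime) (x v : Spacetime) :
    ∑ a, v a * covariant V x a = mink v (V x) := by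
  rw [mink_apply]
  exact Finset.sum_congr rfl fun a _ => by rw [covariant]; ring

theorem specialGauge_eq (V : Spacetime → Spacetime) (x : Spacetime) :
    specialGauge (covariant V) x =
      Real.log (bracket (tauOf x) * bracket ‖zOf x‖) * radialComponent V x := by
  rw [specialGauge, sum_mul_covariant, radialComponent]

theorem specialGauge_chart (V : Spacetime → Spacetime) (p : ℝ × Space) :
    specialGauge (covariant V) (chart p) = logWeight p * radialComponent V (chart p) := by
  rw [specialGauge_eq, tauOf_chart, zOf_chart, logWeight]

theorem differentiable_specialGauge (hV : ContDiff ℝ 3 V) :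
    Differentiable ℝ (specialGauge (covariant V)) := by
  rw [funext (specialGauge_eq V)]
  exact differentiable_log_brackets.mul
    ((contDiff_radialComponent hV).differentiable (by norm_num))

/-- By the chain rule the hatted gradient of S is the coordinate gradient of S composed with the
chart, where the logarithm is explicit. From here on `tauOf` and `zOf` disappear. -/
theorem hatCovector_gaugedPotential (hV : ContDiff ℝ 3 V) (μ : Fin 4) (p : ℝ × Space) :
    hatCovector (gaugedPotential (covariant V)) μ p =
      mink (fderiv ℝ chart p (coordVec μ)) (V (chart p)) -
        pd μ (fun q => logWeight q * radialComponent V (chart q)) p := by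
  have h1 : HasFDerivAt (fun q => logWeight q * radialComponent V (chart q))
      ((fderiv ℝ (specialGauge (covariant V)) (chart p)).comp (fderiv ℝ chart p)) p := by
    refine ((differentiable_specialGauge hV (chart p)).hasFDerivAt.comp p
      ((contDiff_chart (n := 1)).differentiable one_ne_zero p).hasFDerivAt).congr_of_eventuallyEq
      (Eventually.of_forall fun q => (specialGauge_chart V q).symm)
  rw [pd, h1.fderiv, ContinuousLinearMap.comp_apply, ← sum_mul_nabla, ← sum_mul_covariant,
    ← Finset.sum_sub_distrib, hatCovector]
  refine Finset.sum_congr rfl fun a _ => ?_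
  rw [jac_eq, gaugedPotential]
  ring

theorem contDiff_hatCovector_gaugedPotential (hV : ContDiff ℝ 3 V) (μ : Fin 4) :
    ContDiff ℝ 2 (hatCovector (gaugedPotential (covariant V)) μ) := by
  rw [funext (hatCovector_gaugedPotential hV μ)]
  have h1 : ContDiff ℝ 2 fun p => fderiv ℝ chart p (coordVec μ) :=
    ((contDiff_chart (n := 3)).fderiv_right (m := 2) (by norm_num)).clm_apply contDiff_const
  have h2 : ContDiff ℝ 3 fun q => logWeight q * radialComponent V (chart q) :=
    contDiff_logWeight.mul ((contDiff_radialComponent hV).comp contDiff_chart)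
  have h3 : ContDiff ℝ 2 fun p => V (chart p) :=
    (hV.of_le (by norm_num)).comp contDiff_chart
  exact ((mink.contDiff.comp h1).clm_apply h3).sub
    ((h2.fderiv_right (m := 2) (by norm_num)).clm_apply contDiff_const)

theorem fderiv_comp_chart_apply {f : Spacetime → ℝ} (hf : Differentiable ℝ f) (p w : ℝ × Space) :
    fderiv ℝ (fun q => f (chart q)) p w = fderiv ℝ f (chart p) (fderiv ℝ chart p w) := by
  have h : HasFDerivAt (fun q => f (chart q)) ((fderiv ℝ f (chart p)).comp (fderiv ℝ chart p)) p :=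
    (hf (chart p)).hasFDerivAt.comp p
      ((contDiff_chart (n := 1)).differentiable one_ne_zero p).hasFDerivAt
  rw [h.fderiv]
  rfl

theorem hatCovector_gaugedPotential_eq (hV : ContDiff ℝ 3 V) (μ : Fin 4) (p : ℝ × Space) :
    hatCovector (gaugedPotential (covariant V)) μ p =
      mink (fderiv ℝ chart p (coordVec μ)) (V (chart p)) -
        pd μ logWeight p * radialComponent V (chart p) -
        logWeight p * fderiv ℝ (radialComponent V) (chart p) (fderiv ℝ chart p (coordVec μ)) := by
  have hφ : Differentiable ℝ (radialComponent V) :=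
    (contDiff_radialComponent hV).differentiable (by norm_num)
  have hL := (contDiff_logWeight (n := 1)).differentiable one_ne_zero p
  have hφc : DifferentiableAt ℝ (fun q => radialComponent V (chart q)) p :=
    (hφ (chart p)).comp p ((contDiff_chart (n := 1)).differentiable one_ne_zero p)
  rw [hatCovector_gaugedPotential hV, pd, fderiv_fun_mul hL hφc, add_apply, smul_apply, smul_apply,
    fderiv_comp_chart_apply hφ, pd, smul_eq_mul, smul_eq_mul]
  ring

theorem pd_zero_logWeight (p : ℝ × Space) : pd 0 logWeight p = p.1 / bracket p.1 ^ 2 := by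
  rw [pd, fderiv_logWeight_apply]
  simp [coordVec]

theorem pd_succ_logWeight (i : Fin 3) (p : ℝ × Space) :
    pd i.succ logWeight p = p.2 i / bracket ‖p.2‖ ^ 2 := by
  rw [pd, fderiv_logWeight_apply]
  simp [coordVec, EuclideanSpace.inner_single_right]

/-- The covariant component `A_a` as a function of `(τ, z)`. -/
def pulledComponent (V : Spacetime → Spacetime) (a : Fin 4) (p : ℝ × Space) : ℝ :=
  covariant V (chart p) a

/-- The function `∇_a (x · A)` as a function of `(τ, z)`. -/
def pulledGradient (V : Spacetime → Spacetime) (a : Fin 4) (p : ℝ × Space) : ℝ :=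
  nabla a (radialComponent V) (chart p)

theorem mink_single (a : Fin 4) (v : Spacetime) :
    mink (EuclideanSpace.single a 1) v = metricSign a * v a := by
  rw [mink_apply]
  simp

/-- The reason for the choice of S: ∂_τ x contributes τ⟨τ⟩⁻² x·A, which is exactly cancelled by ∂_τ
log(⟨τ⟩⟨z⟩) x·A. Only derivatives of x·A and the component A_0 are left. -/
theorem hatCovector_zero (hV : ContDiff ℝ 3 V) (p : ℝ × Space) :
    hatCovector (gaugedPotential (covariant V)) 0 p =
      (bracket p.1)⁻¹ ^ 2 * (bracket ‖p.2‖ * pulledComponent V 0 p -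
        logWeight p * (p.1 * radialDerivative V (chart p) +
          bracket ‖p.2‖ * pulledGradient V 0 p)) := by
  rw [hatCovector_gaugedPotential_eq hV, fderiv_chart_time, pd_zero_logWeight]
  simp only [map_add, map_smul, add_apply, smul_apply, smul_eq_mul]
  rw [timeDir, mink_single]
  simp only [pulledComponent, pulledGradient, radialDerivative, radialComponent, covariant, nabla]
  field_simp
  ring

theorem hatCovector_succ (hV : ContDiff ℝ 3 V) (j : Fin 3) (p : ℝ × Space) :
    hatCovector (gaugedPotential (covariant V)) j.succ p =
      p.1 * p.2 j * (bracket ‖p.2‖)⁻¹ *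
          (pulledComponent V 0 p - logWeight p * pulledGradient V 0 p) +
        bracket p.1 * (pulledComponent V j.succ p - logWeight p * pulledGradient V j.succ p) -
        p.2 j * (bracket ‖p.2‖)⁻¹ ^ 2 * radialComponent V (chart p) := by
  rw [hatCovector_gaugedPotential_eq hV, fderiv_chart_space, pd_succ_logWeight]
  simp only [map_add, map_smul, add_apply, smul_apply, smul_eq_mul]
  rw [timeDir, mink_single, mink_single]
  simp only [pulledComponent, pulledGradient, covariant, nabla]
  field_simp
  ring

/-- The same cancellation in the z direction, now incomplete: z·∂_z log⟨z⟩ = 1 - ⟨z⟩⁻² leaves ⟨z⟩⁻²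
x·A. -/
theorem sum_mul_hatCovector (hV : ContDiff ℝ 3 V) (p : ℝ × Space) :
    ∑ i : Fin 3, p.2 i * hatCovector (gaugedPotential (covariant V)) i.succ p =
      (bracket ‖p.2‖)⁻¹ ^ 2 * radialComponent V (chart p) -
        p.1 * (bracket ‖p.2‖)⁻¹ * pulledComponent V 0 p -
        logWeight p * (radialDerivative V (chart p) -
          p.1 * (bracket ‖p.2‖)⁻¹ * pulledGradient V 0 p) := by
  have h1 : ∑ i : Fin 3, p.2 i • fderiv ℝ chart p (coordVec i.succ) =
      chart p - (p.1 / bracket ‖p.2‖) • timeDir := by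
    rw [← fderiv_chart_radial, ← sum_smul_coordVec, map_sum]
    simp
  have hZ := bracket_pos ‖p.2‖
  have h2 : ∑ i : Fin 3, p.2 i * mink (fderiv ℝ chart p (coordVec i.succ)) (V (chart p)) =
      radialComponent V (chart p) - p.1 / bracket ‖p.2‖ * pulledComponent V 0 p := by
    have := congrArg (fun v => mink v (V (chart p))) h1
    simp only [map_sum, map_sub, map_smul, sub_apply, smul_apply, sum_apply, smul_eq_mul] at this
    rw [this, timeDir, mink_single]
    rfl
  have h3 : ∑ i : Fin 3, p.2 i *
      fderiv ℝ (radialComponent V) (chart p) (fderiv ℝ chart p (coordVec i.succ)) =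
      radialDerivative V (chart p) - p.1 / bracket ‖p.2‖ * pulledGradient V 0 p := by
    have := congrArg (fderiv ℝ (radialComponent V) (chart p)) h1
    simp only [map_sum, map_sub, map_smul, smul_eq_mul] at this
    rw [this]
    rfl
  have h4 : ∑ i : Fin 3, p.2 i * pd i.succ logWeight p = 1 - (bracket ‖p.2‖)⁻¹ ^ 2 := by
    rw [sum_mul_pd, fderiv_logWeight_apply, real_inner_self_eq_norm_sq, mul_zero, zero_add]
    have := bracket_sq ‖p.2‖
    field_simp
    linarith
  calc _ = ∑ i : Fin 3, p.2 i * mink (fderiv ℝ chart p (coordVec i.succ)) (V (chart p)) -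
        (∑ i : Fin 3, p.2 i * pd i.succ logWeight p) * radialComponent V (chart p) -
        logWeight p * ∑ i : Fin 3, p.2 i *
      fderiv ℝ (radialComponent V) (chart p) (fderiv ℝ chart p (coordVec i.succ)) := by
        rw [Finset.sum_mul, Finset.mul_sum, ← Finset.sum_sub_distrib, ← Finset.sum_sub_distrib]
        refine Finset.sum_congr rfl fun i _ => ?_
        rw [hatCovector_gaugedPotential_eq hV]
        ring
    _ = _ := by
        rw [h2, h3, h4]
        ring

/-- The field strength as an antisymmetric bilinear form. -/
theorem hatTensor_fieldStrength (hV : ContDiff ℝ 3 V) (μ ν : Fin 4) (p : ℝ × Space) :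
    hatTensor (fieldStrength (covariant V)) μ ν p =
      mink (fderiv ℝ chart p (coordVec ν))
          (fderiv ℝ V (chart p) (fderiv ℝ chart p (coordVec μ))) -
        mink (fderiv ℝ chart p (coordVec μ))
          (fderiv ℝ V (chart p) (fderiv ℝ chart p (coordVec ν))) := by
  set x := chart p
  have hn : ∀ a b : Fin 4, nabla a (fun y => covariant V y b) x =
      metricSign b * fderiv ℝ V x (EuclideanSpace.single a 1) b := by
    intro a b
    have h : HasFDerivAt (fun y => metricSign b * V y b)
        (metricSign b • ((EuclideanSpace.proj b : Spacetime →L[ℝ] ℝ).comp (fderiv ℝ V x))) x :=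
      ((EuclideanSpace.proj b : Spacetime →L[ℝ] ℝ).hasFDerivAt.comp x
        (hV.differentiable (by norm_num) x).hasFDerivAt).const_mul _
    change fderiv ℝ (fun y => metricSign b * V y b) x _ = _
    rw [h.fderiv]
    rfl
  have hexp : ∀ v : Spacetime, v = ∑ a, v a • (EuclideanSpace.single a 1 : Spacetime) := by
    intro v
    ext b
    simp [Finset.sum_apply, Pi.single_apply]
  have hbil : ∀ u v : Spacetime, mink v (fderiv ℝ V x u) =
      ∑ a, ∑ b, u a * v b * (metricSign b * fderiv ℝ V x (EuclideanSpace.single a 1) b) := by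
    intro u v
    conv_lhs => rw [hexp u, map_sum, map_sum]
    refine Finset.sum_congr rfl fun a _ => ?_
    rw [map_smul, map_smul, mink_apply, smul_eq_mul, Finset.mul_sum]
    exact Finset.sum_congr rfl fun b _ => by ring
  rw [hbil, hbil, Finset.sum_comm (f := fun a b => fderiv ℝ chart p (coordVec ν) a * _ * _),
    ← Finset.sum_sub_distrib, hatTensor]
  refine Finset.sum_congr rfl fun a _ => ?_
  rw [← Finset.sum_sub_distrib]
  refine Finset.sum_congr rfl fun b _ => ?_
  rw [jac_eq, jac_eq, fieldStrength, hn, hn]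
  ring

theorem pd_pd_comm {f : ℝ × Space → ℝ} (hf : ContDiff ℝ 2 f) (μ ν : Fin 4) (p : ℝ × Space) :
    pd μ (pd ν f) p = pd ν (pd μ f) p := by
  have hd : ∀ κ, HasFDerivAt (pd κ f)
      ((ContinuousLinearMap.apply ℝ ℝ (coordVec κ)).comp (fderiv ℝ (fderiv ℝ f) p)) p := fun κ =>
    (ContinuousLinearMap.apply ℝ ℝ (coordVec κ)).hasFDerivAt.comp p
      ((hf.fderiv_right (m := 1) (by norm_num)).differentiable one_ne_zero p).hasFDerivAt
  have hs : IsSymmSndFDerivAt ℝ f p := hf.contDiffAt.isSymmSndFDerivAt (by simp)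
  rw [pd, (hd ν).fderiv, pd, (hd μ).fderiv]
  exact hs.eq _ _

/-- The exterior derivative of the gauge potential is the field strength. -/
theorem pd_hatCovector_sub (hV : ContDiff ℝ 3 V) (μ ν : Fin 4) (p : ℝ × Space) :
    pd μ (hatCovector (gaugedPotential (covariant V)) ν) p -
      pd ν (hatCovector (gaugedPotential (covariant V)) μ) p =
      hatTensor (fieldStrength (covariant V)) μ ν p := by
  have hS : ContDiff ℝ 3 fun q => logWeight q * radialComponent V (chart q) :=
    contDiff_logWeight.mul ((contDiff_radialComponent hV).comp contDiff_chart)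
  have hc' : ContDiff ℝ 2 (fderiv ℝ chart) :=
    (contDiff_chart (n := 3)).fderiv_right (by norm_num)
  have hVp : HasFDerivAt (fun q => V (chart q))
      ((fderiv ℝ V (chart p)).comp (fderiv ℝ chart p)) p :=
    (hV.differentiable (by norm_num) (chart p)).hasFDerivAt.comp p
      ((contDiff_chart (n := 1)).differentiable one_ne_zero p).hasFDerivAt
  -- The terms with second derivatives of the chart and of S are symmetric in the two indices and
  -- drop out on antisymmetrization.
  have key : ∀ κ lam, pd κ (hatCovector (gaugedPotential (covariant V)) lam) p =
      mink (fderiv ℝ (fderiv ℝ chart) p (coordVec κ) (coordVec lam)) (V (chart p)) +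
      mink (fderiv ℝ chart p (coordVec lam))
        (fderiv ℝ V (chart p) (fderiv ℝ chart p (coordVec κ))) -
      pd κ (pd lam fun q => logWeight q * radialComponent V (chart q)) p := by
    intro κ lam
    have h1 : HasFDerivAt (fun q => fderiv ℝ chart q (coordVec lam))
        ((ContinuousLinearMap.apply ℝ Spacetime (coordVec lam)).comp
          (fderiv ℝ (fderiv ℝ chart) p)) p :=
      (ContinuousLinearMap.apply ℝ Spacetime (coordVec lam)).hasFDerivAt.comp p
        (hc'.differentiable (by norm_num) p).hasFDerivAt
    have h2 := (mink.hasFDerivAt.comp p h1).clm_apply hVp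
    have h3 : DifferentiableAt ℝ
        (pd lam fun q => logWeight q * radialComponent V (chart q)) p :=
      ((hS.fderiv_right (m := 2) (by norm_num)).clm_apply contDiff_const).differentiable
        (by norm_num) p
    have h4 : HasFDerivAt (hatCovector (gaugedPotential (covariant V)) lam) _ p :=
      (h2.sub h3.hasFDerivAt).congr_of_eventuallyEq
        (Eventually.of_forall (hatCovector_gaugedPotential hV lam))
    rw [pd, h4.fderiv]
    simp [pd]
    ring
  have hs : IsSymmSndFDerivAt ℝ chart p :=
    (contDiff_chart (n := 2)).contDiffAt.isSymmSndFDerivAt (by simp)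
  rw [key, key, hatTensor_fieldStrength hV, pd_pd_comm (hS.of_le (by norm_num)) μ ν,
    hs.eq (coordVec μ) (coordVec ν)]
  ring

end Gauge

end

noncomputable section

open Filter Topology Set

/-! ### Weighted bounds in the coordinates `(τ, z)` -/

/-- Logarithmic factors allowed in weighted bounds. -/
class LogFactor (m : ℝ × Space → ℝ) : Prop where
  one_le : ∀ p, 1 ≤ m p

theorem log_bracket_nonneg (s : ℝ) : 0 ≤ Real.log (bracket s) := Real.log_nonneg (one_le_bracket s)

theorem logWeight_nonneg (p : ℝ × Space) : 0 ≤ logWeight p := by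
  rw [logWeight_eq]
  exact add_nonneg (log_bracket_nonneg _) (log_bracket_nonneg _)

/-- The factor `1 + log ⟨τ⟩`. -/
def timeLog (p : ℝ × Space) : ℝ := 1 + Real.log (bracket p.1)

/-- The factor `1 + log (⟨τ⟩⟨z⟩)`. -/
def fullLog (p : ℝ × Space) : ℝ := 1 + logWeight p

instance : LogFactor 1 := ⟨fun _ => le_rfl⟩

instance : LogFactor timeLog := ⟨fun p => by linarith [timeLog.eq_1 p, log_bracket_nonneg p.1]⟩

instance : LogFactor fullLog := ⟨fun p => by linarith [fullLog.eq_1 p, logWeight_nonneg p]⟩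

/-- The monomial `⟨τ⟩^a ⟨z⟩^b`. -/
def monomialWeight (a b : ℝ) (p : ℝ × Space) : ℝ := bracket p.1 ^ a * bracket ‖p.2‖ ^ b

theorem monomialWeight_pos (a b : ℝ) (p : ℝ × Space) : 0 < monomialWeight a b p :=
  mul_pos (Real.rpow_pos_of_pos (bracket_pos _) _) (Real.rpow_pos_of_pos (bracket_pos _) _)

theorem monomialWeight_mul (a b c d : ℝ) (p : ℝ × Space) :
    monomialWeight a b p * monomialWeight c d p = monomialWeight (a + c) (b + d) p := by
  rw [monomialWeight, monomialWeight, monomialWeight, Real.rpow_add (bracket_pos _),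
    Real.rpow_add (bracket_pos _)]
  ring

theorem monomialWeight_mono {a b a' b' : ℝ} (ha : a ≤ a') (hb : b ≤ b') (p : ℝ × Space) :
    monomialWeight a b p ≤ monomialWeight a' b' p :=
  mul_le_mul (Real.rpow_le_rpow_of_exponent_le (one_le_bracket _) ha)
    (Real.rpow_le_rpow_of_exponent_le (one_le_bracket _) hb)
    (Real.rpow_pos_of_pos (bracket_pos _) _).le (Real.rpow_pos_of_pos (bracket_pos _) _).le

/-- The weight `⟨τ⟩² + ⟨z⟩²`. -/
def quadWeight (p : ℝ × Space) : ℝ := bracket p.1 ^ 2 + bracket ‖p.2‖ ^ 2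

theorem quadWeight_pos (p : ℝ × Space) : 0 < quadWeight p := by
  have := bracket_pos p.1
  rw [quadWeight]
  positivity

section Bounds

variable {E F : Type*} [NormedAddCommGroup E] [NormedAddCommGroup F]

/-- The bound `f = O(m ⟨τ⟩^a ⟨z⟩^b)`. -/
def WeightBound (m : ℝ × Space → ℝ) (a b : ℝ) (f : ℝ × Space → E) : Prop :=
  ∃ C, 0 ≤ C ∧ ∀ p, ‖f p‖ ≤ C * (m p * monomialWeight a b p)

/-- The bound `f = O(⟨τ⟩^a ⟨z⟩^b / (⟨τ⟩² + ⟨z⟩²))`. -/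
def QuadBound (a b : ℝ) (f : ℝ × Space → E) : Prop :=
  ∃ C, 0 ≤ C ∧ ∀ p, ‖f p‖ ≤ C * (monomialWeight a b p * (quadWeight p)⁻¹)

variable {m : ℝ × Space → ℝ} {a b c d : ℝ} {f g : ℝ × Space → E}

theorem WeightBound.add (hf : WeightBound m a b f) (hg : WeightBound m a b g) :
    WeightBound m a b fun p => f p + g p := by
  obtain ⟨C, hC0, hC⟩ := hf
  obtain ⟨D, hD0, hD⟩ := hg
  exact ⟨C + D, by positivity, fun p => (norm_add_le _ _).trans (by linarith [hC p, hD p])⟩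

theorem WeightBound.sub (hf : WeightBound m a b f) (hg : WeightBound m a b g) :
    WeightBound m a b fun p => f p - g p := by
  obtain ⟨C, hC0, hC⟩ := hf
  obtain ⟨D, hD0, hD⟩ := hg
  exact ⟨C + D, by positivity, fun p => (norm_sub_le _ _).trans (by linarith [hC p, hD p])⟩

theorem WeightBound.of_norm_le {g : ℝ × Space → F} {D : ℝ} (hf : WeightBound m a b f)
    (hD : 0 ≤ D) (h : ∀ p, ‖g p‖ ≤ D * ‖f p‖) : WeightBound m a b g := by
  obtain ⟨C, hC0, hC⟩ := hf
  refine ⟨D * C, by positivity, fun p => (h p).trans ?_⟩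
  rw [mul_assoc]
  exact mul_le_mul_of_nonneg_left (hC p) hD

theorem WeightBound.mono [hm : LogFactor m] (hf : WeightBound m a b f) (ha : a ≤ c) (hb : b ≤ d) :
    WeightBound m c d f := by
  obtain ⟨C, hC0, hC⟩ := hf
  refine ⟨C, hC0, fun p => (hC p).trans ?_⟩
  have h1 : 0 ≤ m p := zero_le_one.trans (hm.one_le p)
  have h2 := monomialWeight_mono ha hb p
  gcongr

theorem WeightBound.weaken (hf : WeightBound 1 a b f) (m : ℝ × Space → ℝ) [hm : LogFactor m] :
    WeightBound m a b f := by
  obtain ⟨C, hC0, hC⟩ := hf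
  refine ⟨C, hC0, fun p => (hC p).trans ?_⟩
  have h2 := (monomialWeight_pos a b p).le
  have h3 := hm.one_le p
  simp only [Pi.one_apply]
  gcongr

theorem QuadBound.of_norm_le {g : ℝ × Space → F} {D : ℝ} (hf : QuadBound a b f)
    (hD : 0 ≤ D) (h : ∀ p, ‖g p‖ ≤ D * ‖f p‖) : QuadBound a b g := by
  obtain ⟨C, hC0, hC⟩ := hf
  refine ⟨D * C, by positivity, fun p => (h p).trans ?_⟩
  rw [mul_assoc]
  exact mul_le_mul_of_nonneg_left (hC p) hD

/-- Trades the denominator ⟨τ⟩² + ⟨z⟩² for a monomial, possibly absorbing a factor w such as the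
logarithm. Its instances put the two negative powers on ⟨τ⟩, on ⟨z⟩, or one on each. -/
theorem QuadBound.weight {s : ℝ} {C : ℝ} {w : ℝ × Space → ℝ} (hf : QuadBound a b f) (hC : 0 ≤ C)
    {g : ℝ × Space → F} (hg : ∀ p, ‖g p‖ ≤ w p * ‖f p‖) (hw : ∀ p, 0 ≤ w p)
    (h : ∀ p, w p ≤ C * (m p * (monomialWeight c s p * quadWeight p))) :
    WeightBound m (a + c) (b + s) g := by
  obtain ⟨D, hD0, hD⟩ := hf
  refine ⟨C * D, by positivity, fun p => (hg p).trans ?_⟩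
  have hQ := quadWeight_pos p
  have hM := monomialWeight_pos a b p
  calc w p * ‖f p‖ ≤ (C * (m p * (monomialWeight c s p * quadWeight p))) *
        (D * (monomialWeight a b p * (quadWeight p)⁻¹)) :=
        mul_le_mul (h p) (hD p) (norm_nonneg _) ((hw p).trans (h p))
    _ = C * D * (m p * (monomialWeight a b p * monomialWeight c s p)) *
        (quadWeight p * (quadWeight p)⁻¹) := by ring
    _ = _ := by rw [monomialWeight_mul, mul_inv_cancel₀ hQ.ne', mul_one]

theorem QuadBound.time (hf : QuadBound a b f) : WeightBound 1 (a - 2) b f := by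
  have := hf.weight (m := 1) (c := -2) (s := 0) (C := 1) (w := fun _ => 1) zero_le_one
    (fun p => by rw [one_mul]) (fun _ => zero_le_one) fun p => ?_
  · simpa [sub_eq_add_neg] using this
  · have hT := bracket_pos p.1
    have h1 : bracket p.1 ^ (-2 : ℝ) = (bracket p.1 ^ 2)⁻¹ := by
      rw [Real.rpow_neg hT.le]; norm_cast
    simp only [monomialWeight, Pi.one_apply, Real.rpow_zero, mul_one, one_mul, h1, quadWeight]
    rw [inv_mul_eq_div, le_div_iff₀ (by positivity)]
    nlinarith [sq_nonneg (bracket ‖p.2‖)]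

theorem QuadBound.space (hf : QuadBound a b f) : WeightBound 1 a (b - 2) f := by
  have := hf.weight (m := 1) (c := 0) (s := -2) (C := 1) (w := fun _ => 1) zero_le_one
    (fun p => by rw [one_mul]) (fun _ => zero_le_one) fun p => ?_
  · simpa [sub_eq_add_neg] using this
  · have hT := bracket_pos ‖p.2‖
    have h1 : bracket ‖p.2‖ ^ (-2 : ℝ) = (bracket ‖p.2‖ ^ 2)⁻¹ := by
      rw [Real.rpow_neg hT.le]; norm_cast
    simp only [monomialWeight, Pi.one_apply, Real.rpow_zero, one_mul, h1, quadWeight]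
    rw [inv_mul_eq_div, le_div_iff₀ (by positivity)]
    nlinarith [sq_nonneg (bracket p.1)]

theorem QuadBound.mixed (hf : QuadBound a b f) : WeightBound 1 (a - 1) (b - 1) f := by
  have := hf.weight (m := 1) (c := -1) (s := -1) (C := 1) (w := fun _ => 1) zero_le_one
    (fun p => by rw [one_mul]) (fun _ => zero_le_one) fun p => ?_
  · simpa [sub_eq_add_neg] using this
  · have hT := bracket_pos p.1
    have hZ := bracket_pos ‖p.2‖
    simp only [monomialWeight, Pi.one_apply, one_mul, Real.rpow_neg_one, quadWeight]
    rw [← mul_inv, inv_mul_eq_div, le_div_iff₀ (by positivity)]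
    nlinarith [sq_nonneg (bracket p.1 - bracket ‖p.2‖)]

/-- From log⟨z⟩ = log⟨τ⟩ + log(⟨z⟩/⟨τ⟩) and log r ≤ r: the logarithm in z becomes a power that ⟨τ⟩²
+ ⟨z⟩² can absorb, so that only log⟨τ⟩ survives. -/
theorem logWeight_le (p : ℝ × Space) :
    logWeight p ≤ 2 * Real.log (bracket p.1) + bracket ‖p.2‖ / bracket p.1 := by
  have hT := bracket_pos p.1
  have hZ := bracket_pos ‖p.2‖
  have h := Real.log_le_sub_one_of_pos (div_pos hZ hT)
  rw [Real.log_div hZ.ne' hT.ne'] at h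
  rw [logWeight_eq]
  linarith

theorem WeightBound.congr {f g : ℝ × Space → E} (hf : WeightBound m a b f)
    (h : ∀ p, g p = f p) : WeightBound m a b g := by
  rwa [funext h]

variable [NormedSpace ℝ E] [NormedSpace ℝ F]

theorem QuadBound.log_time {f : ℝ × Space → ℝ} (hf : QuadBound a b f) :
    WeightBound timeLog (a - 2) b fun p => logWeight p * f p := by
  have := hf.weight (m := timeLog) (c := -2) (s := 0) (C := 2) (w := logWeight) zero_le_two
    (g := fun p => logWeight p * f p)
    (fun p => by rw [norm_mul, Real.norm_of_nonneg (logWeight_nonneg p)])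
    (fun p => logWeight_nonneg p) fun p => ?_
  · simpa [sub_eq_add_neg] using this
  · have hT := bracket_pos p.1
    have hZ := bracket_pos ‖p.2‖
    have h1 : bracket p.1 ^ (-2 : ℝ) = (bracket p.1 ^ 2)⁻¹ := by
      rw [Real.rpow_neg hT.le]; norm_cast
    have hl := log_bracket_nonneg p.1
    refine (logWeight_le p).trans ?_
    simp only [monomialWeight, Real.rpow_zero, mul_one, h1, quadWeight, timeLog]
    have h2 : 1 ≤ (bracket p.1 ^ 2)⁻¹ * (bracket p.1 ^ 2 + bracket ‖p.2‖ ^ 2) := by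
      rw [inv_mul_eq_div, le_div_iff₀ (by positivity)]
      nlinarith [sq_nonneg (bracket ‖p.2‖)]
    have h3 : bracket ‖p.2‖ / bracket p.1 ≤
        (bracket p.1 ^ 2)⁻¹ * (bracket p.1 ^ 2 + bracket ‖p.2‖ ^ 2) := by
      rw [inv_mul_eq_div, div_le_div_iff₀ hT (by positivity)]
      nlinarith [mul_pos hT (mul_pos hT hT), mul_nonneg hT.le
        (sq_nonneg (bracket p.1 - bracket ‖p.2‖)), mul_pos hT (mul_pos hZ hT),
        mul_pos hT (mul_pos hZ hZ)]
    nlinarith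

theorem QuadBound.log_mixed {f : ℝ × Space → ℝ} (hf : QuadBound a b f) :
    WeightBound timeLog (a - 1) (b - 1) fun p => logWeight p * f p := by
  have := hf.weight (m := timeLog) (c := -1) (s := -1) (C := 2) (w := logWeight) zero_le_two
    (g := fun p => logWeight p * f p)
    (fun p => by rw [norm_mul, Real.norm_of_nonneg (logWeight_nonneg p)])
    (fun p => logWeight_nonneg p) fun p => ?_
  · simpa [sub_eq_add_neg] using this
  · have hT := bracket_pos p.1
    have hZ := bracket_pos ‖p.2‖
    have hl := log_bracket_nonneg p.1
    refine (logWeight_le p).trans ?_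
    simp only [monomialWeight, Real.rpow_neg_one, quadWeight, timeLog]
    have h2 : 1 ≤ (bracket p.1)⁻¹ * (bracket ‖p.2‖)⁻¹ *
        (bracket p.1 ^ 2 + bracket ‖p.2‖ ^ 2) := by
      rw [← mul_inv, inv_mul_eq_div, le_div_iff₀ (by positivity)]
      nlinarith [sq_nonneg (bracket p.1 - bracket ‖p.2‖)]
    have h3 : bracket ‖p.2‖ / bracket p.1 ≤ (bracket p.1)⁻¹ * (bracket ‖p.2‖)⁻¹ *
        (bracket p.1 ^ 2 + bracket ‖p.2‖ ^ 2) := by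
      rw [← mul_inv, inv_mul_eq_div, div_le_div_iff₀ hT (by positivity)]
      nlinarith [mul_pos hT (mul_pos hT hT)]
    nlinarith

theorem WeightBound.clm_apply {f : ℝ × Space → E →L[ℝ] F} {v : ℝ × Space → E}
    (hf : WeightBound 1 a b f) (hv : WeightBound 1 c d v) :
    WeightBound 1 (a + c) (b + d) fun p => f p (v p) := by
  obtain ⟨C, hC0, hC⟩ := hf
  obtain ⟨D, hD0, hD⟩ := hv
  refine ⟨C * D, by positivity, fun p => ((f p).le_opNorm (v p)).trans ?_⟩
  have hM := monomialWeight_pos a b p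
  calc _ ≤ (C * (1 * monomialWeight a b p)) * (D * (1 * monomialWeight c d p)) :=
        mul_le_mul (hC p) (hD p) (norm_nonneg _) (by positivity)
    _ = C * D * (1 * (monomialWeight a b p * monomialWeight c d p)) := by ring
    _ = _ := by rw [monomialWeight_mul]; rfl

theorem QuadBound.clm_apply {f : ℝ × Space → E →L[ℝ] F} {v : ℝ × Space → E}
    (hf : QuadBound a b f) (hv : WeightBound 1 c d v) :
    QuadBound (a + c) (b + d) fun p => f p (v p) := by
  obtain ⟨C, hC0, hC⟩ := hf
  obtain ⟨D, hD0, hD⟩ := hv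
  refine ⟨C * D, by positivity, fun p => ((f p).le_opNorm (v p)).trans ?_⟩
  have hM := monomialWeight_pos a b p
  have hQ := quadWeight_pos p
  calc _ ≤ (C * (monomialWeight a b p * (quadWeight p)⁻¹)) * (D * (1 * monomialWeight c d p)) :=
        mul_le_mul (hC p) (hD p) (norm_nonneg _) (by positivity)
    _ = C * D * ((monomialWeight a b p * monomialWeight c d p) * (quadWeight p)⁻¹) := by ring
    _ = _ := by rw [monomialWeight_mul]

theorem WeightBound.mul [hm : LogFactor m] {f g : ℝ × Space → ℝ} (hf : WeightBound 1 a b f)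
    (hg : WeightBound m c d g) : WeightBound m (a + c) (b + d) fun p => f p * g p := by
  obtain ⟨C, hC0, hC⟩ := hf
  obtain ⟨D, hD0, hD⟩ := hg
  refine ⟨C * D, by positivity, fun p => ?_⟩
  have hM := monomialWeight_pos a b p
  have h1 : 0 ≤ m p := zero_le_one.trans (hm.one_le p)
  rw [norm_mul]
  calc _ ≤ (C * (1 * monomialWeight a b p)) * (D * (m p * monomialWeight c d p)) :=
        mul_le_mul (hC p) (hD p) (norm_nonneg _) (by positivity)
    _ = C * D * (m p * (monomialWeight a b p * monomialWeight c d p)) := by ring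
    _ = _ := by rw [monomialWeight_mul]

theorem WeightBound.log_mul {f : ℝ × Space → ℝ} (hf : WeightBound 1 a b f) :
    WeightBound fullLog a b fun p => logWeight p * f p := by
  obtain ⟨C, hC0, hC⟩ := hf
  refine ⟨C, by positivity, fun p => ?_⟩
  have hM := monomialWeight_pos a b p
  have hL := logWeight_nonneg p
  rw [norm_mul, Real.norm_of_nonneg hL]
  calc _ ≤ fullLog p * (C * (1 * monomialWeight a b p)) :=
        mul_le_mul (by rw [fullLog]; linarith) (hC p) (norm_nonneg _) (by rw [fullLog]; linarith)
    _ = _ := by ring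

/-- Absorbs log⟨z⟩ into ⟨z⟩^δ, for terms with spare decay in z. -/
theorem WeightBound.timeLog_mul {f : ℝ × Space → ℝ} (hf : WeightBound 1 a b f) {δ : ℝ}
    (hδ : 0 < δ) : WeightBound timeLog a (b + δ) fun p => logWeight p * f p := by
  obtain ⟨C, hC0, hC⟩ := hf
  refine ⟨(1 + δ⁻¹) * C, by positivity, fun p => ?_⟩
  have hM := monomialWeight_pos a b p
  have hL := logWeight_nonneg p
  have hZ := one_le_bracket ‖p.2‖
  have h1 := Real.log_le_rpow_div (bracket_pos ‖p.2‖).le hδ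
  have h2 : 1 ≤ bracket ‖p.2‖ ^ δ := Real.one_le_rpow hZ hδ.le
  have h3 := log_bracket_nonneg p.1
  have h4 := log_bracket_nonneg ‖p.2‖
  have hb : logWeight p ≤ (1 + δ⁻¹) * (timeLog p * monomialWeight 0 δ p) := by
    rw [logWeight_eq, timeLog, monomialWeight, Real.rpow_zero, one_mul]
    rw [div_eq_mul_inv] at h1
    have h5 : Real.log (bracket p.1) + Real.log (bracket ‖p.2‖) ≤
        (1 + Real.log (bracket p.1)) * (1 + Real.log (bracket ‖p.2‖)) := by nlinarith
    refine h5.trans ?_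
    have h6 : 1 + Real.log (bracket ‖p.2‖) ≤ (1 + δ⁻¹) * bracket ‖p.2‖ ^ δ := by linarith
    calc _ ≤ (1 + Real.log (bracket p.1)) * ((1 + δ⁻¹) * bracket ‖p.2‖ ^ δ) := by gcongr
      _ = _ := by ring
  rw [norm_mul, Real.norm_of_nonneg hL]
  calc _ ≤ ((1 + δ⁻¹) * (timeLog p * monomialWeight 0 δ p)) * (C * (1 * monomialWeight a b p)) :=
        mul_le_mul hb (hC p) (norm_nonneg _) (hL.trans hb)
    _ = (1 + δ⁻¹) * C * (timeLog p * (monomialWeight 0 δ p * monomialWeight a b p)) := by ring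
    _ = _ := by rw [monomialWeight_mul, zero_add, add_comm δ]

end Bounds

/-! ### Elementary functions -/

theorem weightBound_time : WeightBound 1 1 0 fun p : ℝ × Space => bracket p.1 :=
  ⟨1, zero_le_one, fun p => by simp [monomialWeight, abs_of_pos (bracket_pos p.1)]⟩

theorem weightBound_time_inv : WeightBound 1 (-1) 0 fun p : ℝ × Space => (bracket p.1)⁻¹ :=
  ⟨1, zero_le_one, fun p => by
    simp [monomialWeight, abs_of_pos (bracket_pos p.1), Real.rpow_neg_one]⟩

theorem weightBound_space : WeightBound 1 0 1 fun p : ℝ × Space => bracket ‖p.2‖ :=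
  ⟨1, zero_le_one, fun p => by simp [monomialWeight, abs_of_pos (bracket_pos ‖p.2‖)]⟩

theorem weightBound_space_inv : WeightBound 1 0 (-1) fun p : ℝ × Space => (bracket ‖p.2‖)⁻¹ :=
  ⟨1, zero_le_one, fun p => by
    simp [monomialWeight, abs_of_pos (bracket_pos ‖p.2‖), Real.rpow_neg_one]⟩

theorem weightBound_fst : WeightBound 1 1 0 fun p : ℝ × Space => p.1 :=
  ⟨1, zero_le_one, fun p => by simpa [monomialWeight] using abs_le_bracket p.1⟩

theorem abs_coord_le (p : ℝ × Space) (i : Fin 3) : |p.2 i| ≤ bracket ‖p.2‖ :=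
  (PiLp.norm_apply_le p.2 i).trans ((le_abs_self _).trans (abs_le_bracket _))

theorem weightBound_coord (i : Fin 3) : WeightBound 1 0 1 fun p : ℝ × Space => p.2 i :=
  ⟨1, zero_le_one, fun p => by simpa [monomialWeight] using abs_coord_le p i⟩

theorem weightBound_const {E : Type*} [NormedAddCommGroup E] (c : E) :
    WeightBound 1 0 0 fun _ : ℝ × Space => c :=
  ⟨‖c‖, norm_nonneg _, fun p => by simp [monomialWeight]⟩

theorem weightBound_fderiv_chart (i : Fin 3) :
    WeightBound 1 1 0 fun p => fderiv ℝ chart p (coordVec i.succ) :=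
  ⟨2, zero_le_two, fun p => by simpa [monomialWeight] using norm_fderiv_chart_space_le p i⟩

end

noncomputable section

open Filter Topology Set

/-! ### Bounds of the potential in the coordinates `(τ, z)` -/

/-- Compare ⟨τ⟩²⟨z⟩² = 1 + τ² + |z|² + τ²|z|² with |x|² = τ² + |z|² + 2τ²|z|². -/
theorem brackets_mul_le (p : ℝ × Space) :
    bracket p.1 * bracket ‖p.2‖ ≤ 1 + ‖chart p‖ := by
  have h1 := bracket_sq p.1
  have h2 := bracket_sq ‖p.2‖
  have h3 : ‖chart p‖ ^ 2 = (p.1 * bracket ‖p.2‖) ^ 2 + (bracket p.1 * ‖p.2‖) ^ 2 := by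
    rw [chart, norm_event_sq, norm_smul, Real.norm_eq_abs, abs_of_pos (bracket_pos _)]
  refine (sq_le_sq₀ (mul_pos (bracket_pos _) (bracket_pos _)).le (by positivity)).1 ?_
  rw [mul_pow, h1, h2]
  rw [mul_pow, mul_pow, h1, h2] at h3
  nlinarith [norm_nonneg (chart p)]

/-- Since x² = τ² - |z|² = ⟨τ⟩² - ⟨z⟩², the product of | |x⁰| - |𝐱| | and |x⁰| + |𝐱| is |⟨τ⟩² -
⟨z⟩²|. Then use a² + b² ≤ 2ab + |a² - b²| for positive a, b, and bound 2⟨τ⟩⟨z⟩ by 2(1 + |x|). -/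
theorem quadWeight_le (p : ℝ × Space) :
    quadWeight p ≤ 2 * ((1 + ‖chart p‖) * coneDist (chart p)) := by
  have hR := brackets_mul_le p
  have h1 := bracket_sq p.1
  have h2 := bracket_sq ‖p.2‖
  have hT := bracket_pos p.1
  have hZ := bracket_pos ‖p.2‖
  set q := |chart p 0| with hq
  set r := ‖spacePart (chart p)‖ with hr
  have hq2 : q ^ 2 = p.1 ^ 2 * bracket ‖p.2‖ ^ 2 := by
    rw [hq, sq_abs, chart, event_zero, mul_pow]
  have hr2 : r ^ 2 = bracket p.1 ^ 2 * ‖p.2‖ ^ 2 := by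
    rw [hr, chart, spacePart_event, norm_smul, Real.norm_eq_abs, abs_of_pos hT, mul_pow]
  have hq0 : 0 ≤ q := abs_nonneg _
  have hr0 : 0 ≤ r := norm_nonneg _
  have hqn : q ≤ ‖chart p‖ := abs_time_le_norm _
  have hrn : r ≤ ‖chart p‖ := norm_spacePart_le _
  have hd : |q - r| * (q + r) = |bracket p.1 ^ 2 - bracket ‖p.2‖ ^ 2| := by
    rw [← abs_of_nonneg (add_nonneg hq0 hr0), ← abs_mul]
    congr 1
    linear_combination hq2 - hr2 - bracket ‖p.2‖ ^ 2 * h1 + bracket p.1 ^ 2 * h2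
  have hcd : coneDist (chart p) = 1 + |q - r| := rfl
  rw [hcd, quadWeight]
  have h3 : |q - r| * (q + r) ≤ 2 * ‖chart p‖ * |q - r| := by
    nlinarith [abs_nonneg (q - r)]
  have h4 : bracket p.1 ^ 2 + bracket ‖p.2‖ ^ 2 ≤
      2 * (bracket p.1 * bracket ‖p.2‖) + |bracket p.1 ^ 2 - bracket ‖p.2‖ ^ 2| := by
    rcases le_total (bracket p.1) (bracket ‖p.2‖) with h | h
    · have := neg_abs_le (bracket p.1 ^ 2 - bracket ‖p.2‖ ^ 2)
      nlinarith
    · have := le_abs_self (bracket p.1 ^ 2 - bracket ‖p.2‖ ^ 2)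
      nlinarith
  nlinarith [abs_nonneg (q - r)]

section Pull

variable {F : Type*} [NormedAddCommGroup F] {f : Spacetime → F} {ε : ℝ}

theorem mul_rpow_brackets (s : ℝ) (p : ℝ × Space) :
    (bracket p.1 * bracket ‖p.2‖) ^ s = monomialWeight s s p :=
  Real.mul_rpow (bracket_pos _).le (bracket_pos _).le

theorem BoundedBy.exists_nonneg {w : Spacetime → ℝ} (hf : BoundedBy f w) (hw : ∀ x, 0 ≤ w x) :
    ∃ K, 0 ≤ K ∧ ∀ x, ‖f x‖ ≤ K * w x := by
  obtain ⟨K, hK⟩ := hf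
  exact ⟨|K|, abs_nonneg K, fun x => (hK x).trans
    (mul_le_mul_of_nonneg_right (le_abs_self K) (hw x))⟩

theorem BoundedBy.weightBound_rpow {s : ℝ} (hs : 0 ≤ s)
    (hf : BoundedBy f fun x => (1 + ‖x‖) ^ (-s)) :
    WeightBound 1 (-s) (-s) fun p => f (chart p) := by
  obtain ⟨K, hK0, hK⟩ := hf.exists_nonneg fun x => by positivity
  refine ⟨K, hK0, fun p => (hK _).trans ?_⟩
  rw [Pi.one_apply, one_mul, ← mul_rpow_brackets]
  exact mul_le_mul_of_nonneg_left (Real.rpow_le_rpow_of_nonpos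
    (mul_pos (bracket_pos _) (bracket_pos _)) (brackets_mul_le p) (by linarith)) hK0

theorem BoundedBy.weightBound_inv (hf : BoundedBy f fun x => (1 + ‖x‖)⁻¹) :
    WeightBound 1 (-1) (-1) fun p => f (chart p) := by
  refine BoundedBy.weightBound_rpow zero_le_one ?_
  simpa only [Real.rpow_neg_one] using hf

theorem BoundedBy.quadBound (hf : BoundedBy f fun x => (1 + ‖x‖)⁻¹ * (coneDist x)⁻¹) :
    QuadBound 0 0 fun p => f (chart p) := by
  have hc : ∀ x, 0 < coneDist x := fun x => zero_lt_one.trans_le (one_le_coneDist x)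
  obtain ⟨K, hK0, hK⟩ := hf.exists_nonneg fun x => by have := hc x; positivity
  refine ⟨2 * K, by positivity, fun p => (hK _).trans ?_⟩
  have h1 := quadWeight_le p
  have h2 := quadWeight_pos p
  have h3 := hc (chart p)
  rw [monomialWeight, Real.rpow_zero, Real.rpow_zero, one_mul, one_mul, ← mul_inv,
    mul_comm 2 K, mul_assoc]
  gcongr
  rw [← div_eq_mul_inv, le_div_iff₀ h2, inv_mul_le_iff₀ (by positivity)]
  linarith

theorem rpow_quadWeight_le (hε : 0 ≤ ε) (p : ℝ × Space) :
    quadWeight p ^ (-ε) ≤ monomialWeight (-2 * ε) 0 p ∧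
      quadWeight p ^ (-ε) ≤ monomialWeight 0 (-2 * ε) p := by
  have hT := bracket_pos p.1
  have hZ := bracket_pos ‖p.2‖
  have h : ∀ b : ℝ, 0 < b → (b ^ 2) ^ (-ε) = b ^ (-2 * ε) := fun b hb => by
    rw [← Real.rpow_natCast, ← Real.rpow_mul hb.le]
    congr 1
    push_cast
    ring
  rw [monomialWeight, monomialWeight, Real.rpow_zero, Real.rpow_zero, mul_one, one_mul,
    ← h _ hT, ← h _ hZ]
  exact ⟨Real.rpow_le_rpow_of_nonpos (by positivity) (by rw [quadWeight]; nlinarith)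
      (by linarith),
    Real.rpow_le_rpow_of_nonpos (by positivity) (by rw [quadWeight]; nlinarith) (by linarith)⟩

/-- With d the distance weight, (1 + |x|)⁻¹ d^(-ε) = (1 + |x|)^(ε-1) ((1 + |x|)d)^(-ε), and each
factor has a bound in the coordinates. The last one can be spent on ⟨τ⟩ or on ⟨z⟩. -/
theorem BoundedBy.exists_coneDist_rpow (hε : 0 ≤ ε) (hε1 : ε ≤ 1)
    (hf : BoundedBy f fun x => (1 + ‖x‖)⁻¹ * coneDist x ^ (-ε)) :
    ∃ C, 0 ≤ C ∧ ∀ p, ‖f (chart p)‖ ≤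
      C * (monomialWeight (ε - 1) (ε - 1) p * quadWeight p ^ (-ε)) := by
  have hc : ∀ x, 0 < coneDist x := fun x => zero_lt_one.trans_le (one_le_coneDist x)
  obtain ⟨K, hK0, hK⟩ := hf.exists_nonneg fun x => by have := hc x; positivity
  refine ⟨K * (1 / 2) ^ (-ε), by positivity, fun p => (hK _).trans ?_⟩
  have h2 := quadWeight_pos p
  have h3 := hc (chart p)
  have hR : 0 < 1 + ‖chart p‖ := by positivity
  have h4 : (1 + ‖chart p‖)⁻¹ * coneDist (chart p) ^ (-ε) =
      (1 + ‖chart p‖) ^ (ε - 1) * ((1 + ‖chart p‖) * coneDist (chart p)) ^ (-ε) := by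
    rw [Real.mul_rpow hR.le h3.le, ← mul_assoc, ← Real.rpow_add hR, ← Real.rpow_neg_one]
    congr 2
    ring
  have h5 : (1 + ‖chart p‖) ^ (ε - 1) ≤ monomialWeight (ε - 1) (ε - 1) p := by
    rw [← mul_rpow_brackets]
    exact Real.rpow_le_rpow_of_nonpos (mul_pos (bracket_pos _) (bracket_pos _))
      (brackets_mul_le p) (by linarith)
  have h6 : ((1 + ‖chart p‖) * coneDist (chart p)) ^ (-ε) ≤
      (1 / 2) ^ (-ε) * quadWeight p ^ (-ε) := by
    rw [← Real.mul_rpow (by norm_num) h2.le]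
    exact Real.rpow_le_rpow_of_nonpos (by positivity) (by linarith [quadWeight_le p]) (by linarith)
  rw [h4, mul_assoc]
  refine mul_le_mul_of_nonneg_left ?_ hK0
  have h7 := (monomialWeight_pos (ε - 1) (ε - 1) p).le
  calc _ ≤ monomialWeight (ε - 1) (ε - 1) p * ((1 / 2) ^ (-ε) * quadWeight p ^ (-ε)) := by gcongr
    _ = _ := by ring

theorem BoundedBy.weightBound_coneDist_time (hε : 0 ≤ ε) (hε1 : ε ≤ 1)
    (hf : BoundedBy f fun x => (1 + ‖x‖)⁻¹ * coneDist x ^ (-ε)) :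
    WeightBound 1 (-1 - ε) (-1 + ε) fun p => f (chart p) := by
  obtain ⟨C, hC0, hC⟩ := hf.exists_coneDist_rpow hε hε1
  refine ⟨C, hC0, fun p => (hC p).trans ?_⟩
  refine mul_le_mul_of_nonneg_left ?_ hC0
  refine (mul_le_mul_of_nonneg_left (rpow_quadWeight_le hε p).1
    (monomialWeight_pos _ _ p).le).trans (le_of_eq ?_)
  rw [monomialWeight_mul, Pi.one_apply, one_mul]
  congr 1 <;> ring

theorem BoundedBy.weightBound_coneDist_space (hε : 0 ≤ ε) (hε1 : ε ≤ 1)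
    (hf : BoundedBy f fun x => (1 + ‖x‖)⁻¹ * coneDist x ^ (-ε)) :
    WeightBound 1 (-1 + ε) (-1 - ε) fun p => f (chart p) := by
  obtain ⟨C, hC0, hC⟩ := hf.exists_coneDist_rpow hε hε1
  refine ⟨C, hC0, fun p => (hC p).trans ?_⟩
  refine mul_le_mul_of_nonneg_left ?_ hC0
  refine (mul_le_mul_of_nonneg_left (rpow_quadWeight_le hε p).2
    (monomialWeight_pos _ _ p).le).trans (le_of_eq ?_)
  rw [monomialWeight_mul, Pi.one_apply, one_mul]
  congr 1 <;> ring

theorem BoundedBy.weightBound_coneDist (hε : 0 ≤ ε)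
    (hf : BoundedBy f fun x => (1 + ‖x‖)⁻¹ * coneDist x ^ (-ε)) :
    WeightBound 1 (-1) (-1) fun p => f (chart p) := by
  have hc : ∀ x, 0 < coneDist x := fun x => zero_lt_one.trans_le (one_le_coneDist x)
  obtain ⟨K, hK0, hK⟩ := hf.exists_nonneg fun x => by have := hc x; positivity
  refine BoundedBy.weightBound_inv ⟨K, fun x => (hK x).trans ?_⟩
  refine mul_le_mul_of_nonneg_left (mul_le_of_le_one_right (by positivity) ?_) hK0
  exact Real.rpow_le_one_of_one_le_of_nonpos (one_le_coneDist x) (by linarith)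

end Pull

end

noncomputable section

open Filter Topology Set

/-! ### Bounds of the components and their derivatives -/

theorem abs_metricSign (a : Fin 4) : |metricSign a| = 1 := by
  unfold metricSign
  split_ifs <;> simp

section Components

variable {ε : ℝ} {V : Spacetime → Spacetime}

theorem hasFDerivAt_covariant (hV : ContDiff ℝ 3 V) (a : Fin 4) (x : Spacetime) :
    HasFDerivAt (fun y => covariant V y a)
      (metricSign a • ((EuclideanSpace.proj a : Spacetime →L[ℝ] ℝ).comp (fderiv ℝ V x))) x :=
  ((EuclideanSpace.proj a : Spacetime →L[ℝ] ℝ).hasFDerivAt.comp x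
    (hV.differentiable (by norm_num) x).hasFDerivAt).const_mul _

theorem contDiff_fderiv_radialComponent (hV : ContDiff ℝ 3 V) :
    ContDiff ℝ 2 (fderiv ℝ (radialComponent V)) :=
  (contDiff_radialComponent hV).fderiv_right (by norm_num)

theorem hasFDerivAt_nabla_radialComponent (hV : ContDiff ℝ 3 V) (a : Fin 4) (x : Spacetime) :
    HasFDerivAt (nabla a (radialComponent V))
      ((ContinuousLinearMap.apply ℝ ℝ (EuclideanSpace.single a 1)).comp
        (fderiv ℝ (fderiv ℝ (radialComponent V)) x)) x := by
  have h := (ContinuousLinearMap.apply ℝ ℝ (EuclideanSpace.single a 1 : Spacetime)).hasFDerivAt.comp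
    x ((contDiff_fderiv_radialComponent hV).differentiable (by norm_num) x).hasFDerivAt
  exact h

theorem fderiv_pulledComponent (hV : ContDiff ℝ 3 V) (a : Fin 4) (p w : ℝ × Space) :
    fderiv ℝ (pulledComponent V a) p w =
      metricSign a * fderiv ℝ V (chart p) (fderiv ℝ chart p w) a := by
  have h : Differentiable ℝ fun y => covariant V y a := fun x =>
    (hasFDerivAt_covariant hV a x).differentiableAt
  have := fderiv_comp_chart_apply h p w
  rw [(hasFDerivAt_covariant hV a (chart p)).fderiv] at this
  exact this

theorem fderiv_pulledGradient (hV : ContDiff ℝ 3 V) (a : Fin 4) (p w : ℝ × Space) :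
    fderiv ℝ (pulledGradient V a) p w =
      fderiv ℝ (fderiv ℝ (radialComponent V)) (chart p) (fderiv ℝ chart p w)
        (EuclideanSpace.single a 1) := by
  have h : Differentiable ℝ (nabla a (radialComponent V)) := fun x =>
    (hasFDerivAt_nabla_radialComponent hV a x).differentiableAt
  have := fderiv_comp_chart_apply h p w
  rw [(hasFDerivAt_nabla_radialComponent hV a (chart p)).fderiv] at this
  exact this

theorem differentiable_comp_chart {f : Spacetime → ℝ} (hf : Differentiable ℝ f) :
    Differentiable ℝ fun p => f (chart p) :=
  hf.comp ((contDiff_chart (n := 1)).differentiable one_ne_zero)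

theorem differentiable_pulledComponent (hV : ContDiff ℝ 3 V) (a : Fin 4) :
    Differentiable ℝ (pulledComponent V a) :=
  differentiable_comp_chart fun x => (hasFDerivAt_covariant hV a x).differentiableAt

theorem differentiable_pulledGradient (hV : ContDiff ℝ 3 V) (a : Fin 4) :
    Differentiable ℝ (pulledGradient V a) :=
  differentiable_comp_chart fun x => (hasFDerivAt_nabla_radialComponent hV a x).differentiableAt

theorem differentiable_radialComponent (hV : ContDiff ℝ 3 V) :
    Differentiable ℝ (radialComponent V) :=
  (contDiff_radialComponent hV).differentiable (by norm_num)

theorem differentiable_radialDerivative (hV : ContDiff ℝ 3 V) :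
    Differentiable ℝ (radialDerivative V) :=
  (contDiff_radialDerivative hV).differentiable (by norm_num)

/-- Commutation of a derivative with the radial derivative. -/
theorem fderiv_fderiv_radialComponent_self (hV : ContDiff ℝ 3 V) (x b : Spacetime) :
    fderiv ℝ (fderiv ℝ (radialComponent V)) x x b =
      fderiv ℝ (radialDerivative V) x b - fderiv ℝ (radialComponent V) x b := by
  have h1 := ((contDiff_fderiv_radialComponent hV).differentiable (by norm_num) x).hasFDerivAt
  have h2 : HasFDerivAt (radialDerivative V) _ x := h1.clm_apply (hasFDerivAt_id x)
  have hs : IsSymmSndFDerivAt ℝ (radialComponent V) x :=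
    ((contDiff_radialComponent hV).of_le (by norm_num : (2 : WithTop ℕ∞) ≤ 3)
      ).contDiffAt.isSymmSndFDerivAt (by simp)
  rw [h2.fderiv]
  simp only [add_apply, ContinuousLinearMap.comp_apply, ContinuousLinearMap.flip_apply,
    ContinuousLinearMap.id_apply, hs.eq x b]
  ring

theorem norm_covariant_le (a : Fin 4) (v : Spacetime) : ‖metricSign a * v a‖ ≤ 1 * ‖v‖ := by
  rw [norm_mul, Real.norm_eq_abs, abs_metricSign, one_mul, one_mul]
  exact PiLp.norm_apply_le v a

theorem norm_apply_single_le (f : Spacetime →L[ℝ] ℝ) (a : Fin 4) :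
    ‖f (EuclideanSpace.single a 1)‖ ≤ 1 * ‖f‖ := by
  have h := f.le_opNorm (EuclideanSpace.single a 1)
  rwa [PiLp.norm_single, norm_one, mul_comm] at h

namespace PotentialBounds

theorem weightBound_component (hV : PotentialBounds ε V) (a : Fin 4) :
    WeightBound 1 (-1) (-1) (pulledComponent V a) :=
  hV.self.weightBound_inv.of_norm_le zero_le_one fun _ => norm_covariant_le a _

theorem weightBound_radialComponent (hV : PotentialBounds ε V) :
    WeightBound 1 0 0 fun p => radialComponent V (chart p) := by
  obtain ⟨K, hK0, hK⟩ := hV.self.exists_nonneg fun x => by positivity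
  refine ⟨K, hK0, fun p => (abs_mink_le _ _).trans ?_⟩
  simp only [monomialWeight, Real.rpow_zero, Pi.one_apply, mul_one]
  calc _ ≤ ‖chart p‖ * (K * (1 + ‖chart p‖)⁻¹) := by gcongr; exact hK _
    _ = K * (‖chart p‖ / (1 + ‖chart p‖)) := by ring
    _ ≤ K * 1 := by
      gcongr
      rw [div_le_one (by positivity)]
      linarith
    _ = K := mul_one K

theorem weightBound_gradient (hV : PotentialBounds ε V) (a : Fin 4) :
    WeightBound 1 (-1) (-1) (pulledGradient V a) :=
  hV.radial_deriv.weightBound_inv.of_norm_le zero_le_one fun _ => norm_apply_single_le _ a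

theorem weightBound_radialDerivative (hV : PotentialBounds ε V) (hε : 0 < ε) :
    WeightBound 1 (-ε) (-ε) fun p => radialDerivative V (chart p) :=
  hV.radialDeriv.weightBound_rpow hε.le

theorem quadBound_fderiv_component (hV : PotentialBounds ε V) (a : Fin 4) (i : Fin 3) :
    QuadBound 1 0 fun p => fderiv ℝ (pulledComponent V a) p (coordVec i.succ) := by
  have h := hV.deriv.quadBound.clm_apply (weightBound_fderiv_chart i)
  rw [zero_add, zero_add] at h
  refine h.of_norm_le zero_le_one fun p => ?_
  rw [fderiv_pulledComponent hV.contDiff]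
  exact norm_covariant_le a _

theorem quadBound_fderiv_gradient (hV : PotentialBounds ε V) (a : Fin 4) (i : Fin 3) :
    QuadBound 1 0 fun p => fderiv ℝ (pulledGradient V a) p (coordVec i.succ) := by
  have h := hV.radial_deriv_two.quadBound.clm_apply (weightBound_fderiv_chart i)
  rw [zero_add, zero_add] at h
  refine h.of_norm_le zero_le_one fun p => ?_
  rw [fderiv_pulledGradient hV.contDiff]
  exact norm_apply_single_le _ a

theorem weightBound_fderiv_radialComponent (hV : PotentialBounds ε V) (i : Fin 3) :
    WeightBound 1 0 (-1)
      fun p => fderiv ℝ (fun q => radialComponent V (chart q)) p (coordVec i.succ) :=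
  ((hV.radial_deriv.weightBound_inv.clm_apply (weightBound_fderiv_chart i)).mono
    (by norm_num) (by norm_num)).congr fun p =>
      fderiv_comp_chart_apply (differentiable_radialComponent hV.contDiff) p _

theorem weightBound_fderiv_radialDerivative (hV : PotentialBounds ε V) (hε : 0 < ε) (i : Fin 3) :
    WeightBound 1 0 (-1)
      fun p => fderiv ℝ (fun q => radialDerivative V (chart q)) p (coordVec i.succ) :=
  (((hV.radialDeriv_deriv.weightBound_coneDist hε.le).clm_apply (weightBound_fderiv_chart i)).mono
    (by norm_num) (by norm_num)).congr fun p =>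
      fderiv_comp_chart_apply (differentiable_radialDerivative hV.contDiff) p _

theorem weightBound_fderiv_radialDerivative' (hV : PotentialBounds ε V) (hε : 0 < ε)
    (hε1 : ε ≤ 1) (i : Fin 3) : WeightBound 1 (-ε) (-1 + ε)
      fun p => fderiv ℝ (fun q => radialDerivative V (chart q)) p (coordVec i.succ) :=
  (((hV.radialDeriv_deriv.weightBound_coneDist_time hε.le hε1).clm_apply
    (weightBound_fderiv_chart i)).mono (by linarith) (by linarith)).congr fun p =>
      fderiv_comp_chart_apply (differentiable_radialDerivative hV.contDiff) p _

theorem fderiv_comp_chart_radial {f : Spacetime → ℝ} (hf : Differentiable ℝ f) (p : ℝ × Space) :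
    fderiv ℝ (fun q => f (chart q)) p (0, p.2) = fderiv ℝ f (chart p) (chart p) -
      p.1 * (bracket ‖p.2‖)⁻¹ * fderiv ℝ f (chart p) timeDir := by
  rw [fderiv_comp_chart_apply hf, fderiv_chart_radial, map_sub, map_smul, smul_eq_mul,
    div_eq_mul_inv]

theorem weightBound_slope : WeightBound 1 1 (-1) fun p : ℝ × Space => p.1 * (bracket ‖p.2‖)⁻¹ :=
  (weightBound_fst.mul weightBound_space_inv).mono (by norm_num) (by norm_num)

/-- Along z·∂_z nothing is lost: the part (x·∇)V is as small as V, and the time derivative carries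
⟨τ⟩⟨z⟩⁻¹ against ⟨τ⟩⁻². -/
theorem weightBound_radial_component (hV : PotentialBounds ε V) (a : Fin 4) :
    WeightBound 1 (-1) (-1) fun p => fderiv ℝ (pulledComponent V a) p (0, p.2) := by
  have h1 : WeightBound 1 (-1) (-1) fun p =>
      metricSign a * (fderiv ℝ V (chart p) (chart p)) a :=
    hV.deriv_self.weightBound_inv.of_norm_le zero_le_one fun _ => norm_covariant_le a _
  have h2 : WeightBound 1 (-2) 0 fun p => metricSign a * (fderiv ℝ V (chart p) timeDir) a := by
    refine WeightBound.of_norm_le (D := 1) ?_ zero_le_one fun _ => norm_covariant_le a _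
    exact (hV.deriv.quadBound.clm_apply (weightBound_const timeDir)).time.mono
      (by norm_num) (by norm_num)
  refine (h1.sub ((weightBound_slope.mul h2).mono (by norm_num) (by norm_num))).congr fun p => ?_
  rw [fderiv_pulledComponent hV.contDiff, fderiv_chart_radial, map_sub, map_smul,
    PiLp.sub_apply, PiLp.smul_apply, smul_eq_mul]
  ring

theorem quadBound_time_time (hV : PotentialBounds ε V) : QuadBound 0 0 fun p =>
    fderiv ℝ (fderiv ℝ (radialComponent V)) (chart p) timeDir timeDir := by
  have h := (hV.radial_deriv_two.quadBound.clm_apply (weightBound_const timeDir)).clm_apply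
    (weightBound_const timeDir)
  simpa only [add_zero] using h

/-- Commuting ∂_0 with x·∇ trades a second derivative of x·A for a first derivative of (x·∇)(x·A),
which has the better decay. -/
theorem fderiv_gradient_radial (hV : PotentialBounds ε V) (p : ℝ × Space) :
    fderiv ℝ (pulledGradient V 0) p (0, p.2) =
      fderiv ℝ (radialDerivative V) (chart p) timeDir - pulledGradient V 0 p -
        p.1 * (bracket ‖p.2‖)⁻¹ *
          fderiv ℝ (fderiv ℝ (radialComponent V)) (chart p) timeDir timeDir := by
  rw [fderiv_pulledGradient hV.contDiff, fderiv_chart_radial, map_sub, map_smul, sub_apply,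
    smul_apply, fderiv_fderiv_radialComponent_self hV.contDiff]
  simp only [smul_eq_mul, div_eq_mul_inv]
  rfl

theorem weightBound_time_radialDerivative (hV : PotentialBounds ε V) (hε : 0 < ε) :
    WeightBound 1 (-1) (-1) fun p => fderiv ℝ (radialDerivative V) (chart p) timeDir :=
  ((hV.radialDeriv_deriv.weightBound_coneDist hε.le).clm_apply (weightBound_const timeDir)).mono
    (by norm_num) (by norm_num)

theorem weightBound_time_radialDerivative_time (hV : PotentialBounds ε V) (hε : 0 < ε)
    (hε1 : ε ≤ 1) :
    WeightBound 1 (-1 - ε) (-1 + ε) fun p => fderiv ℝ (radialDerivative V) (chart p) timeDir :=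
  ((hV.radialDeriv_deriv.weightBound_coneDist_time hε.le hε1).clm_apply
    (weightBound_const timeDir)).mono (by norm_num) (by norm_num)

theorem weightBound_time_radialDerivative_space (hV : PotentialBounds ε V) (hε : 0 < ε)
    (hε1 : ε ≤ 1) :
    WeightBound 1 (-1 + ε) (-1 - ε) fun p => fderiv ℝ (radialDerivative V) (chart p) timeDir :=
  ((hV.radialDeriv_deriv.weightBound_coneDist_space hε.le hε1).clm_apply
    (weightBound_const timeDir)).mono (by norm_num) (by norm_num)

theorem weightBound_radial_gradient (hV : PotentialBounds ε V) (hε : 0 < ε) :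
    WeightBound 1 (-1) (-1) fun p => fderiv ℝ (pulledGradient V 0) p (0, p.2) :=
  (((hV.weightBound_time_radialDerivative hε).sub (hV.weightBound_gradient 0)).sub
    ((weightBound_slope.mul hV.quadBound_time_time.time).mono (by norm_num) (by norm_num))).congr
    hV.fderiv_gradient_radial

theorem weightBound_radial_radialComponent (hV : PotentialBounds ε V) (hε : 0 < ε) :
    WeightBound 1 0 0 fun p => fderiv ℝ (fun q => radialComponent V (chart q)) p (0, p.2) :=
  (((hV.weightBound_radialDerivative hε).mono (by linarith) (by linarith)).sub
    ((weightBound_slope.mul (hV.weightBound_gradient 0)).mono (by norm_num) (by norm_num))).congr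
    fun p => fderiv_comp_chart_radial (differentiable_radialComponent hV.contDiff) p

/-- The bound of the time derivative that favours ⟨τ⟩ is the right one here: multiplied by τ/⟨z⟩ it
leaves exactly ⟨τ⟩^(-ε). -/
theorem weightBound_radial_radialDerivative (hV : PotentialBounds ε V) (hε : 0 < ε)
    (hε1 : ε < 1 / 2) : WeightBound 1 (-ε) (-ε)
      fun p => fderiv ℝ (fun q => radialDerivative V (chart q)) p (0, p.2) :=
  ((hV.radialDeriv_deriv_self.weightBound_rpow hε.le).sub
    ((weightBound_slope.mul (hV.weightBound_time_radialDerivative_time hε (by linarith))).mono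
      (by linarith) (by linarith))).congr
    fun p => fderiv_comp_chart_radial (differentiable_radialDerivative hV.contDiff) p

end PotentialBounds

end Components

end

noncomputable section

open Filter Topology Set

/-! ### Spatial derivatives of the special gauge potential -/

section LineDerivatives

variable {E : Type*} [NormedAddCommGroup E] [NormedSpace ℝ E] {f g : E → ℝ} {f' g' : ℝ} {p w : E}

theorem HasLineDerivAt.fun_mul (hf : HasLineDerivAt ℝ f f' p w) (hg : HasLineDerivAt ℝ g g' p w) :
    HasLineDerivAt ℝ (fun q => f q * g q) (f' * g p + f p * g') p w := by
  have h := HasDerivAt.fun_mul hf hg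
  simp only [zero_smul, add_zero] at h
  exact h

theorem HasLineDerivAt.fun_add (hf : HasLineDerivAt ℝ f f' p w) (hg : HasLineDerivAt ℝ g g' p w) :
    HasLineDerivAt ℝ (fun q => f q + g q) (f' + g') p w := HasDerivAt.fun_add hf hg

theorem HasLineDerivAt.fun_sub (hf : HasLineDerivAt ℝ f f' p w) (hg : HasLineDerivAt ℝ g g' p w) :
    HasLineDerivAt ℝ (fun q => f q - g q) (f' - g') p w := HasDerivAt.fun_sub hf hg

theorem hasLineDerivAt_fderiv (hf : Differentiable ℝ f) (p w : E) :
    HasLineDerivAt ℝ f (fderiv ℝ f p w) p w := (hf p).hasFDerivAt.hasLineDerivAt w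

theorem HasLineDerivAt.fderiv_eq (h : HasLineDerivAt ℝ f f' p w) (hf : DifferentiableAt ℝ f p) :
    fderiv ℝ f p w = f' := by
  rw [← hf.lineDeriv_eq_fderiv, h.lineDeriv]

end LineDerivatives

section Space

variable {p : ℝ × Space} {u : Space} {n : ℝ}

theorem hasLineDerivAt_fst (h : ℝ → ℝ) (p : ℝ × Space) (u : Space) :
    HasLineDerivAt ℝ (fun q : ℝ × Space => h q.1) 0 p (0, u) := by
  have := hasDerivAt_const (0 : ℝ) (h p.1)
  simpa [HasLineDerivAt] using this

theorem hasLineDerivAt_coord (j : Fin 3) (p : ℝ × Space) (u : Space) :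
    HasLineDerivAt ℝ (fun q : ℝ × Space => q.2 j) (u j) p (0, u) :=
  (((EuclideanSpace.proj j : Space →L[ℝ] ℝ).comp
    (ContinuousLinearMap.snd ℝ ℝ Space)).hasFDerivAt (x := p)).hasLineDerivAt (0, u)

theorem hasLineDerivAt_space (hn : inner ℝ p.2 u = n) :
    HasLineDerivAt ℝ (fun q : ℝ × Space => bracket ‖q.2‖) (n * (bracket ‖p.2‖)⁻¹) p (0, u) := by
  have h := ((hasFDerivAt_bracket_norm p.2).comp p
    (hasFDerivAt_snd (𝕜 := ℝ) (p := p))).hasLineDerivAt (0, u)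
  have e : (((bracket ‖p.2‖)⁻¹ • innerSL ℝ p.2).comp (ContinuousLinearMap.snd ℝ ℝ Space)) (0, u) =
      n * (bracket ‖p.2‖)⁻¹ := by
    simp [hn, mul_comm]
  rw [e] at h
  exact h

theorem hasLineDerivAt_space_inv (hn : inner ℝ p.2 u = n) :
    HasLineDerivAt ℝ (fun q : ℝ × Space => (bracket ‖q.2‖)⁻¹) (-n * (bracket ‖p.2‖)⁻¹ ^ 3) p
      (0, u) := by
  have h := HasDerivAt.fun_inv (hasLineDerivAt_space hn) (bracket_pos _).ne'
  simp only [zero_smul, add_zero] at h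
  refine HasDerivAt.congr_deriv h ?_
  have := (bracket_pos ‖p.2‖).ne'
  field_simp

theorem hasLineDerivAt_space_inv_sq (hn : inner ℝ p.2 u = n) :
    HasLineDerivAt ℝ (fun q : ℝ × Space => (bracket ‖q.2‖)⁻¹ ^ 2)
      (-2 * n * (bracket ‖p.2‖)⁻¹ ^ 4) p (0, u) := by
  have h := (hasLineDerivAt_space_inv hn).fun_mul (hasLineDerivAt_space_inv hn)
  simp only [← pow_two] at h
  refine HasDerivAt.congr_deriv h ?_
  ring

theorem hasLineDerivAt_logWeight (hn : inner ℝ p.2 u = n) :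
    HasLineDerivAt ℝ logWeight (n * (bracket ‖p.2‖)⁻¹ ^ 2) p (0, u) := by
  have h := hasLineDerivAt_fderiv ((contDiff_logWeight (n := 1)).differentiable one_ne_zero) p
    ((0, u) : ℝ × Space)
  rw [fderiv_logWeight_apply, hn, mul_zero, zero_add, div_eq_mul_inv, ← inv_pow] at h
  exact h

variable {ε : ℝ} {V : Spacetime → Spacetime}

/-- One formula for all spatial directions u with n = z·u: coordinate directions have n = z^i, the
radial direction u = z has n = |z|². -/
theorem fderiv_hatCovector_zero (hV : ContDiff ℝ 3 V) (hn : inner ℝ p.2 u = n) :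
    fderiv ℝ (hatCovector (gaugedPotential (covariant V)) 0) p (0, u) =
      (bracket p.1)⁻¹ ^ 2 * (n * (bracket ‖p.2‖)⁻¹ * pulledComponent V 0 p +
        bracket ‖p.2‖ * fderiv ℝ (pulledComponent V 0) p (0, u) -
        n * (bracket ‖p.2‖)⁻¹ ^ 2 * (p.1 * radialDerivative V (chart p) +
          bracket ‖p.2‖ * pulledGradient V 0 p) -
        logWeight p * (p.1 * fderiv ℝ (fun q => radialDerivative V (chart q)) p (0, u) +
          n * (bracket ‖p.2‖)⁻¹ * pulledGradient V 0 p +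
          bracket ‖p.2‖ * fderiv ℝ (pulledGradient V 0) p (0, u))) := by
  have hB := (contDiff_hatCovector_gaugedPotential hV 0).differentiable (by norm_num) p
  have hZ := hasLineDerivAt_space hn
  have ha := hasLineDerivAt_fderiv (differentiable_pulledComponent hV 0) p ((0, u) : ℝ × Space)
  have hg := hasLineDerivAt_fderiv (differentiable_pulledGradient hV 0) p ((0, u) : ℝ × Space)
  have hψ := hasLineDerivAt_fderiv (differentiable_comp_chart (differentiable_radialDerivative hV))
    p ((0, u) : ℝ × Space)
  have h := (hasLineDerivAt_fst (fun t => (bracket t)⁻¹ ^ 2) p u).fun_mul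
    ((hZ.fun_mul ha).fun_sub ((hasLineDerivAt_logWeight hn).fun_mul
      (((hasLineDerivAt_fst (fun t => t) p u).fun_mul hψ).fun_add (hZ.fun_mul hg))))
  rw [← funext (hatCovector_zero hV)] at h
  rw [h.fderiv_eq hB]
  ring

/-- The contraction `z^i 𝒜̂_i`. -/
def radialGauge (V : Spacetime → Spacetime) (p : ℝ × Space) : ℝ :=
  ∑ i : Fin 3, p.2 i * hatCovector (gaugedPotential (covariant V)) i.succ p

theorem differentiable_radialGauge (hV : ContDiff ℝ 3 V) : Differentiable ℝ (radialGauge V) := by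
  have h : ∀ i : Fin 3, Differentiable ℝ (hatCovector (gaugedPotential (covariant V)) i.succ) :=
    fun i => (contDiff_hatCovector_gaugedPotential hV i.succ).differentiable (by norm_num)
  unfold radialGauge
  fun_prop

theorem fderiv_radialGauge (hV : ContDiff ℝ 3 V) (hn : inner ℝ p.2 u = n) :
    fderiv ℝ (radialGauge V) p (0, u) =
      -2 * n * (bracket ‖p.2‖)⁻¹ ^ 4 * radialComponent V (chart p) +
        (bracket ‖p.2‖)⁻¹ ^ 2 * fderiv ℝ (fun q => radialComponent V (chart q)) p (0, u) +
        p.1 * (n * (bracket ‖p.2‖)⁻¹ ^ 3) * pulledComponent V 0 p -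
        p.1 * (bracket ‖p.2‖)⁻¹ * fderiv ℝ (pulledComponent V 0) p (0, u) -
        n * (bracket ‖p.2‖)⁻¹ ^ 2 * (radialDerivative V (chart p) -
          p.1 * (bracket ‖p.2‖)⁻¹ * pulledGradient V 0 p) -
        logWeight p * (fderiv ℝ (fun q => radialDerivative V (chart q)) p (0, u) +
          p.1 * (n * (bracket ‖p.2‖)⁻¹ ^ 3) * pulledGradient V 0 p -
          p.1 * (bracket ‖p.2‖)⁻¹ * fderiv ℝ (pulledGradient V 0) p (0, u)) := by
  have hI := hasLineDerivAt_space_inv hn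
  have ha := hasLineDerivAt_fderiv (differentiable_pulledComponent hV 0) p ((0, u) : ℝ × Space)
  have hg := hasLineDerivAt_fderiv (differentiable_pulledGradient hV 0) p ((0, u) : ℝ × Space)
  have hφ := hasLineDerivAt_fderiv (differentiable_comp_chart (differentiable_radialComponent hV))
    p ((0, u) : ℝ × Space)
  have hψ := hasLineDerivAt_fderiv (differentiable_comp_chart (differentiable_radialDerivative hV))
    p ((0, u) : ℝ × Space)
  have hτ := (hasLineDerivAt_fst (fun t => t) p u).fun_mul hI
  have h := (((hasLineDerivAt_space_inv_sq hn).fun_mul hφ).fun_sub (hτ.fun_mul ha)).fun_sub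
    ((hasLineDerivAt_logWeight hn).fun_mul (hψ.fun_sub (hτ.fun_mul hg)))
  rw [← funext (sum_mul_hatCovector hV)] at h
  rw [HasLineDerivAt.fderiv_eq (f := radialGauge V) h (differentiable_radialGauge hV p)]
  ring

theorem fderiv_hatCovector_succ (hV : ContDiff ℝ 3 V) (j : Fin 3) (hn : inner ℝ p.2 u = n) :
    fderiv ℝ (hatCovector (gaugedPotential (covariant V)) j.succ) p (0, u) =
      p.1 * (u j * (bracket ‖p.2‖)⁻¹ - p.2 j * n * (bracket ‖p.2‖)⁻¹ ^ 3) *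
          (pulledComponent V 0 p - logWeight p * pulledGradient V 0 p) +
        p.1 * (p.2 j * (bracket ‖p.2‖)⁻¹) * (fderiv ℝ (pulledComponent V 0) p (0, u) -
          n * (bracket ‖p.2‖)⁻¹ ^ 2 * pulledGradient V 0 p -
          logWeight p * fderiv ℝ (pulledGradient V 0) p (0, u)) +
        bracket p.1 * (fderiv ℝ (pulledComponent V j.succ) p (0, u) -
          n * (bracket ‖p.2‖)⁻¹ ^ 2 * pulledGradient V j.succ p -
          logWeight p * fderiv ℝ (pulledGradient V j.succ) p (0, u)) -
        (u j * (bracket ‖p.2‖)⁻¹ ^ 2 - 2 * (p.2 j * n * (bracket ‖p.2‖)⁻¹ ^ 4)) *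
          radialComponent V (chart p) -
        p.2 j * (bracket ‖p.2‖)⁻¹ ^ 2 *
          fderiv ℝ (fun q => radialComponent V (chart q)) p (0, u) := by
  have hB := (contDiff_hatCovector_gaugedPotential hV j.succ).differentiable (by norm_num) p
  have hI := hasLineDerivAt_space_inv hn
  have hL := hasLineDerivAt_logWeight hn
  have hz := hasLineDerivAt_coord j p u
  have ha := fun a => hasLineDerivAt_fderiv (differentiable_pulledComponent hV a) p
    ((0, u) : ℝ × Space)
  have hg := fun a => hasLineDerivAt_fderiv (differentiable_pulledGradient hV a) p
    ((0, u) : ℝ × Space)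
  have hφ := hasLineDerivAt_fderiv (differentiable_comp_chart (differentiable_radialComponent hV))
    p ((0, u) : ℝ × Space)
  have h := (((((hasLineDerivAt_fst (fun t => t) p u).fun_mul hz).fun_mul hI).fun_mul
    ((ha 0).fun_sub (hL.fun_mul (hg 0)))).fun_add ((hasLineDerivAt_fst bracket p u).fun_mul
      ((ha j.succ).fun_sub (hL.fun_mul (hg j.succ))))).fun_sub
    ((hz.fun_mul (hasLineDerivAt_space_inv_sq hn)).fun_mul hφ)
  rw [← funext (hatCovector_succ hV j)] at h
  rw [h.fderiv_eq hB]
  ring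

end Space

end

noncomputable section

open Filter Topology Set

/-! ### Estimates of the special gauge potential -/

theorem weightBound_time_inv_sq : WeightBound 1 (-2) 0 fun p : ℝ × Space => (bracket p.1)⁻¹ ^ 2 :=
  ((weightBound_time_inv.mul weightBound_time_inv).mono (by norm_num) (by norm_num)).congr
    fun _ => pow_two _

theorem weightBound_space_inv_sq :
    WeightBound 1 0 (-2) fun p : ℝ × Space => (bracket ‖p.2‖)⁻¹ ^ 2 :=
  ((weightBound_space_inv.mul weightBound_space_inv).mono (by norm_num) (by norm_num)).congr
    fun _ => pow_two _

theorem weightBound_space_inv_cube :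
    WeightBound 1 0 (-3) fun p : ℝ × Space => (bracket ‖p.2‖)⁻¹ ^ 3 :=
  ((weightBound_space_inv_sq.mul weightBound_space_inv).mono (by norm_num) (by norm_num)).congr
    fun _ => pow_succ _ _

theorem weightBound_space_inv_four :
    WeightBound 1 0 (-4) fun p : ℝ × Space => (bracket ‖p.2‖)⁻¹ ^ 4 :=
  ((weightBound_space_inv_cube.mul weightBound_space_inv).mono (by norm_num) (by norm_num)).congr
    fun _ => pow_succ _ _

theorem inner_coordVec_succ (p : ℝ × Space) (i : Fin 3) :
    inner ℝ p.2 (EuclideanSpace.single i (1 : ℝ) : Space) = p.2 i := by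
  simp [EuclideanSpace.inner_single_right]

theorem norm_sq_eq_bracket (p : ℝ × Space) : ‖p.2‖ ^ 2 = bracket ‖p.2‖ ^ 2 - 1 := by
  rw [bracket_sq]; ring

theorem weightBound_norm_sq : WeightBound 1 0 2 fun p : ℝ × Space => ‖p.2‖ ^ 2 := by
  refine ⟨1, zero_le_one, fun p => ?_⟩
  have h : bracket ‖p.2‖ ^ (2 : ℝ) = bracket ‖p.2‖ ^ 2 := by norm_cast
  simp only [monomialWeight, Real.rpow_zero, Pi.one_apply, one_mul, h]
  rw [Real.norm_of_nonneg (by positivity), norm_sq_eq_bracket]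
  linarith

namespace PotentialBounds

variable {ε : ℝ} {V : Spacetime → Spacetime}

/-- The logarithm in front of τ(x·∇)(x·A) is absorbed in z by ⟨z⟩^(-ε). Only the one in front of
⟨τ⟩⁻²⟨z⟩∇_0(x·A) = O(⟨τ⟩⁻³) survives, hence the separate log⟨z⟩ term in the theorem. -/
theorem exists_hatCovector_zero_split (hV : PotentialBounds ε V) (hε : 0 < ε) (hε1 : ε < 1 / 2) :
    ∃ f g : ℝ × Space → ℝ, WeightBound timeLog (-1 - ε) 0 f ∧ WeightBound 1 (-3) 0 g ∧
      ∀ p, hatCovector (gaugedPotential (covariant V)) 0 p = f p - logWeight p * g p := by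
  have ha := hV.weightBound_component 0
  have hg := hV.weightBound_gradient 0
  have hψ := hV.weightBound_radialDerivative hε
  refine ⟨_, _, ((weightBound_time_inv_sq.mul (weightBound_space.mul ha)).weaken timeLog).mono
    (by linarith) (by norm_num) |>.sub ((weightBound_time_inv_sq.mul
      ((weightBound_fst.mul hψ).timeLog_mul hε)).mono (by linarith) (by linarith)),
    (weightBound_time_inv_sq.mul (weightBound_space.mul hg)).mono (by norm_num) (by norm_num),
    fun p => ?_⟩
  rw [hatCovector_zero hV.contDiff]
  ring

theorem weightBound_pd_zero (hV : PotentialBounds ε V) (hε : 0 < ε) (hε1 : ε < 1 / 2)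
    (i : Fin 3) : WeightBound timeLog (-1 - ε) 0
      (pd i.succ (hatCovector (gaugedPotential (covariant V)) 0)) := by
  have ha := hV.weightBound_component 0
  have hg := hV.weightBound_gradient 0
  have hψ := hV.weightBound_radialDerivative hε
  have da := hV.quadBound_fderiv_component 0 i
  have dg := hV.quadBound_fderiv_gradient 0 i
  have dψ := hV.weightBound_fderiv_radialDerivative' hε (by linarith) i
  have hZ : WeightBound 1 0 0 fun p : ℝ × Space => p.2 i * (bracket ‖p.2‖)⁻¹ :=
    ((weightBound_coord i).mul weightBound_space_inv).mono (by norm_num) (by norm_num)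
  have hL : WeightBound 1 0 (-1) fun p : ℝ × Space => p.2 i * (bracket ‖p.2‖)⁻¹ ^ 2 :=
    ((weightBound_coord i).mul weightBound_space_inv_sq).mono (by norm_num) (by norm_num)
  have h1 := ((hZ.mul ha).weaken timeLog).mono (c := 1 - ε) (d := 0) (by linarith) (by norm_num)
  have h2 := ((weightBound_space.mul da.mixed).weaken timeLog).mono (c := 1 - ε) (d := 0)
    (by linarith) (by norm_num)
  have h3 := ((hL.mul (((weightBound_fst.mul hψ).mono (c := 1 - ε) (d := 0) (by linarith)
    (by linarith)).add ((weightBound_space.mul hg).mono (by linarith) (by norm_num)))).weaken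
    timeLog).mono (c := 1 - ε) (d := 0) (by linarith) (by norm_num)
  -- The terms decay in z at least like ⟨z⟩^(-1+ε), so log⟨z⟩ is absorbed with δ = 1 - ε.
  have h4 := ((((weightBound_fst.mul dψ).mono (c := 1 - ε) (d := -1 + ε) (by linarith)
    (by linarith)).add ((hZ.mul hg).mono (by linarith) (by linarith))).timeLog_mul
    (δ := 1 - ε) (by linarith)).mono (c := 1 - ε) (d := 0) (by linarith) (by linarith)
  have h5 := (weightBound_space.mul dg.log_mixed).mono (c := 1 - ε) (d := 0)
    (by linarith) (by norm_num)
  refine ((weightBound_time_inv_sq.mul ((((h1.add h2).sub h3).sub h4).sub h5)).mono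
    (by linarith) (by linarith)).congr fun p => ?_
  rw [pd]
  change fderiv ℝ _ p (0, EuclideanSpace.single i 1) = _
  rw [fderiv_hatCovector_zero hV.contDiff (inner_coordVec_succ p i)]
  simp only [coordVec, Fin.cases_succ]
  ring

/-- The dangerous term is log(⟨τ⟩⟨z⟩)⟨z⟩∇_0(x·A), without decay in z. Differentiating the factor ⟨z⟩
gives (⟨z⟩ - ⟨z⟩⁻¹)∇_0(x·A), and the commutator in `fderiv_gradient_radial` gives -⟨z⟩∇_0(x·A); only
-⟨z⟩⁻¹∇_0(x·A) is left. -/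
theorem weightBound_radial_zero (hV : PotentialBounds ε V) (hε : 0 < ε) (hε1 : ε < 1 / 2) :
    WeightBound timeLog (-1 - ε) 0 fun p =>
      fderiv ℝ (hatCovector (gaugedPotential (covariant V)) 0) p (0, p.2) := by
  have ha := hV.weightBound_component 0
  have hg := hV.weightBound_gradient 0
  have hψ := hV.weightBound_radialDerivative hε
  have da := hV.weightBound_radial_component 0
  have htt := hV.quadBound_time_time
  have hs := hV.weightBound_time_radialDerivative_space hε (by linarith)
  have dψ := hV.weightBound_radial_radialDerivative hε hε1
  have hZ : WeightBound 1 0 1 fun p : ℝ × Space => ‖p.2‖ ^ 2 * (bracket ‖p.2‖)⁻¹ :=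
    (weightBound_norm_sq.mul weightBound_space_inv).mono (by norm_num) (by norm_num)
  have hL : WeightBound 1 0 0 fun p : ℝ × Space => ‖p.2‖ ^ 2 * (bracket ‖p.2‖)⁻¹ ^ 2 :=
    (weightBound_norm_sq.mul weightBound_space_inv_sq).mono (by norm_num) (by norm_num)
  have h1 := ((hZ.mul ha).weaken timeLog).mono (c := 1 - ε) (d := 0) (by linarith) (by norm_num)
  have h2 := ((weightBound_space.mul da).weaken timeLog).mono (c := 1 - ε) (d := 0)
    (by linarith) (by norm_num)
  have h3 := ((hL.mul (((weightBound_fst.mul hψ).mono (c := 1 - ε) (d := 0) (by linarith)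
    (by linarith)).add ((weightBound_space.mul hg).mono (by linarith) (by norm_num)))).weaken
    timeLog).mono (c := 1 - ε) (d := 0) (by linarith) (by norm_num)
  have h4 := (((((weightBound_fst.mul dψ).mono (c := 1 - ε) (d := -ε) (by linarith)
    (by linarith)).add ((weightBound_space.mul hs).mono (by linarith) (by linarith))).sub
    ((weightBound_space_inv.mul hg).mono (by linarith) (by linarith))).timeLog_mul
    hε).mono (c := 1 - ε) (d := 0) (by linarith) (by linarith)
  have h5 := (weightBound_fst.mul htt.log_mixed).mono (c := 1 - ε) (d := 0)
    (by linarith) (by norm_num)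
  refine ((weightBound_time_inv_sq.mul ((((h1.add h2).sub h3).sub h4).add h5)).mono
    (by linarith) (by linarith)).congr fun p => ?_
  rw [fderiv_hatCovector_zero hV.contDiff (real_inner_self_eq_norm_sq p.2),
    hV.fderiv_gradient_radial]
  have hb := (bracket_pos ‖p.2‖).ne'
  have hb1 : bracket ‖p.2‖ * (bracket ‖p.2‖)⁻¹ = 1 := mul_inv_cancel₀ hb
  rw [norm_sq_eq_bracket]
  linear_combination (bracket p.1)⁻¹ ^ 2 * logWeight p * (p.1 *
    (fderiv ℝ (fderiv ℝ (radialComponent V)) (chart p)) timeDir timeDir -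
      bracket ‖p.2‖ * pulledGradient V 0 p) * hb1

theorem weightBound_succ (hV : PotentialBounds ε V) (j : Fin 3) :
    WeightBound fullLog 0 (-1) (hatCovector (gaugedPotential (covariant V)) j.succ) := by
  have ha := hV.weightBound_component
  have hg := hV.weightBound_gradient
  have hφ := hV.weightBound_radialComponent
  have hs : WeightBound 1 1 0 fun p : ℝ × Space => p.1 * p.2 j * (bracket ‖p.2‖)⁻¹ :=
    ((weightBound_fst.mul (weightBound_coord j)).mul weightBound_space_inv).mono (by norm_num)
      (by norm_num)
  have h1 := (hs.mul (((ha 0).weaken fullLog).sub (hg 0).log_mul)).mono (c := 0) (d := -1)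
    (by norm_num) (by norm_num)
  have h2 := (weightBound_time.mul (((ha j.succ).weaken fullLog).sub (hg j.succ).log_mul)).mono
    (c := 0) (d := -1) (by norm_num) (by norm_num)
  have h3 := ((((weightBound_coord j).mul weightBound_space_inv_sq).mul hφ).weaken fullLog).mono
    (c := 0) (d := -1) (by norm_num) (by norm_num)
  exact ((h1.add h2).sub h3).congr (hatCovector_succ hV.contDiff j)

theorem weightBound_radialGauge (hV : PotentialBounds ε V) (hε : 0 < ε) (hε1 : ε < 1 / 2) :
    WeightBound fullLog 0 (-ε) (radialGauge V) := by
  have ha := hV.weightBound_component 0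
  have hg := hV.weightBound_gradient 0
  have hφ := hV.weightBound_radialComponent
  have hψ := hV.weightBound_radialDerivative hε
  have h1 := ((weightBound_space_inv_sq.mul hφ).weaken fullLog).mono (c := 0) (d := -ε)
    (by norm_num) (by linarith)
  have h2 := ((weightBound_slope.mul ha).weaken fullLog).mono (c := 0) (d := -ε)
    (by norm_num) (by linarith)
  have h3 := ((hψ.mono (c := 0) (d := -ε) (by linarith) le_rfl).sub
    ((weightBound_slope.mul hg).mono (by norm_num) (by linarith))).log_mul
  exact ((h1.sub h2).sub h3).congr (sum_mul_hatCovector hV.contDiff)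

/-- Differentiating the closed form of the contraction, not the separate components, retains the
cancellation of x·A and the decay ⟨z⟩⁻¹. -/
theorem weightBound_pd_radialGauge (hV : PotentialBounds ε V) (hε : 0 < ε) (i : Fin 3) :
    WeightBound fullLog 0 (-1) (pd i.succ (radialGauge V)) := by
  have ha := hV.weightBound_component 0
  have hg := hV.weightBound_gradient 0
  have hφ := hV.weightBound_radialComponent
  have hψ := hV.weightBound_radialDerivative hε
  have da := (hV.quadBound_fderiv_component 0 i).time
  have dg := (hV.quadBound_fderiv_gradient 0 i).time
  have dφ := hV.weightBound_fderiv_radialComponent i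
  have dψ := hV.weightBound_fderiv_radialDerivative hε i
  have hz := weightBound_coord i
  have h1 := (((((weightBound_const (-2 : ℝ)).mul hz).mul weightBound_space_inv_four).mul
    hφ).weaken fullLog).mono (c := 0) (d := -1) (by norm_num) (by norm_num)
  have h2 := ((weightBound_space_inv_sq.mul dφ).weaken fullLog).mono (c := 0) (d := -1)
    (by norm_num) (by norm_num)
  have hc := weightBound_fst.mul (hz.mul weightBound_space_inv_cube)
  have h3 := ((hc.mul ha).weaken fullLog).mono (c := 0) (d := -1) (by norm_num) (by norm_num)
  have h4 := ((weightBound_slope.mul da).weaken fullLog).mono (c := 0) (d := -1)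
    (by norm_num) (by norm_num)
  have h5 := (((hz.mul weightBound_space_inv_sq).mul ((hψ.mono (c := 0) (d := 0) (by linarith)
    (by linarith)).sub ((weightBound_slope.mul hg).mono (by norm_num) (by norm_num)))).weaken
    fullLog).mono (c := 0) (d := -1) (by norm_num) (by norm_num)
  have h6 := ((dψ.add ((hc.mul hg).mono (by norm_num) (by norm_num))).sub
    ((weightBound_slope.mul dg).mono (by norm_num) (by norm_num))).log_mul
  exact (((((h1.add h2).add h3).sub h4).sub h5).sub h6).congr fun p =>
    fderiv_radialGauge hV.contDiff (inner_coordVec_succ p i)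

theorem weightBound_radial_radialGauge (hV : PotentialBounds ε V) (hε : 0 < ε)
    (hε1 : ε < 1 / 2) :
    WeightBound fullLog 0 (-ε) fun p => fderiv ℝ (radialGauge V) p (0, p.2) := by
  have ha := hV.weightBound_component 0
  have hg := hV.weightBound_gradient 0
  have hφ := hV.weightBound_radialComponent
  have hψ := hV.weightBound_radialDerivative hε
  have da := hV.weightBound_radial_component 0
  have dg := hV.weightBound_radial_gradient hε
  have dφ := hV.weightBound_radial_radialComponent hε
  have dψ := hV.weightBound_radial_radialDerivative hε hε1
  have hz := weightBound_norm_sq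
  have h1 := (((((weightBound_const (-2 : ℝ)).mul hz).mul weightBound_space_inv_four).mul
    hφ).weaken fullLog).mono (c := 0) (d := -ε) (by norm_num) (by linarith)
  have h2 := ((weightBound_space_inv_sq.mul dφ).weaken fullLog).mono (c := 0) (d := -ε)
    (by norm_num) (by linarith)
  have hc := weightBound_fst.mul (hz.mul weightBound_space_inv_cube)
  have h3 := ((hc.mul ha).weaken fullLog).mono (c := 0) (d := -ε) (by norm_num) (by linarith)
  have h4 := ((weightBound_slope.mul da).weaken fullLog).mono (c := 0) (d := -ε)
    (by norm_num) (by linarith)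
  have h5 := (((hz.mul weightBound_space_inv_sq).mul ((hψ.mono (c := 0) (d := -ε) (by linarith)
    (by linarith)).sub ((weightBound_slope.mul hg).mono (by norm_num) (by linarith)))).weaken
    fullLog).mono (c := 0) (d := -ε) (by norm_num) (by linarith)
  have h6 := (((dψ.mono (c := 0) (d := -ε) (by linarith) le_rfl).add
    ((hc.mul hg).mono (by norm_num) (by linarith))).sub
    ((weightBound_slope.mul dg).mono (by norm_num) (by linarith))).log_mul
  exact (((((h1.add h2).add h3).sub h4).sub h5).sub h6).congr fun p =>
    fderiv_radialGauge hV.contDiff (real_inner_self_eq_norm_sq p.2)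

/-- No log⟨z⟩ appears: where it multiplies a gradient of x·A it is absorbed by ⟨z⟩⁻¹, where it
multiplies a second derivative by ⟨τ⟩² + ⟨z⟩². -/
theorem weightBound_pd_succ (hV : PotentialBounds ε V) (i j : Fin 3) :
    WeightBound timeLog 0 0
      (pd i.succ (hatCovector (gaugedPotential (covariant V)) j.succ)) := by
  have ha := hV.weightBound_component
  have hg := hV.weightBound_gradient
  have hφ := hV.weightBound_radialComponent
  have da := fun a => hV.quadBound_fderiv_component a i
  have dg := fun a => hV.quadBound_fderiv_gradient a i
  have dφ := hV.weightBound_fderiv_radialComponent i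
  have hi := weightBound_coord i
  have hj := weightBound_coord j
  have hu := weightBound_const ((EuclideanSpace.single i 1 : Space) j)
  have h1 := (weightBound_fst.mul (((hu.mul weightBound_space_inv).mono (c := 0) (d := -1)
    (by norm_num) (by norm_num)).sub (((hj.mul hi).mul weightBound_space_inv_cube).mono
      (by norm_num) (by norm_num)))).mul ((((ha 0).weaken timeLog).mono (c := -1) (d := 0)
      (by norm_num) (by norm_num)).sub (((hg 0).timeLog_mul one_pos).mono (by norm_num)
      (by norm_num)))
  have hin : ∀ a, WeightBound timeLog (-1) 0 fun p =>
      fderiv ℝ (pulledComponent V a) p (coordVec i.succ) -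
        p.2 i * (bracket ‖p.2‖)⁻¹ ^ 2 * pulledGradient V a p -
        logWeight p * fderiv ℝ (pulledGradient V a) p (coordVec i.succ) := fun a =>
    (((da a).time.weaken timeLog).mono (by norm_num) (by norm_num)).sub
      ((((hi.mul weightBound_space_inv_sq).mul (hg a)).weaken timeLog).mono (by norm_num)
        (by norm_num)) |>.sub ((dg a).log_time.mono (by norm_num) (by norm_num))
  have h2 := (weightBound_fst.mul (hj.mul weightBound_space_inv)).mul (hin 0)
  have h3 := weightBound_time.mul (hin j.succ)
  have h4 := ((((hu.mul weightBound_space_inv_sq).mono (c := 0) (d := 0) (by norm_num)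
    (by norm_num)).sub (((weightBound_const (2 : ℝ)).mul ((hj.mul hi).mul
      weightBound_space_inv_four)).mono (by norm_num) (by norm_num))).mul hφ).weaken timeLog
  have h5 := ((hj.mul weightBound_space_inv_sq).mul dφ).weaken timeLog
  refine (((((h1.mono (c := 0) (d := 0) (by norm_num) (by norm_num)).add
    (h2.mono (by norm_num) (by norm_num))).add (h3.mono (by norm_num) (by norm_num))).sub
    (h4.mono (by norm_num) (by norm_num))).sub (h5.mono (by norm_num) (by norm_num))).congr
    fun p => fderiv_hatCovector_succ hV.contDiff j (inner_coordVec_succ p i)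

end PotentialBounds

end

noncomputable section

open Filter Topology Set

/-! ### Estimates of the field strength -/

section Field

variable {ε : ℝ} {V : Spacetime → Spacetime}

/-- The field strength of `V` as a bilinear form. -/
def faraday (V : Spacetime → Spacetime) (x u v : Spacetime) : ℝ :=
  mink v (fderiv ℝ V x u) - mink u (fderiv ℝ V x v)

theorem faraday_neg (V : Spacetime → Spacetime) (x u v : Spacetime) :
    faraday V x u v = -faraday V x v u := by
  rw [faraday, faraday]; ring

theorem faraday_self (V : Spacetime → Spacetime) (x u : Spacetime) : faraday V x u u = 0 :=
  sub_self _

theorem faraday_add_smul (V : Spacetime → Spacetime) (x u v w : Spacetime) (a b : ℝ) :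
    faraday V x u (a • v + b • w) = a * faraday V x u v + b * faraday V x u w := by
  simp only [faraday, map_add, map_smul, add_apply, smul_apply, smul_eq_mul]
  ring

/-- The linear form obtained by contracting the field strength with `x`. -/
def radialFaraday (V : Spacetime → Spacetime) (x : Spacetime) : Spacetime →L[ℝ] ℝ :=
  mink.flip (fderiv ℝ V x x) + (mink.flip (V x) + -fderiv ℝ (radialComponent V) x)

/-- That is, x^a F_ab = (x·∇)A_b + A_b - ∇_b(x·A), each term being O((1 + |x|)⁻¹). Estimating |x||F|
directly would give no decay along the light cone. -/
theorem radialFaraday_apply (hV : ContDiff ℝ 3 V) (x v : Spacetime) :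
    radialFaraday V x v = faraday V x x v := by
  simp only [radialFaraday, add_apply, neg_apply, ContinuousLinearMap.flip_apply, faraday,
    fderiv_radialComponent_apply (hV.differentiable (by norm_num) x)]
  ring

theorem norm_flip_mink_le (v : Spacetime) : ‖mink.flip v‖ ≤ 1 * ‖v‖ :=
  (mink.flip.le_opNorm v).trans (by
    rw [ContinuousLinearMap.opNorm_flip]
    gcongr
    exact norm_mink_le)

theorem BoundedBy.flip_mink {f : Spacetime → Spacetime} {w : Spacetime → ℝ}
    (hf : BoundedBy f w) : BoundedBy (fun x => mink.flip (f x)) w := by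
  obtain ⟨K, hK⟩ := hf
  exact ⟨K, fun x => (norm_flip_mink_le _).trans (by rw [one_mul]; exact hK x)⟩

namespace PotentialBounds

theorem weightBound_radialFaraday (hV : PotentialBounds ε V) :
    WeightBound 1 (-1) (-1) fun p => radialFaraday V (chart p) :=
  (hV.deriv_self.flip_mink.add (hV.self.flip_mink.add hV.radial_deriv.neg)).weightBound_inv

theorem quadBound_faraday (hV : PotentialBounds ε V) {a b c d : ℝ} {u v : ℝ × Space → Spacetime}
    (hu : WeightBound 1 a b u) (hv : WeightBound 1 c d v) :
    QuadBound (a + c) (b + d) fun p => faraday V (chart p) (u p) (v p) := by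
  have h : ∀ {a b c d : ℝ} {u v : ℝ × Space → Spacetime}, WeightBound 1 a b u →
      WeightBound 1 c d v →
      QuadBound (a + c) (b + d) fun p => mink (v p) (fderiv ℝ V (chart p) (u p)) := by
    intro a b c d u v hu hv
    have h1 := hV.deriv.quadBound.clm_apply hu
    rw [zero_add, zero_add] at h1
    exact (h1.of_norm_le zero_le_one fun p => norm_flip_mink_le _).clm_apply hv
  obtain ⟨C, hC0, hC⟩ := h hu hv
  obtain ⟨D, hD0, hD⟩ := h hv hu
  rw [add_comm c a, add_comm d b] at hD
  exact ⟨C + D, by positivity, fun p => (norm_sub_le _ _).trans (by linarith [hC p, hD p])⟩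

theorem hatTensor_eq (hV : ContDiff ℝ 3 V) (μ ν : Fin 4) (p : ℝ × Space) :
    hatTensor (fieldStrength (covariant V)) μ ν p =
      faraday V (chart p) (fderiv ℝ chart p (coordVec μ)) (fderiv ℝ chart p (coordVec ν)) :=
  hatTensor_fieldStrength hV μ ν p

theorem sum_mul_hatTensor (hV : ContDiff ℝ 3 V) (ν : Fin 4) (p : ℝ × Space) :
    ∑ i : Fin 3, p.2 i * hatTensor (fieldStrength (covariant V)) i.succ ν p =
      faraday V (chart p) (chart p) (fderiv ℝ chart p (coordVec ν)) -
        p.1 * (bracket ‖p.2‖)⁻¹ *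
          faraday V (chart p) timeDir (fderiv ℝ chart p (coordVec ν)) := by
  have h1 : ∑ i : Fin 3, p.2 i • fderiv ℝ chart p (coordVec i.succ) =
      (1 : ℝ) • chart p + (-(p.1 * (bracket ‖p.2‖)⁻¹)) • timeDir := by
    rw [one_smul, neg_smul, ← sub_eq_add_neg, ← div_eq_mul_inv, ← fderiv_chart_radial,
      ← sum_smul_coordVec, map_sum]
    simp
  set v := fderiv ℝ chart p (coordVec ν)
  have h2 : ∑ i : Fin 3, p.2 i * faraday V (chart p) v (fderiv ℝ chart p (coordVec i.succ)) =
      faraday V (chart p) v (∑ i : Fin 3, p.2 i • fderiv ℝ chart p (coordVec i.succ)) := by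
    simp only [faraday, map_sum, map_smul, sum_apply, smul_apply, smul_eq_mul, mul_sub,
      Finset.sum_sub_distrib]
  rw [h1, faraday_add_smul] at h2
  rw [faraday_neg V (chart p) (chart p), faraday_neg V (chart p) timeDir]
  have h3 : ∀ i : Fin 3, hatTensor (fieldStrength (covariant V)) i.succ ν p =
      -faraday V (chart p) v (fderiv ℝ chart p (coordVec i.succ)) := fun i => by
    rw [hatTensor_eq hV, faraday_neg]
  simp only [h3, mul_neg, Finset.sum_neg_distrib, h2]
  ring

theorem weightBound_space_time (hV : PotentialBounds ε V) (i : Fin 3) :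
    WeightBound 1 (-1) (-1) (hatTensor (fieldStrength (covariant V)) i.succ 0) := by
  have he := weightBound_fderiv_chart i
  have h1 := (weightBound_fst.mul weightBound_time_inv_sq).mul
    (hV.weightBound_radialFaraday.clm_apply he)
  have h2 := (weightBound_space.mul weightBound_time_inv_sq).mul
    (hV.quadBound_faraday he (weightBound_const timeDir)).space
  refine ((h2.mono (by norm_num) (by norm_num)).sub (h1.mono (by norm_num) (by norm_num))).congr
    fun p => ?_
  rw [hatTensor_eq hV.contDiff, fderiv_chart_time, faraday_add_smul,
    radialFaraday_apply hV.contDiff, faraday_neg V (chart p) (chart p)]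
  ring

/-- Both contracted vectors lie in the span of x and the time axis, so by antisymmetry only F(x,
e_0) contributes. -/
theorem weightBound_radial_time (hV : PotentialBounds ε V) :
    WeightBound 1 (-1) 0 fun p =>
      ∑ i : Fin 3, p.2 i * hatTensor (fieldStrength (covariant V)) i.succ 0 p := by
  have hF := hV.weightBound_radialFaraday.clm_apply (weightBound_const timeDir)
  have h1 := (weightBound_space.mul weightBound_time_inv_sq).mul hF
  have h2 := ((weightBound_fst.mul weightBound_slope).mul weightBound_time_inv_sq).mul hF
  refine ((h1.mono (by norm_num) (by norm_num)).add (h2.mono (by norm_num) (by norm_num))).congr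
    fun p => ?_
  rw [sum_mul_hatTensor hV.contDiff, fderiv_chart_time, faraday_add_smul, faraday_add_smul,
    faraday_self, faraday_self, faraday_neg V (chart p) timeDir, radialFaraday_apply hV.contDiff]
  ring

theorem weightBound_space_space (hV : PotentialBounds ε V) (i j : Fin 3) :
    WeightBound 1 0 0 (hatTensor (fieldStrength (covariant V)) i.succ j.succ) :=
  ((hV.quadBound_faraday (weightBound_fderiv_chart i) (weightBound_fderiv_chart j)).time.mono
    (by norm_num) (by norm_num)).congr (hatTensor_eq hV.contDiff _ _)

theorem weightBound_radial_space (hV : PotentialBounds ε V) (j : Fin 3) :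
    WeightBound 1 0 (-1) fun p =>
      ∑ i : Fin 3, p.2 i * hatTensor (fieldStrength (covariant V)) i.succ j.succ p := by
  have he := weightBound_fderiv_chart j
  have h1 := hV.weightBound_radialFaraday.clm_apply he
  have h2 := weightBound_slope.mul (hV.quadBound_faraday (weightBound_const timeDir) he).time
  refine ((h1.mono (by norm_num) (by norm_num)).sub (h2.mono (by norm_num) (by norm_num))).congr
    fun p => ?_
  rw [sum_mul_hatTensor hV.contDiff, radialFaraday_apply hV.contDiff]

end PotentialBounds

end Field

/-! ### Remaining derivatives, obtained from the exterior derivative. -/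

section Gauge

variable {ε : ℝ} {V : Spacetime → Spacetime}

theorem WeightBound.of_timeLog {f : ℝ × Space → ℝ} {δ : ℝ} (hδ : 0 < δ) {a b : ℝ}
    (hf : WeightBound timeLog a b f) : WeightBound 1 (a + δ) b f := by
  obtain ⟨C, hC0, hC⟩ := hf
  refine ⟨C * (1 + δ⁻¹), by positivity, fun p => (hC p).trans ?_⟩
  have h1 := Real.log_le_rpow_div (bracket_pos p.1).le hδ
  have h2 : 1 ≤ bracket p.1 ^ δ := Real.one_le_rpow (one_le_bracket _) hδ.le
  have h3 := (monomialWeight_pos a b p).le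
  have h4 : timeLog p ≤ (1 + δ⁻¹) * monomialWeight δ 0 p := by
    rw [timeLog, monomialWeight, Real.rpow_zero, mul_one]
    rw [div_eq_mul_inv] at h1
    linarith
  have h5 : monomialWeight (a + δ) b p = monomialWeight δ 0 p * monomialWeight a b p := by
    rw [monomialWeight_mul, zero_add, add_comm]
  rw [Pi.one_apply, one_mul, h5, mul_assoc, ← mul_assoc (1 + δ⁻¹)]
  gcongr

namespace PotentialBounds

/-- From ∂_τ 𝒜̂_i = ∂_i 𝒜̂_τ - F̂_{iτ}; no time derivative is estimated directly. The spare ⟨τ⟩^(-ε)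
absorbs log⟨τ⟩. -/
theorem weightBound_pd_time (hV : PotentialBounds ε V) (hε : 0 < ε) (hε1 : ε < 1 / 2)
    (i : Fin 3) : WeightBound 1 (-1) 0
      (pd 0 (hatCovector (gaugedPotential (covariant V)) i.succ)) := by
  have h1 := (hV.weightBound_pd_zero hε hε1 i).of_timeLog hε
  have h2 := hV.weightBound_space_time i
  refine ((h1.mono (by linarith) le_rfl).sub (h2.mono le_rfl (by norm_num))).congr fun p => ?_
  rw [← pd_hatCovector_sub hV.contDiff]
  ring

theorem weightBound_radial_pd_time (hV : PotentialBounds ε V) (hε : 0 < ε) (hε1 : ε < 1 / 2) :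
    WeightBound 1 (-1) 0 fun p =>
      ∑ k : Fin 3, p.2 k * pd 0 (hatCovector (gaugedPotential (covariant V)) k.succ) p := by
  have h1 := (hV.weightBound_radial_zero hε hε1).of_timeLog hε
  refine ((h1.mono (by linarith) le_rfl).sub hV.weightBound_radial_time).congr fun p => ?_
  rw [← sum_mul_pd, ← Finset.sum_sub_distrib]
  refine Finset.sum_congr rfl fun k _ => ?_
  rw [← pd_hatCovector_sub hV.contDiff]
  ring

theorem pd_radialGauge (hV : ContDiff ℝ 3 V) (j : Fin 3) (p : ℝ × Space) :
    pd j.succ (radialGauge V) p =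
      ∑ i : Fin 3, p.2 i * pd j.succ (hatCovector (gaugedPotential (covariant V)) i.succ) p +
        hatCovector (gaugedPotential (covariant V)) j.succ p := by
  have hB : ∀ i : Fin 3, Differentiable ℝ (hatCovector (gaugedPotential (covariant V)) i.succ) :=
    fun i => (contDiff_hatCovector_gaugedPotential hV i.succ).differentiable (by norm_num)
  have h : ∀ i : Fin 3, HasLineDerivAt ℝ
      (fun q : ℝ × Space => q.2 i * hatCovector (gaugedPotential (covariant V)) i.succ q) _ p
      (0, EuclideanSpace.single j (1 : ℝ)) := fun i =>
    (hasLineDerivAt_coord i p (EuclideanSpace.single j 1)).fun_mul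
      (hasLineDerivAt_fderiv (hB i) p _)
  have hs := HasDerivAt.fun_sum (u := Finset.univ) fun i _ => h i
  change fderiv ℝ (radialGauge V) p (0, EuclideanSpace.single j 1) = _
  rw [HasLineDerivAt.fderiv_eq (f := radialGauge V) hs (differentiable_radialGauge hV p),
    Finset.sum_add_distrib, add_comm]
  congr 1
  simp

theorem weightBound_sum_pd_radial (hV : PotentialBounds ε V) (hε : 0 < ε) (j : Fin 3) :
    WeightBound fullLog 0 (-1) fun p =>
      ∑ i : Fin 3, p.2 i * pd j.succ (hatCovector (gaugedPotential (covariant V)) i.succ) p :=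
  ((hV.weightBound_pd_radialGauge hε j).sub (hV.weightBound_succ j)).congr fun p => by
    rw [pd_radialGauge hV.contDiff]
    ring

/-- Exchanging the indices costs z^i F̂_{ij}, already O(⟨z⟩⁻¹). -/
theorem weightBound_sum_radial_pd (hV : PotentialBounds ε V) (hε : 0 < ε) (j : Fin 3) :
    WeightBound fullLog 0 (-1) fun p =>
      ∑ i : Fin 3, p.2 i * pd i.succ (hatCovector (gaugedPotential (covariant V)) j.succ) p :=
  ((hV.weightBound_sum_pd_radial hε j).add
    ((hV.weightBound_radial_space j).weaken fullLog)).congr fun p => by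
    rw [← Finset.sum_add_distrib]
    refine Finset.sum_congr rfl fun i _ => ?_
    rw [← pd_hatCovector_sub hV.contDiff]
    ring

/-- The double contraction is (z·∂ - 1) applied to z^i 𝒜̂_i, by the product rule. -/
theorem weightBound_sum_sum (hV : PotentialBounds ε V) (hε : 0 < ε) (hε1 : ε < 1 / 2) :
    WeightBound fullLog 0 (-ε) fun p => ∑ i : Fin 3, ∑ j : Fin 3,
      p.2 i * p.2 j * pd i.succ (hatCovector (gaugedPotential (covariant V)) j.succ) p :=
  ((hV.weightBound_radial_radialGauge hε hε1).sub (hV.weightBound_radialGauge hε hε1)).congr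
    fun p => by
    rw [← sum_mul_pd, radialGauge, ← Finset.sum_sub_distrib]
    refine Finset.sum_congr rfl fun i _ => ?_
    rw [pd_radialGauge hV.contDiff, mul_add, Finset.mul_sum, add_sub_cancel_right]
    exact Finset.sum_congr rfl fun j _ => by ring

end PotentialBounds

end Gauge

end

/-! ### Uniform constants and assembly of the theorem. -/

section Final

theorem WeightBound.exists_uniform {ι : Type*} [Finite ι] {m : ℝ × Space → ℝ} [hm : LogFactor m]
    {a b : ℝ} {f : ι → ℝ × Space → ℝ} (h : ∀ i, WeightBound m a b (f i)) :
    ∃ C, 0 ≤ C ∧ ∀ i p, |f i p| ≤ C * (m p * monomialWeight a b p) := by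
  choose C hC0 hC using h
  cases nonempty_fintype ι
  refine ⟨∑ i, C i, Finset.sum_nonneg fun i _ => hC0 i, fun i p => (hC i p).trans ?_⟩
  exact mul_le_mul_of_nonneg_right
    (Finset.single_le_sum (fun i _ => hC0 i) (Finset.mem_univ i))
    (mul_nonneg (zero_le_one.trans (hm.one_le p)) (monomialWeight_pos a b p).le)

theorem bracket_rpow_neg (s a : ℝ) : bracket s ^ (-a) = (bracket s ^ a)⁻¹ :=
  Real.rpow_neg (bracket_pos s).le a

theorem PotentialBounds.exists_hatCovector_zero_le {ε : ℝ} {V : Spacetime → Spacetime}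
    (hV : PotentialBounds ε V) (hε : 0 < ε) (hε1 : ε < 1 / 2) :
    ∃ C, 0 ≤ C ∧ ∀ (τ : ℝ) (z : Space),
      |hatCovector (gaugedPotential (covariant V)) 0 (τ, z)| ≤
        C * ((1 + Real.log (bracket τ)) / bracket τ ^ (1 + ε)
          + Real.log (bracket ‖z‖) / bracket τ ^ 3) := by
  obtain ⟨f, g, ⟨C, hC0, hC⟩, ⟨D, hD0, hD⟩, h⟩ := hV.exists_hatCovector_zero_split hε hε1
  refine ⟨C + D, by positivity, fun τ z => ?_⟩
  have hf := hC (τ, z)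
  have hg := hD (τ, z)
  have hT := log_bracket_nonneg τ
  have hZ := log_bracket_nonneg ‖z‖
  have hL := logWeight_nonneg (τ, z)
  have e1 : monomialWeight (-1 - ε) 0 (τ, z) = (bracket τ ^ (1 + ε))⁻¹ := by
    rw [monomialWeight, Real.rpow_zero, mul_one, ← bracket_rpow_neg]
    congr 1
    ring
  have e2 : monomialWeight (-3) 0 (τ, z) = (bracket τ ^ 3)⁻¹ := by
    rw [monomialWeight, Real.rpow_zero, mul_one, bracket_rpow_neg]
    norm_cast
  have e3 : (bracket τ ^ 3)⁻¹ ≤ (bracket τ ^ (1 + ε))⁻¹ := by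
    rw [← e1, ← e2]
    exact monomialWeight_mono (by linarith) le_rfl _
  have hp1 : 0 ≤ (bracket τ ^ 3)⁻¹ := by rw [← e2]; exact (monomialWeight_pos _ _ _).le
  have hp2 : 0 ≤ (bracket τ ^ (1 + ε))⁻¹ := hp1.trans e3
  rw [Pi.one_apply, one_mul, e2, Real.norm_eq_abs] at hg
  rw [e1, timeLog, Real.norm_eq_abs] at hf
  have h1 : |logWeight (τ, z) * g (τ, z)| ≤
      (Real.log (bracket τ) + Real.log (bracket ‖z‖)) * (D * (bracket τ ^ 3)⁻¹) := by
    rw [abs_mul, abs_of_nonneg hL, ← logWeight_eq (τ, z)]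
    gcongr
  have h2 := mul_le_mul_of_nonneg_left e3 hT
  have h3 : Real.log (bracket τ) * (bracket τ ^ 3)⁻¹ ≤
      (1 + Real.log (bracket τ)) * (bracket τ ^ (1 + ε))⁻¹ := by linarith
  rw [h, div_eq_mul_inv, div_eq_mul_inv]
  calc _ ≤ |f (τ, z)| + |logWeight (τ, z) * g (τ, z)| := abs_sub _ _
    _ ≤ C * ((1 + Real.log (bracket τ)) * (bracket τ ^ (1 + ε))⁻¹) +
        (D * (Real.log (bracket τ) * (bracket τ ^ 3)⁻¹) +
          D * (Real.log (bracket ‖z‖) * (bracket τ ^ 3)⁻¹)) := by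
      refine add_le_add hf (h1.trans (le_of_eq ?_))
      ring
    _ ≤ C * ((1 + Real.log (bracket τ)) * (bracket τ ^ (1 + ε))⁻¹) +
        (D * ((1 + Real.log (bracket τ)) * (bracket τ ^ (1 + ε))⁻¹) +
          D * (Real.log (bracket ‖z‖) * (bracket τ ^ 3)⁻¹)) := by gcongr
    _ ≤ _ := by
      have := mul_nonneg hC0 (mul_nonneg hZ hp1)
      linarith

theorem le_of_le_mul_weight {x C K w t : ℝ} (h : x ≤ C * w) (hCK : C ≤ K) (hw : 0 ≤ w)
    (ht : K * w = t) : x ≤ t :=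
  h.trans ((mul_le_mul_of_nonneg_right hCK hw).trans ht.le)

end Final

theorem theoremJ1 (ε : ℝ) (hε : 0 < ε) (hε' : ε < 1 / 2)
    (J Jinc : Spacetime → Spacetime)
    (hJ : IsScatteringCurrent ε J) (hJinc : IsScatteringCurrent ε Jinc)
    (A : Spacetime → Fin 4 → ℝ) (hA : A = lorenzPotential J Jinc)
    (F : Fin 4 → Fin 4 → ℝ × Space → ℝ) (hF : F = hatTensor (fieldStrength A))
    (B : Fin 4 → ℝ × Space → ℝ) (hB : B = hatCovector (gaugedPotential A)) :
    -- `F μ ν` is `F̂_{μν}` and `B μ` is the hatted special gauge potential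
    (∀ a, ContDiff ℝ 3 (fun x => A x a)) ∧
    (∀ μ, ContDiff ℝ 2 (B μ)) ∧
    ∃ K : ℝ, ∀ (τ : ℝ) (z : Space),
      (∀ i : Fin 3, |F i.succ 0 (τ, z)| ≤ K / (bracket τ * bracket ‖z‖)) ∧
      |∑ i : Fin 3, z i * F i.succ 0 (τ, z)| ≤ K / bracket τ ∧
      (∀ i j : Fin 3, |F i.succ j.succ (τ, z)| ≤ K) ∧
      (∀ j : Fin 3, |∑ i : Fin 3, z i * F i.succ j.succ (τ, z)| ≤ K / bracket ‖z‖) ∧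
      |B 0 (τ, z)| ≤
        K * ((1 + Real.log (bracket τ)) / bracket τ ^ (1 + ε)
          + Real.log (bracket ‖z‖) / bracket τ ^ 3) ∧
      (∀ i : Fin 3, |B i.succ (τ, z)| ≤
        K * ((1 + Real.log (bracket τ * bracket ‖z‖)) / bracket ‖z‖)) ∧
      |∑ i : Fin 3, z i * B i.succ (τ, z)| ≤
        K * ((1 + Real.log (bracket τ * bracket ‖z‖)) / bracket ‖z‖ ^ ε) ∧
      (∀ i : Fin 3,
        |pd i.succ (B 0) (τ, z)| + |∑ k : Fin 3, z k * pd k.succ (B 0) (τ, z)| ≤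
          K * ((1 + Real.log (bracket τ)) / bracket τ ^ (1 + ε))) ∧
      (∀ i : Fin 3,
        |pd 0 (B i.succ) (τ, z)| + |∑ k : Fin 3, z k * pd 0 (B k.succ) (τ, z)| ≤
          K / bracket τ) ∧
      (∀ i j : Fin 3, |pd i.succ (B j.succ) (τ, z)| ≤ K * (1 + Real.log (bracket τ))) ∧
      (∀ j : Fin 3,
        |∑ i : Fin 3, z i * pd i.succ (B j.succ) (τ, z)|
            + |∑ i : Fin 3, z i * pd j.succ (B i.succ) (τ, z)| ≤
          K * ((1 + Real.log (bracket τ * bracket ‖z‖)) / bracket ‖z‖)) ∧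
      |∑ i : Fin 3, ∑ j : Fin 3, z i * z j * pd i.succ (B j.succ) (τ, z)| ≤
        K * ((1 + Real.log (bracket τ * bracket ‖z‖)) / bracket ‖z‖ ^ ε) := by
  have hV := potentialBounds_totalPotential hε (by linarith) hJ hJinc
  rw [lorenzPotential_eq] at hA
  change A = covariant (totalPotential J Jinc) at hA
  -- The currents are no longer needed: the bounds on V, including its regularity, imply the rest.
  generalize totalPotential J Jinc = V at hA hV
  subst hA hF hB
  refine ⟨fun a => ?_, contDiff_hatCovector_gaugedPotential hV.contDiff, ?_⟩
  · exact contDiff_const.mul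
      ((EuclideanSpace.proj a : Spacetime →L[ℝ] ℝ).contDiff.comp hV.contDiff)
  have hrad : WeightBound timeLog (-1 - ε) 0 fun p => ∑ k : Fin 3, p.2 k *
      pd k.succ (hatCovector (gaugedPotential (covariant V)) 0) p :=
    (hV.weightBound_radial_zero hε hε').congr fun p => sum_mul_pd _ p
  obtain ⟨C1, h01, h1⟩ := WeightBound.exists_uniform hV.weightBound_space_time
  obtain ⟨C2, h02, h2⟩ := hV.weightBound_radial_time
  obtain ⟨C3, h03, h3⟩ := WeightBound.exists_uniform fun k : Fin 3 × Fin 3 =>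
    hV.weightBound_space_space k.1 k.2
  obtain ⟨C4, h04, h4⟩ := WeightBound.exists_uniform hV.weightBound_radial_space
  obtain ⟨C5, h05, h5⟩ := hV.exists_hatCovector_zero_le hε hε'
  obtain ⟨C6, h06, h6⟩ := WeightBound.exists_uniform hV.weightBound_succ
  obtain ⟨C7, h07, h7⟩ := hV.weightBound_radialGauge hε hε'
  obtain ⟨C8, h08, h8⟩ := WeightBound.exists_uniform (hV.weightBound_pd_zero hε hε')
  obtain ⟨C9, h09, h9⟩ := hrad
  obtain ⟨C10, h010, h10⟩ := WeightBound.exists_uniform (hV.weightBound_pd_time hε hε')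
  obtain ⟨C11, h011, h11⟩ := hV.weightBound_radial_pd_time hε hε'
  obtain ⟨C12, h012, h12⟩ := WeightBound.exists_uniform fun k : Fin 3 × Fin 3 =>
    hV.weightBound_pd_succ k.1 k.2
  obtain ⟨C13, h013, h13⟩ := WeightBound.exists_uniform (hV.weightBound_sum_radial_pd hε)
  obtain ⟨C14, h014, h14⟩ := WeightBound.exists_uniform (hV.weightBound_sum_pd_radial hε)
  obtain ⟨C15, h015, h15⟩ := hV.weightBound_sum_sum hε hε'
  -- All constants are nonnegative, so their sum serves every estimate, including those whose left
  -- side is a sum of two terms.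
  refine ⟨C1 + C2 + C3 + C4 + C5 + C6 + C7 + C8 + C9 + C10 + C11 + C12 + C13 + C14 + C15,
    fun τ z => ?_⟩
  set K := C1 + C2 + C3 + C4 + C5 + C6 + C7 + C8 + C9 + C10 + C11 + C12 + C13 + C14 + C15
    with hK
  have hT := bracket_pos τ
  have hZ := bracket_pos ‖z‖
  have hlT := log_bracket_nonneg τ
  have hlZ := log_bracket_nonneg ‖z‖
  have hlTZ : 0 ≤ Real.log (bracket τ * bracket ‖z‖) := logWeight_nonneg (τ, z)
  have eε : bracket τ ^ (-1 - ε) = (bracket τ ^ (1 + ε))⁻¹ := by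
    rw [← bracket_rpow_neg]
    congr 1
    ring
  simp only [monomialWeight, Pi.one_apply, timeLog, fullLog, logWeight, Real.rpow_neg_one,
    Real.rpow_zero, mul_one, one_mul, bracket_rpow_neg, Real.norm_eq_abs]
    at h1 h2 h3 h4 h6 h7 h8 h9 h10 h11 h12 h13 h14 h15
  refine ⟨fun i => le_of_le_mul_weight (K := K) (h1 i (τ, z)) (by linarith) (by positivity) ?_,
    le_of_le_mul_weight (K := K) (h2 (τ, z)) (by linarith) (by positivity) ?_,
    fun i j => le_of_le_mul_weight (K := K) (w := 1) (by simpa using h3 (i, j) (τ, z)) (by linarith)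
      zero_le_one (mul_one K),
    fun j => le_of_le_mul_weight (K := K) (h4 j (τ, z)) (by linarith) (by positivity) ?_,
    le_of_le_mul_weight (K := K) (h5 τ z) (by linarith) (by positivity) rfl,
    fun i => le_of_le_mul_weight (K := K) (h6 i (τ, z)) (by linarith) (by positivity) ?_,
    le_of_le_mul_weight (K := K) (h7 (τ, z)) (by linarith) (by positivity) ?_,
    fun i => le_of_le_mul_weight (K := K) (C := C8 + C9)
      ((add_le_add (h8 i (τ, z)) (h9 (τ, z))).trans_eq (add_mul C8 C9 _).symm)
      (by linarith) (by rw [eε]; positivity) ?_,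
    fun i => le_of_le_mul_weight (K := K) (C := C10 + C11)
      ((add_le_add (h10 i (τ, z)) (h11 (τ, z))).trans_eq (add_mul C10 C11 _).symm)
      (by linarith) (by positivity) ?_,
    fun i j => le_of_le_mul_weight (K := K) (h12 (i, j) (τ, z)) (by linarith) (by positivity) rfl,
    fun j => le_of_le_mul_weight (K := K) (C := C13 + C14)
      ((add_le_add (h13 j (τ, z)) (h14 j (τ, z))).trans_eq (add_mul C13 C14 _).symm)
      (by linarith) (by positivity) ?_,
    le_of_le_mul_weight (K := K) (h15 (τ, z)) (by linarith) (by positivity) ?_⟩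
  · rw [div_eq_mul_inv, mul_inv]
  · rw [div_eq_mul_inv]
  · rw [div_eq_mul_inv]
  · rw [div_eq_mul_inv]
  · rw [div_eq_mul_inv]
  · rw [div_eq_mul_inv, eε]
  · rw [div_eq_mul_inv]
  · rw [div_eq_mul_inv]
  · rw [div_eq_mul_inv]
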